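/- Every Platonic solid has a non-trivial acute triangulation. That is, let $P\subset\mathbb{R}^3$ be a (solid) regular tetrahedron, cube, regular octahedron, regular dodecahedron or regular icosahedron, of any size and in any position. Then there is a finite geometric simplicial complex $K$ in $\mathbb{R}^3$ whose underlying space is $P$, all of whose maximal simplices are tetrahedra with all six dihedral angles strictly less than $\pi/2$, and which contains at least two tetrahedra. -/

import Mathlib

/-- Euclidean three-space. -/
abbrev E3 : Type := EuclideanSpace ℝ (Fin 3)

/-- The combinatorial types of the Platonic solids. -/
inductive PlatonicType : Type
  | tetrahedron
  | cube
  | octahedron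
  | dodecahedron
  | icosahedron

/-- The vertex set of the standard model of each Platonic solid, centred at the origin
(coordinate indices are taken modulo `3`). -/
def PlatonicType.vertices : PlatonicType → Set E3
  /- `(1,1,1)`, `(1,-1,-1)`, `(-1,1,-1)`, `(-1,-1,1)` -/
  | .tetrahedron => {v | (∀ i, |v i| = 1) ∧ v 0 * v 1 * v 2 = 1}
  /- `(±1,±1,±1)` -/
  | .cube => {v | ∀ i, |v i| = 1}
  /- `(±1,0,0)`, `(0,±1,0)`, `(0,0,±1)` -/
  | .octahedron => {v | ∃ i, |v i| = 1 ∧ v (i + 1) = 0 ∧ v (i + 2) = 0}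
  /- `(±1,±1,±1)` and the cyclic permutations of `(0,±1/φ,±φ)` -/
  | .dodecahedron => {v | (∀ i, |v i| = 1) ∨
      ∃ i, v i = 0 ∧ |v (i + 1)| = Real.goldenRatio⁻¹ ∧ |v (i + 2)| = Real.goldenRatio}
  /- the cyclic permutations of `(0,±1,±φ)` -/
  | .icosahedron => {v | ∃ i, v i = 0 ∧ |v (i + 1)| = 1 ∧ |v (i + 2)| = Real.goldenRatio}

/-- The (solid) standard model of a Platonic solid. -/
def PlatonicType.model (T : PlatonicType) : Set E3 := convexHull ℝ T.vertices

/-- `P` is a Platonic solid: the image of one of the five standard models under a similarity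
`x ↦ c + r • A x` of Euclidean space, with `A` orthogonal and `r > 0`. -/
def IsPlatonicSolid (P : Set E3) : Prop :=
  ∃ (T : PlatonicType) (r : ℝ) (A : E3 ≃ₗᵢ[ℝ] E3) (c : E3),
    0 < r ∧ P = (fun x => c + r • A x) '' T.model

/-- The dihedral angle of the tetrahedron `a b c d` at its edge `a b`: the angle between the
components of `c - a` and `d - a` orthogonal to the edge. -/
noncomputable def dihedralAngle (a b c d : E3) : ℝ :=
  InnerProductGeometry.angle
    ((Submodule.span ℝ {b - a})ᗮ.starProjection (c - a))
    ((Submodule.span ℝ {b - a})ᗮ.starProjection (d - a))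

/-- The tetrahedron with vertex set `s` is acute: all of its dihedral angles are acute. -/
def IsAcuteTetrahedron (s : Finset E3) : Prop :=
  s.card = 4 ∧ AffineIndependent ℝ ((↑) : s → E3) ∧
    ∀ a ∈ s, ∀ b ∈ s, ∀ c ∈ s, ∀ d ∈ s, [a, b, c, d].Nodup →
      dihedralAngle a b c d < Real.pi / 2

/-- `K` is an acute triangulation of `P`: a finite geometric simplicial complex with underlying
space `P`, all of whose maximal simplices are acute tetrahedra. -/
structure IsAcuteTriangulation (K : Geometry.SimplicialComplex ℝ E3) (P : Set E3) : Prop where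
  finite : K.faces.Finite
  space_eq : K.space = P
  acute : ∀ s ∈ K.facets, IsAcuteTetrahedron s

/-- A triangulation is non-trivial if it has more than one tetrahedron. -/
def IsNontrivialTriangulation (K : Geometry.SimplicialComplex ℝ E3) : Prop :=
  ∃ s ∈ K.faces, ∃ t ∈ K.faces, s.card = 4 ∧ t.card = 4 ∧ s ≠ t

/-! Similarities preserve acuteness, so one convenient size of each model suffices. The icosahedron
is the cone from its centre over its boundary triangles. The dodecahedron, the regular tetrahedron
and the trirectangular tetrahedron get explicit meshes, cut out of the boundary complex of the
600-cell, with coordinates in ℤ or ℤ[φ]. The octahedron consists of eight trirectangular tetrahedra,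
one in each octant, which fit together by reflection. The cube consists of an inscribed regular
tetrahedron and four trirectangular corners; each corner is glued along a face on which the two
meshes agree.

The main point is a local criterion for a finite family of simplices in a convex set P to be a
triangulation of P (`IsTiling`): every facet is either shared with a simplex on its other side or
lies in a supporting plane of P, and some point is covered exactly once. Count the simplices
containing a point, with value 2 for an interior point and 1 for a relatively interior point of a
facet. Crossing a shared facet, the gain of one simplex cancels the loss of the other, so the count
is locally constant in the interior of P off the codimension two skeleton (`sumWeight_eventually`).
Generic segments avoid this skeleton, so the count is constant at generic points (`sumWeight_eq`),
and the point covered once makes it 2. Thus the simplices have disjoint interiors and cover P. The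
same count, restricted to the simplices containing a fixed face F and to a small ball around a
relatively interior point of F, shows that every simplex through that point has F as a face
(`IsTiling.support_subset`); this is the face-to-face condition.

The pairing of facets enters in a dual form: every antisymmetric function on facets has sum zero.
This follows directly from a list in which partners are neighbours, and no involution has to be
constructed. Acuteness at an edge is positivity of a polynomial (`dihedralAngle_lt_iff`),
barycentric coordinates are quotients of determinants (`det_eq_coord_mul`), and hence all conditions
on a mesh become finitely many sign tests in exact arithmetic (`Mesh.Valid`), evaluated by the
kernel. -/

namespace AcuteTriangulation

open Set Filter Topology

/-! ### The density of one simplex and its jump across a facet. -/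

section Weights

variable {κ E : Type*} [NormedAddCommGroup E] [NormedSpace ℝ E]

/-- The point `x` lies in the relative interior of the facet of `c` opposite to `c j`. -/
def OnFacet (c : AffineBasis κ ℝ E) (j : κ) (x : E) : Prop :=
  c.coord j x = 0 ∧ ∀ k, k ≠ j → 0 < c.coord k x

open Classical in
/-- Twice the density of the simplex `c` at `x`, up to codimension two: `2` in the interior, `1` in
the relative interior of a facet. -/
noncomputable def weight (c : AffineBasis κ ℝ E) (x : E) : ℤ :=
  if ∀ k, 0 < c.coord k x then 2 else if ∃ j, OnFacet c j x then 1 else 0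

/-- No two barycentric coordinates vanish at `x`. -/
def Regular (c : AffineBasis κ ℝ E) (x : E) : Prop :=
  ∀ j k, j ≠ k → c.coord j x = 0 → c.coord k x ≠ 0

lemma weight_of_pos {c : AffineBasis κ ℝ E} {x : E} (h : ∀ k, 0 < c.coord k x) : weight c x = 2 :=
  if_pos h

lemma weight_nonneg (c : AffineBasis κ ℝ E) (x : E) : 0 ≤ weight c x := by
  unfold weight; split_ifs <;> norm_num

lemma weight_of_neg {c : AffineBasis κ ℝ E} {x : E} {k : κ} (h : c.coord k x < 0) :
    weight c x = 0 := by
  unfold weight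
  rw [if_neg (fun h' => (h' k).not_gt h), if_neg]
  rintro ⟨j, hj, hj'⟩
  by_cases hk : k = j
  · subst hk; exact h.ne hj
  · exact (hj' k hk).not_gt h

lemma weight_of_onFacet {c : AffineBasis κ ℝ E} {x : E} {j : κ} (h : OnFacet c j x) :
    weight c x = 1 := by
  unfold weight
  rw [if_neg (fun h' => (h' j).ne' h.1), if_pos ⟨j, h⟩]

lemma nonneg_of_weight_ne_zero {c : AffineBasis κ ℝ E} {x : E} (h : weight c x ≠ 0) (k : κ) :
    0 ≤ c.coord k x := by
  by_contra! hk
  exact h (weight_of_neg hk)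

variable [Fintype κ]

lemma continuous_coord (c : AffineBasis κ ℝ E) (k : κ) : Continuous (c.coord k) :=
  have := c.finiteDimensional
  AffineMap.continuous_of_finiteDimensional _

open Classical in
-- Near a relatively interior point of a facet only the coordinate that vanishes there can change
-- sign, and the weight is one plus its sign. At any other regular point the weight is locally
-- constant and the sum is empty of nonzero terms.
lemma weight_eventually {c : AffineBasis κ ℝ E} {x₀ : E} (hr : Regular c x₀) :
    ∀ᶠ x in 𝓝 x₀, weight c x = weight c x₀ +
      ∑ j, if OnFacet c j x₀ then ((SignType.sign (c.coord j x) : SignType) : ℤ) else 0 := by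
  have hpos : ∀ k, 0 < c.coord k x₀ → ∀ᶠ x in 𝓝 x₀, 0 < c.coord k x := fun k hk =>
    (continuous_coord c k).continuousAt.eventually (lt_mem_nhds hk)
  by_cases hneg : ∃ k, c.coord k x₀ < 0
  · obtain ⟨k, hk⟩ := hneg
    have := (continuous_coord c k).continuousAt.eventually (gt_mem_nhds hk)
    filter_upwards [this] with x hx
    rw [weight_of_neg hx, weight_of_neg hk, Finset.sum_eq_zero, add_zero]
    intro j _
    rw [if_neg]
    rintro ⟨hj, hj'⟩
    by_cases hkj : k = j
    · subst hkj; exact hk.ne hj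
    · exact (hj' k hkj).not_gt hk
  push Not at hneg
  by_cases hall : ∀ k, 0 < c.coord k x₀
  · filter_upwards [eventually_all.2 fun k => hpos k (hall k)] with x hx
    rw [weight_of_pos hx, weight_of_pos hall, Finset.sum_eq_zero, add_zero]
    exact fun j _ => if_neg fun h => (hall j).ne' h.1
  · push Not at hall
    obtain ⟨j, hj⟩ := hall
    have hj0 : c.coord j x₀ = 0 := le_antisymm hj (hneg j)
    have hF : OnFacet c j x₀ :=
      ⟨hj0, fun k hk => lt_of_le_of_ne (hneg k) (Ne.symm (hr j k hk.symm hj0))⟩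
    have hev : ∀ᶠ x in 𝓝 x₀, ∀ k, k ≠ j → 0 < c.coord k x :=
      eventually_all.2 fun k => by
        by_cases hk : k = j
        · simp [hk]
        · filter_upwards [hpos k (hF.2 k hk)] with x hx _ using hx
    filter_upwards [hev] with x hx
    rw [weight_of_onFacet hF, Finset.sum_eq_single j, if_pos hF]
    · rcases lt_trichotomy (c.coord j x) 0 with h | h | h
      · rw [weight_of_neg h, sign_neg h]; rfl
      · rw [weight_of_onFacet ⟨h, hx⟩, h, sign_zero]; rfl
      · rw [sign_pos h, weight_of_pos]
        · rfl
        · intro k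
          by_cases hk : k = j
          · rw [hk]; exact h
          · exact hx k hk
    · intro k _ hk
      exact if_neg fun h => (hF.2 k hk).ne' h.1
    · simp

lemma affineMap_eq_sum (c : AffineBasis κ ℝ E) (f : E →ᵃ[ℝ] ℝ) (x : E) :
    f x = ∑ k, c.coord k x * f (c k) := by
  conv_lhs => rw [← c.affineCombination_coord_eq_self x]
  rw [Finset.map_affineCombination _ _ _ (c.sum_coord_apply_eq_one x),
    Finset.affineCombination_eq_linear_combination _ _ _ (c.sum_coord_apply_eq_one x)]
  simp

/-- `c` and `c'` share the facet opposite to the vertex with index `l`, and lie on opposite sides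
of it. -/
def Opposite (l : κ) (c c' : AffineBasis κ ℝ E) : Prop :=
  (∀ k, k ≠ l → c k = c' k) ∧ c'.coord l (c l) < 0

/-- Both coordinates are affine and vanish on the common facet, so they are proportional; the factor
is read off at `c l` and is negative. This is why the two signs cancel. -/
lemma Opposite.coord_eq {l : κ} {c c' : AffineBasis κ ℝ E} (h : Opposite l c c') (x : E) :
    c'.coord l x = c'.coord l (c l) * c.coord l x := by
  rw [affineMap_eq_sum c (c'.coord l) x, Finset.sum_eq_single l, mul_comm]
  · intro k _ hk
    rw [h.1 k hk, AffineBasis.coord_apply_ne _ (Ne.symm hk), mul_zero]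
  · simp

lemma Opposite.sign_coord {l : κ} {c c' : AffineBasis κ ℝ E} (h : Opposite l c c') (x : E) :
    SignType.sign (c'.coord l x) = - SignType.sign (c.coord l x) := by
  rw [h.coord_eq, sign_mul, sign_neg h.2]; simp

lemma Opposite.onFacet_imp {l : κ} {c c' : AffineBasis κ ℝ E} (h : Opposite l c c') {x : E}
    (hx : OnFacet c l x) : OnFacet c' l x := by
  refine ⟨by rw [h.coord_eq, hx.1, mul_zero], fun k hk => ?_⟩
  rw [affineMap_eq_sum c (c'.coord k) x, Finset.sum_eq_single k]
  · rw [h.1 k hk, AffineBasis.coord_apply_eq, mul_one]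
    exact hx.2 k hk
  · intro m _ hm
    by_cases hml : m = l
    · rw [hml, hx.1, zero_mul]
    · rw [h.1 m hml, AffineBasis.coord_apply_ne _ (Ne.symm hm), mul_zero]
  · simp

lemma Opposite.symm {l : κ} {c c' : AffineBasis κ ℝ E} (h : Opposite l c c') :
    Opposite l c' c := by
  refine ⟨fun k hk => (h.1 k hk).symm, ?_⟩
  have := h.coord_eq (c' l)
  rw [AffineBasis.coord_apply_eq] at this
  nlinarith [h.2]

lemma Opposite.onFacet_iff {l : κ} {c c' : AffineBasis κ ℝ E} (h : Opposite l c c') {x : E} :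
    OnFacet c l x ↔ OnFacet c' l x :=
  ⟨h.onFacet_imp, h.symm.onFacet_imp⟩

end Weights

/-- A zero of `f` is the limit of points on the line towards `p`, along which `f` is a nonzero
multiple of the parameter. -/
lemma dense_affineMap_ne_zero {E : Type*} [NormedAddCommGroup E] [NormedSpace ℝ E]
    (f : E →ᵃ[ℝ] ℝ) (hf : ∃ p, f p ≠ 0) : Dense {x | f x ≠ 0} := by
  obtain ⟨p, hp⟩ := hf
  intro y
  by_cases hy : f y = 0
  · have hc : Tendsto (fun u : ℝ => AffineMap.lineMap y p u) (𝓝[≠] 0) (𝓝 y) := by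
      have : Continuous fun u : ℝ => AffineMap.lineMap (k := ℝ) y p u := AffineMap.lineMap_continuous
      have h0 := this.tendsto 0
      rw [AffineMap.lineMap_apply_zero] at h0
      exact h0.mono_left nhdsWithin_le_nhds
    refine mem_closure_of_tendsto hc ?_
    filter_upwards [self_mem_nhdsWithin] with u hu
    have : f (AffineMap.lineMap y p u) = u * f p := by
      rw [AffineMap.apply_lineMap, AffineMap.lineMap_apply, hy]; simp
    show f _ ≠ 0
    rw [this]
    exact mul_ne_zero hu hp
  · exact subset_closure hy

lemma dense_forall_affineMap_ne_zero {E α : Type*} [NormedAddCommGroup E] [NormedSpace ℝ E]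
    [FiniteDimensional ℝ E] [Finite α] (f : α → E →ᵃ[ℝ] ℝ) (hf : ∀ a, ∃ p, f a p ≠ 0) :
    Dense {x | ∀ a, f a x ≠ 0} := by
  have := FiniteDimensional.complete ℝ E
  rw [ofPred_forall]
  refine dense_iInter_of_isOpen (fun a => ?_) fun a => dense_affineMap_ne_zero _ (hf a)
  exact isOpen_ne_fun (AffineMap.continuous_of_finiteDimensional _) continuous_const

end AcuteTriangulation

namespace AcuteTriangulation

open Set Filter Topology

/-! ### From pairing of facets to a simplicial complex. -/

section Tiling

variable {ι κ E : Type*} [Fintype ι] [Fintype κ] [NormedAddCommGroup E] [NormedSpace ℝ E]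

/-- The simplex `c` with its vertices rearranged by `σ`. -/
noncomputable def rearrange (c : AffineBasis κ ℝ E) (σ : Equiv.Perm κ) : AffineBasis κ ℝ E :=
  c.reindex σ.symm

omit [Fintype κ] in
lemma rearrange_apply (c : AffineBasis κ ℝ E) (σ : Equiv.Perm κ) (k : κ) :
    rearrange c σ k = c (σ k) := by
  simp [rearrange]

omit [Fintype κ] in
lemma rearrange_coord (c : AffineBasis κ ℝ E) (σ : Equiv.Perm κ) (k : κ) :
    (rearrange c σ).coord k = c.coord (σ k) := by
  simp [rearrange, AffineBasis.coord_reindex]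

omit [Fintype κ] in
lemma range_rearrange (c : AffineBasis κ ℝ E) (σ : Equiv.Perm κ) :
    range (rearrange c σ) = range c := by
  have : (rearrange c σ : κ → E) = c ∘ σ := funext (rearrange_apply c σ)
  rw [this, σ.surjective.range_comp]

omit [Fintype κ] in
lemma onFacet_rearrange (c : AffineBasis κ ℝ E) (σ : Equiv.Perm κ) (l : κ) (x : E) :
    OnFacet (rearrange c σ) l x ↔ OnFacet c (σ l) x := by
  unfold OnFacet
  simp only [rearrange_coord]
  refine and_congr_right fun _ => ⟨fun h k hk => ?_, fun h k hk => h _ (σ.injective.ne hk)⟩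
  have := h (σ.symm k) (fun h' => hk (by rw [← h', Equiv.apply_symm_apply]))
  rwa [Equiv.apply_symm_apply] at this

/-- The facets of the simplices `b i` cancel in pairs inside `P`: every function on pairs
(simplex, facet), presented as simplices with the distinguished vertex `l` opposite to the facet,
has sum zero if it is antisymmetric for pairs of simplices adjacent along a facet, and zero at
facets supporting `P`. -/
structure FacetPaired (l : κ) (ρ : κ → Equiv.Perm κ) (b : ι → AffineBasis κ ℝ E) (P : Set E) :
    Prop where
  perm_apply : ∀ j, ρ j l = j
  sum_eq_zero : ∀ g : AffineBasis κ ℝ E → ℤ,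
    (∀ i j i' j', Opposite l (rearrange (b i) (ρ j)) (rearrange (b i') (ρ j')) →
      g (rearrange (b i) (ρ j)) + g (rearrange (b i') (ρ j')) = 0) →
    (∀ i j, (∀ x ∈ P, 0 ≤ (b i).coord j x) → g (rearrange (b i) (ρ j)) = 0) →
    ∑ i, ∑ j, g (rearrange (b i) (ρ j)) = 0

open Classical in
/-- Twice the number of simplices `b i` with property `A` that contain `x`, up to codimension
two. -/
noncomputable def sumWeight (A : Set E → Prop) (b : ι → AffineBasis κ ℝ E) (x : E) : ℤ :=
  ∑ i, if A (range (b i)) then weight (b i) x else 0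

variable {l : κ} {ρ : κ → Equiv.Perm κ} {b : ι → AffineBasis κ ℝ E} {P : Set E}

omit [Fintype κ] in
-- From a zero in the interior one could move a little away from the vertex `c j`, staying in `P`
-- and making the coordinate negative. So unpaired facets do not meet the interior.
lemma coord_ne_zero_of_mem_interior {c : AffineBasis κ ℝ E} {j : κ}
    (hP : ∀ x ∈ P, 0 ≤ c.coord j x) {x₀ : E} (hx₀ : x₀ ∈ interior P) : c.coord j x₀ ≠ 0 := by
  intro h0
  have hc : Continuous fun u : ℝ => AffineMap.lineMap (k := ℝ) x₀ (c j) u :=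
    AffineMap.lineMap_continuous
  have h1 := hc.tendsto 0
  rw [AffineMap.lineMap_apply_zero] at h1
  have h2 := h1.eventually (mem_interior_iff_mem_nhds.1 hx₀)
  obtain ⟨u, hu, hu0⟩ : ∃ u : ℝ, AffineMap.lineMap (k := ℝ) x₀ (c j) u ∈ P ∧ u < 0 := by
    have h3 : ∀ᶠ u : ℝ in 𝓝[<] 0, AffineMap.lineMap (k := ℝ) x₀ (c j) u ∈ P :=
      h2.filter_mono nhdsWithin_le_nhds
    exact (h3.and self_mem_nhdsWithin).exists
  have := hP _ hu
  rw [AffineMap.apply_lineMap, AffineMap.lineMap_apply, h0, AffineBasis.coord_apply_eq] at this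
  simp at this
  linarith

/-- Adjacent simplices whose common facet contains `x` either both have property `A` or none. -/
def StarClosed (l : κ) (ρ : κ → Equiv.Perm κ) (b : ι → AffineBasis κ ℝ E) (A : Set E → Prop)
    (x : E) : Prop :=
  ∀ i j i' j', Opposite l (rearrange (b i) (ρ j)) (rearrange (b i') (ρ j')) →
    OnFacet (b i) (ρ j l) x → (A (range (b i)) ↔ A (range (b i')))

omit [Fintype ι] in
lemma Opposite.onFacet_base_iff {i i' : ι} {j j' : κ}
    (h : Opposite l (rearrange (b i) (ρ j)) (rearrange (b i') (ρ j'))) (x : E) :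
    OnFacet (b i) (ρ j l) x ↔ OnFacet (b i') (ρ j' l) x := by
  rw [← onFacet_rearrange, ← onFacet_rearrange]
  exact h.onFacet_iff

/-- The change of the count is the sum of the jumps over all facets through `x₀`. The jumps are
antisymmetric for adjacent simplices, by opposite signs and star-closedness, and vanish for
supporting facets, so the pairing hypothesis applies to them. -/
lemma sumWeight_eventually (h : FacetPaired l ρ b P) {A : Set E → Prop} {x₀ : E}
    (hx₀ : x₀ ∈ interior P) (hreg : ∀ i, Regular (b i) x₀) (hA : StarClosed l ρ b A x₀) :
    ∀ᶠ x in 𝓝 x₀, sumWeight A b x = sumWeight A b x₀ := by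
  classical
  filter_upwards [eventually_all.2 fun i => weight_eventually (hreg i)] with x hx
  let g : AffineBasis κ ℝ E → ℤ := fun c =>
    if A (range c) ∧ OnFacet c l x₀ then ((SignType.sign (c.coord l x) : SignType) : ℤ) else 0
  have hg : ∀ i j, g (rearrange (b i) (ρ j)) = if A (range (b i)) then
      (if OnFacet (b i) j x₀ then ((SignType.sign ((b i).coord j x) : SignType) : ℤ) else 0)
      else 0 := by
    intro i j
    simp only [g, range_rearrange, onFacet_rearrange, rearrange_coord, h.perm_apply]
    by_cases h1 : A (range (b i)) <;> simp [h1]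
  have key := h.sum_eq_zero g ?_ ?_
  · have h1 : sumWeight A b x = sumWeight A b x₀ + ∑ i, ∑ j, g (rearrange (b i) (ρ j)) := by
      unfold sumWeight
      rw [← Finset.sum_add_distrib]
      refine Finset.sum_congr rfl fun i _ => ?_
      simp only [hg]
      by_cases hi : A (range (b i))
      · simp only [hi, if_true]; exact hx i
      · simp [hi]
    rw [h1, key, add_zero]
  · intro i j i' j' hop
    have e1 := hop.onFacet_base_iff x₀
    simp only [g, range_rearrange, onFacet_rearrange, hop.sign_coord x]
    by_cases h1 : OnFacet (b i) (ρ j l) x₀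
    · have h2 := e1.1 h1
      have h3 := hA i j i' j' hop h1
      by_cases h4 : A (range (b i))
      · rw [if_pos ⟨h4, h1⟩, if_pos ⟨h3.1 h4, h2⟩]
        cases SignType.sign ((rearrange (b i) (ρ j)).coord l x) <;> rfl
      · rw [if_neg (fun h => h4 h.1), if_neg (fun h => h4 (h3.2 h.1)), add_zero]
    · rw [if_neg (fun h => h1 h.2), if_neg (fun h => h1 (e1.2 h.2)), add_zero]
  · intro i j hP
    rw [hg]
    have : ¬ OnFacet (b i) j x₀ := fun h' => coord_ne_zero_of_mem_interior hP hx₀ h'.1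
    simp [this]

/-- No barycentric coordinate of any of the simplices vanishes at `x`. -/
def Generic (b : ι → AffineBasis κ ℝ E) (x : E) : Prop := ∀ i k, (b i).coord k x ≠ 0

lemma dense_generic (b : ι → AffineBasis κ ℝ E) [FiniteDimensional ℝ E] :
    Dense {x | Generic b x} := by
  have := dense_forall_affineMap_ne_zero (fun a : ι × κ => (b a.1).coord a.2)
    fun a => ⟨b a.1 a.2, by simp⟩
  exact this.mono fun x (hx : ∀ a : ι × κ, _) i k => hx (i, k)

omit [Fintype κ] [Fintype ι] in
lemma Generic.regular {x : E} (h : Generic b x) (i : ι) : Regular (b i) x :=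
  fun _ k _ _ => h i k

/-- For generic `x`, almost all points `y` are such that the segment from `x` to `y` avoids the
codimension two skeleton. -/
lemma dense_segment_regular [FiniteDimensional ℝ E] {x : E} (hx : Generic b x) :
    Dense {y | ∀ z ∈ segment ℝ x y, ∀ i, Regular (b i) z} := by
  -- If two coordinates vanish together on the segment, their vectors of values at `x` and `y` are
  -- dependent. This 2 × 2 determinant is affine in `y`, and at the vertex `b i k` it is the nonzero
  -- value of the `j`-th coordinate at `x`.
  let f : ι × {p : κ × κ // p.1 ≠ p.2} → E →ᵃ[ℝ] ℝ := fun a =>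
    (b a.1).coord a.2.1.1 x • (b a.1).coord a.2.1.2 - (b a.1).coord a.2.1.2 x • (b a.1).coord a.2.1.1
  refine (dense_forall_affineMap_ne_zero f ?_).mono ?_
  · rintro ⟨i, ⟨⟨j, k⟩, hjk⟩⟩
    refine ⟨b i k, ?_⟩
    simp only [f, AffineMap.coe_sub, AffineMap.coe_smul, Pi.sub_apply, Pi.smul_apply,
      AffineBasis.coord_apply_eq, AffineBasis.coord_apply_ne _ hjk, smul_eq_mul]
    simpa using hx i j
  · rintro y hy z ⟨u, v, hu, hv, huv, rfl⟩ i j k hjk h1 h2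
    have hz : u • x + v • y = AffineMap.lineMap (k := ℝ) x y v := by
      rw [AffineMap.lineMap_apply_module, ← huv]; simp
    rw [hz, AffineMap.apply_lineMap, AffineMap.lineMap_apply_module, smul_eq_mul,
      smul_eq_mul] at h1 h2
    have hv0 : v ≠ 0 := by
      rintro rfl
      simp at h1
      exact hx i j h1
    apply hy (i, ⟨(j, k), hjk⟩)
    simp only [f, AffineMap.coe_sub, AffineMap.coe_smul, Pi.sub_apply, Pi.smul_apply, smul_eq_mul]
    apply mul_left_cancel₀ hv0
    linear_combination (b i).coord j x * h2 - (b i).coord k x * h1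

variable [FiniteDimensional ℝ E]

/-- The segment from `x` to `y` itself may meet the codimension two skeleton. Since the count is
constant near `y`, the endpoint can be perturbed, and a locally constant function on a segment is
constant. -/
lemma sumWeight_eq (h : FacetPaired l ρ b P) {A : Set E → Prop} {U : Set E} (hU : IsOpen U)
    (hUc : Convex ℝ U) (hUP : U ⊆ interior P) (hA : ∀ x ∈ U, StarClosed l ρ b A x)
    {x y : E} (hx : x ∈ U) (hy : y ∈ U) (hgx : Generic b x) (hgy : Generic b y) :
    sumWeight A b x = sumWeight A b y := by
  have h1 := sumWeight_eventually h (hUP hy) hgy.regular (hA y hy)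
  obtain ⟨V, hV, hVo, hyV⟩ := eventually_nhds_iff.1 (h1.and (hU.mem_nhds hy))
  obtain ⟨y', hy'V, hy'⟩ := (dense_segment_regular hgx).inter_open_nonempty V hVo ⟨y, hyV⟩
  rw [← (hV y' hy'V).1]
  have hseg : segment ℝ x y' ⊆ U := hUc.segment_subset hx (hV y' hy'V).2
  refine (convex_segment x y').isPreconnected.constant (f := sumWeight A b) ?_
    (left_mem_segment ℝ x y') (right_mem_segment ℝ x y')
  intro z hz
  have hev := sumWeight_eventually h (hUP (hseg hz)) (hy' z hz) (hA z (hseg hz))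
  refine ContinuousAt.continuousWithinAt ?_
  exact (continuousAt_const (y := sumWeight A b z)).congr (hev.mono fun w hw => hw.symm)

omit [FiniteDimensional ℝ E] in
lemma isOpen_forall_coord_pos (c : AffineBasis κ ℝ E) : IsOpen {x | ∀ k, 0 < c.coord k x} := by
  rw [ofPred_forall]
  exact isOpen_iInter_of_finite fun k => isOpen_lt continuous_const (continuous_coord c k)

omit [FiniteDimensional ℝ E] in
lemma isClosed_forall_coord_nonneg (c : AffineBasis κ ℝ E) :
    IsClosed {x | ∀ k, 0 ≤ c.coord k x} := by
  rw [ofPred_forall]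
  exact isClosed_iInter fun k => isClosed_le continuous_const (continuous_coord c k)

/-- If a nonempty star-closed subfamily meets the convex open set `U`, it covers it. -/
lemma exists_coord_pos (h : FacetPaired l ρ b P) {A : Set E → Prop} {U : Set E} (hU : IsOpen U)
    (hUc : Convex ℝ U) (hUP : U ⊆ interior P) (hA : ∀ x ∈ U, StarClosed l ρ b A x)
    {i : ι} (hi : A (range (b i))) {q : E} (hq : q ∈ U) (hiq : ∀ k, 0 < (b i).coord k q)
    {x : E} (hx : x ∈ U) (hgx : Generic b x) :
    ∃ j, A (range (b j)) ∧ ∀ k, 0 < (b j).coord k x := by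
  classical
  obtain ⟨q', ⟨hq'U, hq'i⟩, hq'g⟩ := (dense_generic b).inter_open_nonempty
    (U ∩ {x | ∀ k, 0 < (b i).coord k x}) (hU.inter (isOpen_forall_coord_pos _)) ⟨q, hq, hiq⟩
  have heq := sumWeight_eq h hU hUc hUP hA hq'U hx hq'g hgx
  have hpos : 0 < sumWeight A b q' := by
    refine lt_of_lt_of_le ?_ (Finset.single_le_sum (f := fun i =>
      if A (range (b i)) then weight (b i) q' else 0) ?_ (Finset.mem_univ i))
    · simp only [hi, if_true, weight_of_pos hq'i]; norm_num
    · intro j _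
      split_ifs
      exacts [weight_nonneg _ _, le_rfl]
  rw [heq] at hpos
  obtain ⟨j, _, hj⟩ := Finset.exists_ne_zero_of_sum_ne_zero hpos.ne'
  by_cases hAj : A (range (b j))
  · rw [if_pos hAj] at hj
    exact ⟨j, hAj, fun k => lt_of_le_of_ne (nonneg_of_weight_ne_zero hj k) (hgx j k).symm⟩
  · simp [hAj] at hj

/-- A family of simplices in the convex set `P` whose facets cancel in pairs, with a point covered
exactly once. -/
structure IsTiling (l : κ) (ρ : κ → Equiv.Perm κ) (b : ι → AffineBasis κ ℝ E) (P : Set E) : Prop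
    extends FacetPaired l ρ b P where
  convex : Convex ℝ P
  mem : ∀ i k, b i k ∈ P
  covered_once : ∃ i p, (∀ k, 0 < (b i).coord k p) ∧ ∀ j, j ≠ i → ∃ k, (b j).coord k p < 0

namespace IsTiling

omit [FiniteDimensional ℝ E] in
lemma nonneg_subset (h : IsTiling l ρ b P) (i : ι) : {x | ∀ k, 0 ≤ (b i).coord k x} ⊆ P := by
  rw [← AffineBasis.convexHull_eq_nonneg_coord]
  refine convexHull_min ?_ h.convex
  rintro _ ⟨k, rfl⟩
  exact h.mem i k

omit [FiniteDimensional ℝ E] in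
lemma pos_subset (h : IsTiling l ρ b P) (i : ι) :
    {x | ∀ k, 0 < (b i).coord k x} ⊆ interior P :=
  interior_maximal (Subset.trans (fun _ hx k => (hx k).le) (h.nonneg_subset i))
    (isOpen_forall_coord_pos _)

omit [Fintype κ] [FiniteDimensional ℝ E] [Fintype ι] in
lemma starClosed_true (x : E) : StarClosed l ρ b (fun _ => True) x :=
  fun _ _ _ _ _ _ => Iff.rfl

lemma sumWeight_eq_two (h : IsTiling l ρ b P) {x : E} (hx : x ∈ interior P) (hgx : Generic b x) :
    sumWeight (fun _ => True) b x = 2 := by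
  classical
  obtain ⟨i, p, hp, hj⟩ := h.covered_once
  -- Covering by exactly one simplex is an open condition in its strict form, so the given point can
  -- be replaced by a generic one.
  have hN : IsOpen ({x | ∀ k, 0 < (b i).coord k x} ∩
      ⋂ j : {j // j ≠ i}, {x | ∃ k, (b j).coord k x < 0}) := by
    refine (isOpen_forall_coord_pos _).inter (isOpen_iInter_of_finite fun j => ?_)
    rw [ofPred_exists]
    exact isOpen_iUnion fun k => isOpen_lt (continuous_coord _ k) continuous_const
  obtain ⟨q, ⟨hqi, hqj⟩, hqg⟩ := (dense_generic b).inter_open_nonempty _ hN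
    ⟨p, hp, mem_iInter.2 fun j => hj j j.2⟩
  rw [sumWeight_eq h.toFacetPaired isOpen_interior h.convex.interior subset_rfl
    (fun x _ => starClosed_true x) hx (h.pos_subset i hqi) hgx hqg]
  unfold sumWeight
  rw [Finset.sum_eq_single i]
  · rw [if_pos trivial, weight_of_pos hqi]
  · intro j _ hji
    obtain ⟨k, hk⟩ := mem_iInter.1 hqj ⟨j, hji⟩
    rw [if_pos trivial, weight_of_neg hk]
  · simp

/-- Two overlapping interiors would give a generic point with count at least four instead of two. -/
lemma eq_of_coord_pos (h : IsTiling l ρ b P) {i j : ι} {x : E} (hi : ∀ k, 0 < (b i).coord k x)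
    (hj : ∀ k, 0 < (b j).coord k x) : i = j := by
  classical
  by_contra hij
  obtain ⟨y, ⟨hyi, hyj⟩, hyg⟩ := (dense_generic b).inter_open_nonempty _
    ((isOpen_forall_coord_pos (b i)).inter (isOpen_forall_coord_pos (b j))) ⟨x, hi, hj⟩
  have h2 := h.sumWeight_eq_two (h.pos_subset i hyi) hyg
  have hs : sumWeight (fun _ => True) b y = ∑ m, weight (b m) y := by simp [sumWeight]
  have h4 : ∑ m ∈ ({i, j} : Finset ι), weight (b m) y ≤ ∑ m, weight (b m) y :=
    Finset.sum_le_sum_of_subset_of_nonneg (Finset.subset_univ _) fun m _ _ => weight_nonneg _ _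
  rw [Finset.sum_pair hij, weight_of_pos hyi, weight_of_pos hyj, ← hs, h2] at h4
  norm_num at h4

omit [FiniteDimensional ℝ E] [Fintype ι] in
lemma mem_closure_pos {c : AffineBasis κ ℝ E} {x : E} (hx : ∀ k, 0 ≤ c.coord k x) :
    x ∈ closure {x | ∀ k, 0 < c.coord k x} := by
  rw [← AffineBasis.interior_convexHull, Convex.closure_interior_eq_closure_of_nonempty_interior
    (convex_convexHull ℝ _)]
  · apply subset_closure
    rw [AffineBasis.convexHull_eq_nonneg_coord]
    exact hx
  · have := c.finiteDimensional
    rw [interior_convexHull_nonempty_iff_affineSpan_eq_top]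
    exact c.tot

/-- The union of the simplices is closed and contains all generic interior points; these are dense
in the convex set `P`, whose interior is nonempty. -/
lemma exists_coord_nonneg (h : IsTiling l ρ b P) {x : E} (hx : x ∈ P) :
    ∃ i, ∀ k, 0 ≤ (b i).coord k x := by
  obtain ⟨i, p, hp, -⟩ := h.covered_once
  have hne : (interior P).Nonempty := ⟨p, h.pos_subset i hp⟩
  have hd : interior P ⊆ closure (interior P ∩ {x | Generic b x}) :=
    (dense_generic b).open_subset_closure_inter isOpen_interior
  have hsub : interior P ∩ {x | Generic b x} ⊆ ⋃ i, {x | ∀ k, 0 ≤ (b i).coord k x} := by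
    rintro y ⟨hy, hyg⟩
    obtain ⟨j, -, hj⟩ := exists_coord_pos h.toFacetPaired (A := fun _ => True) isOpen_interior
      h.convex.interior subset_rfl (fun x _ => starClosed_true x) trivial (h.pos_subset i hp) hp
      hy hyg
    exact mem_iUnion.2 ⟨j, fun k => (hj k).le⟩
  have hcl : IsClosed (⋃ i, {x | ∀ k, 0 ≤ (b i).coord k x}) :=
    isClosed_iUnion_of_finite fun i => isClosed_forall_coord_nonneg _
  have hxc : x ∈ closure (interior P) := by
    rw [h.convex.closure_interior_eq_closure_of_nonempty_interior hne]
    exact subset_closure hx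
  have := closure_minimal (hd.trans (closure_minimal hsub hcl)) hcl hxc
  exact mem_iUnion.1 this

omit [FiniteDimensional ℝ E] [Fintype κ] [Fintype ι] in
lemma coord_eq_zero_of_mem_convexHull {c : AffineBasis κ ℝ E} {s : Set E} (hs : s ⊆ range c)
    {x : E} (hx : x ∈ convexHull ℝ s) {k : κ} (hk : c k ∉ s) : c.coord k x = 0 := by
  have : s ⊆ (c.coord k) ⁻¹' {0} := by
    intro y hy
    obtain ⟨m, rfl⟩ := hs hy
    have hkm : k ≠ m := by rintro rfl; exact hk hy
    simp [AffineBasis.coord_apply_ne _ hkm]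
  exact convexHull_min this ((convex_singleton 0).affine_preimage _) hx

omit [FiniteDimensional ℝ E] [Fintype ι] in
lemma mem_convexHull_support {c : AffineBasis κ ℝ E} {x : E} (hx : ∀ k, 0 ≤ c.coord k x) :
    x ∈ convexHull ℝ (c '' {k | 0 < c.coord k x}) := by
  classical
  have h2 : ∑ k ∈ Finset.univ.filter (fun k => 0 < c.coord k x), c.coord k x • c k = x := by
    rw [Finset.sum_filter_of_ne, c.linear_combination_coord_eq_self x]
    intro k _ hk
    refine lt_of_le_of_ne (hx k) fun h => hk ?_
    rw [← h, zero_smul]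
  have h3 : ∑ k ∈ Finset.univ.filter (fun k => 0 < c.coord k x), c.coord k x = 1 := by
    rw [Finset.sum_filter_of_ne, c.sum_coord_apply_eq_one]
    intro k _ hk
    exact lt_of_le_of_ne (hx k) hk.symm
  have h4 := (convex_convexHull ℝ (c '' {k | 0 < c.coord k x})).sum_mem
    (fun k _ => hx k) h3 fun k hk => subset_convexHull ℝ _ ⟨k, by simpa using hk, rfl⟩
  rwa [h2] at h4

omit [FiniteDimensional ℝ E] [Fintype κ] [Fintype ι] in
-- The two coordinates are affine functions that agree at every vertex of the common face `F`.
lemma coord_eq_coord {c c' : AffineBasis κ ℝ E} {F : Set E} (hc : F ⊆ range c)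
    (hc' : F ⊆ range c') {x : E} (hx : x ∈ convexHull ℝ F) {m k : κ} (h : c m = c' k) :
    c.coord m x = c'.coord k x := by
  have hle : F ⊆ (c.coord m - c'.coord k) ⁻¹' {0} := by
    intro z hz
    obtain ⟨k', rfl⟩ := hc' hz
    obtain ⟨m', hmk'⟩ := hc hz
    by_cases hmm : m = m'
    · subst hmm
      obtain rfl : k = k' := c'.ind.injective (h.symm.trans hmk')
      have h1 : c.coord m (c' k) = 1 := by rw [← h, AffineBasis.coord_apply_eq]
      simp [h1]
    · have hkk : k ≠ k' := by
        rintro rfl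
        exact hmm (c.ind.injective (h.trans hmk'.symm))
      have h1 : c.coord m (c' k') = 0 := by rw [← hmk', AffineBasis.coord_apply_ne _ hmm]
      simp [h1, AffineBasis.coord_apply_ne _ hkk]
  have := convexHull_min hle ((convex_singleton (0 : ℝ)).affine_preimage _) hx
  simpa [sub_eq_zero] using this

/-- Let `F` be the face of `b i` with `x` in its relative interior. Near `x`, the simplices having
`F` as a face form a star-closed family, so they cover all generic points there. Some of these
points lie in the interior of `b j`, which therefore belongs to the family by disjointness of
interiors. -/
lemma support_subset (h : IsTiling l ρ b P) {i j : ι} {x : E} (hi : ∀ k, 0 ≤ (b i).coord k x)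
    (hj : ∀ k, 0 ≤ (b j).coord k x) : b i '' {k | 0 < (b i).coord k x} ⊆ range (b j) := by
  set F := b i '' {k | 0 < (b i).coord k x} with hF
  have hxF : x ∈ convexHull ℝ F := mem_convexHull_support hi
  have hev : ∀ᶠ y in 𝓝 x, ∀ i' k, 0 < (b i').coord k x → 0 < (b i').coord k y := by
    refine eventually_all.2 fun i' => eventually_all.2 fun k => ?_
    by_cases hk : 0 < (b i').coord k x
    · exact ((continuous_coord _ k).continuousAt.eventually (lt_mem_nhds hk)).mono fun _ h _ => h
    · simp [hk]
  obtain ⟨ε, hε, hball⟩ := Metric.eventually_nhds_iff_ball.1 hev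
  have hpos : ∀ i' k, F ⊆ range (b i') → b i' k ∈ F → 0 < (b i').coord k x := by
    rintro i' k hFi' ⟨m, hm, hmk⟩
    rw [← coord_eq_coord (image_subset_range _ _) hFi' hxF hmk]
    exact hm
  -- In this ball the coordinates belonging to vertices of `F` stay positive. So a facet through `z`
  -- is opposite to a vertex outside `F`; it contains `F`, and so does the neighbour across it.
  have hAux : ∀ z ∈ Metric.ball x ε, ∀ i₁ j₁ i₂ j₂,
      Opposite l (rearrange (b i₁) (ρ j₁)) (rearrange (b i₂) (ρ j₂)) →
      OnFacet (b i₁) (ρ j₁ l) z → F ⊆ range (b i₁) → F ⊆ range (b i₂) := by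
    intro z hz i₁ j₁ i₂ j₂ hop hon hF1 y hy
    obtain ⟨k, rfl⟩ := hF1 hy
    have h1 := hball z hz i₁ k (hpos i₁ k hF1 hy)
    have hk : (ρ j₁).symm k ≠ l := by
      rintro rfl
      rw [Equiv.apply_symm_apply] at hon
      exact h1.ne' hon.1
    have := hop.1 _ hk
    rw [rearrange_apply, rearrange_apply, Equiv.apply_symm_apply] at this
    rw [this]
    exact mem_range_self _
  have hstar : ∀ z ∈ Metric.ball x ε ∩ interior P, StarClosed l ρ b (fun t => F ⊆ t) z := by
    intro z hz i₁ j₁ i₂ j₂ hop hon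
    exact ⟨hAux z hz.1 _ _ _ _ hop hon,
      hAux z hz.1 _ _ _ _ hop.symm ((hop.onFacet_base_iff z).1 hon)⟩
  have hopen : IsOpen (Metric.ball x ε) := Metric.isOpen_ball
  obtain ⟨q, hqb, hq⟩ := mem_closure_iff.1 (mem_closure_pos hi) _ hopen (Metric.mem_ball_self hε)
  obtain ⟨r, hrb, hr⟩ := mem_closure_iff.1 (mem_closure_pos hj) _ hopen (Metric.mem_ball_self hε)
  obtain ⟨r', ⟨hr'b, hr'⟩, hrg⟩ := (dense_generic b).inter_open_nonempty _
    (hopen.inter (isOpen_forall_coord_pos (b j))) ⟨r, hrb, hr⟩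
  obtain ⟨m, hm, hmpos⟩ := exists_coord_pos h.toFacetPaired (hopen.inter isOpen_interior)
    ((convex_ball x ε).inter h.convex.interior) inter_subset_right hstar (i := i)
    (image_subset_range _ _) ⟨hqb, h.pos_subset i hq⟩ hq ⟨hr'b, h.pos_subset j hr'⟩ hrg
  rwa [h.eq_of_coord_pos hmpos hr'] at hm

/-- The simplicial complex formed by the simplices of a tiling and their faces. -/
def complex [DecidableEq E] (h : IsTiling l ρ b P) : Geometry.SimplicialComplex ℝ E where
  faces := {s | s.Nonempty ∧ ∃ i, (s : Set E) ⊆ range (b i)}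
  isRelLowerSet_faces := by
    rintro s ⟨hs, i, hi⟩
    exact ⟨hs, fun t hts ht => ⟨ht, i, (Finset.coe_subset.2 hts).trans hi⟩⟩
  indep := by
    rintro s ⟨-, i, hi⟩
    exact (b i).ind.range.mono hi
  inter_subset_convexHull := by
    rintro s t ⟨-, i, hi⟩ ⟨-, j, hj⟩ x ⟨hxs, hxt⟩
    have hxi : ∀ k, 0 ≤ (b i).coord k x := by
      have := convexHull_mono hi hxs
      rwa [AffineBasis.convexHull_eq_nonneg_coord] at this
    have hxj : ∀ k, 0 ≤ (b j).coord k x := by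
      have := convexHull_mono hj hxt
      rwa [AffineBasis.convexHull_eq_nonneg_coord] at this
    have h1 := h.support_subset hxi hxj
    -- The vertices that carry `x` are the same in both simplices, and they belong to `s` and to
    -- `t`.
    have h2 : b i '' {k | 0 < (b i).coord k x} ⊆ s := by
      rintro _ ⟨k, hk, rfl⟩
      by_contra hks
      exact (ne_of_gt hk) (coord_eq_zero_of_mem_convexHull hi hxs hks)
    have h4 : b j '' {k | 0 < (b j).coord k x} ⊆ t := by
      rintro _ ⟨k, hk, rfl⟩
      by_contra hks
      exact (ne_of_gt hk) (coord_eq_zero_of_mem_convexHull hj hxt hks)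
    have h5 : b i '' {k | 0 < (b i).coord k x} ⊆ b j '' {k | 0 < (b j).coord k x} := by
      rintro _ ⟨m, hm, rfl⟩
      obtain ⟨k, hk⟩ := h1 ⟨m, hm, rfl⟩
      refine ⟨k, ?_, hk⟩
      have := coord_eq_coord (image_subset_range _ _) h1 (mem_convexHull_support hxi) hk.symm
      show 0 < (b j).coord k x
      rw [← this]
      exact hm
    exact convexHull_mono (subset_inter h2 (h5.trans h4)) (mem_convexHull_support hxi)

end IsTiling

end Tiling

end AcuteTriangulation

namespace AcuteTriangulation

open Set

/-! ### Acuteness of a dihedral angle as a polynomial inequality. -/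

section Acute

/-- A positive multiple of the cosine of the dihedral angle of the tetrahedron `a b c d` at the
edge `a b`. -/
noncomputable def dihedralForm (a b c d : E3) : ℝ :=
  inner ℝ (b - a) (b - a) * inner ℝ (c - a) (d - a) -
    inner ℝ (b - a) (c - a) * inner ℝ (b - a) (d - a)

lemma inner_starProjection_orthogonal_span_singleton {u : E3} (hu : u ≠ 0) (x y : E3) :
    inner ℝ ((Submodule.span ℝ {u})ᗮ.starProjection x) ((Submodule.span ℝ {u})ᗮ.starProjection y) *
      inner ℝ u u = inner ℝ u u * inner ℝ x y - inner ℝ u x * inner ℝ u y := by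
  have hn : ‖u‖ ^ 2 = inner ℝ u u := (real_inner_self_eq_norm_sq _).symm
  have hu' : inner ℝ u u ≠ 0 := inner_self_ne_zero.2 hu
  rw [Submodule.starProjection_orthogonal]
  simp only [sub_apply, ContinuousLinearMap.id_apply, Submodule.starProjection_singleton,
    inner_sub_left, inner_sub_right, inner_smul_left, inner_smul_right]
  simp only [RCLike.ofReal_real_eq_id, id_eq, hn, conj_trivial]
  rw [real_inner_comm u x]
  field_simp
  ring

/-- The angle is acute exactly if the inner product of the two projections is positive, and clearing
the denominator `inner ℝ (b - a) (b - a)` turns this product into `dihedralForm`. If a projection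
vanishes, both sides are false. -/
lemma dihedralAngle_lt_iff {a b : E3} (c d : E3) (hab : a ≠ b) :
    dihedralAngle a b c d < Real.pi / 2 ↔ 0 < dihedralForm a b c d := by
  have hne : b - a ≠ 0 := sub_ne_zero.2 hab.symm
  have hu : 0 < inner ℝ (b - a) (b - a) := real_inner_self_pos.2 hne
  unfold dihedralAngle InnerProductGeometry.angle
  rw [Real.arccos_lt_pi_div_two, dihedralForm,
    ← inner_starProjection_orthogonal_span_singleton hne]
  constructor
  · intro h
    refine mul_pos ?_ hu
    by_contra! hle
    exact h.not_ge (div_nonpos_of_nonpos_of_nonneg hle (by positivity))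
  · intro h
    have h' := pos_of_mul_pos_left h hu.le
    refine div_pos h' (lt_of_le_of_ne (by positivity) fun h0 => ?_)
    have := (abs_real_inner_le_norm _ _).trans h0.symm.le
    exact (abs_pos.2 h'.ne').not_ge this

end Acute

/-! ### Images of triangulations under similarities. -/

section Transport

/-- `e` multiplies distances by `r`. -/
structure IsSimilarity (e : E3 ≃ᵃ[ℝ] E3) (r : ℝ) : Prop where
  ne_zero : r ≠ 0
  inner_eq : ∀ x y z w, inner ℝ (e x - e y) (e z - e w) = r ^ 2 * inner ℝ (x - y) (z - w)

lemma IsSimilarity.dihedralForm_eq {e : E3 ≃ᵃ[ℝ] E3} {r : ℝ} (h : IsSimilarity e r)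
    (a b c d : E3) : dihedralForm (e a) (e b) (e c) (e d) = r ^ 4 * dihedralForm a b c d := by
  simp only [dihedralForm, h.inner_eq]; ring

lemma affineIndependent_map (e : E3 ≃ᵃ[ℝ] E3) {s : Finset E3}
    (h : AffineIndependent ℝ ((↑) : s → E3)) :
    AffineIndependent ℝ ((↑) : s.map e.toEquiv.toEmbedding → E3) := by
  have h1 : AffineIndependent ℝ ((↑) : ((s.map e.toEquiv.toEmbedding : Finset E3) : Set E3) → E3) := by
    rw [Finset.coe_map]
    exact e.affineIndependent_set_of_eq_iff.2 h
  exact h1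

lemma IsSimilarity.isAcuteTetrahedron {e : E3 ≃ᵃ[ℝ] E3} {r : ℝ} (h : IsSimilarity e r)
    {s : Finset E3} (hs : IsAcuteTetrahedron s) :
    IsAcuteTetrahedron (s.map e.toEquiv.toEmbedding) := by
  refine ⟨by rw [Finset.card_map, hs.1], affineIndependent_map e hs.2.1, ?_⟩
  simp only [Finset.mem_map]
  rintro _ ⟨a, ha, rfl⟩ _ ⟨b, hb, rfl⟩ _ ⟨c, hc, rfl⟩ _ ⟨d, hd, rfl⟩ hnd
  have hnd' : [a, b, c, d].Nodup :=
    (List.nodup_map_iff e.injective (l := [a, b, c, d])).1 hnd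
  have hab : a ≠ b := by simp at hnd'; tauto
  have := (dihedralAngle_lt_iff c d hab).1 (hs.2.2 a ha b hb c hc d hd hnd')
  refine (dihedralAngle_lt_iff _ _ (e.injective.ne hab)).2 ?_
  have hr := h.ne_zero
  have h2 := h.dihedralForm_eq a b c d
  show 0 < dihedralForm (e a) (e b) (e c) (e d)
  rw [h2]
  positivity

/-- The image of a simplicial complex under an affine automorphism. -/
def mapComplex (K : Geometry.SimplicialComplex ℝ E3) (e : E3 ≃ᵃ[ℝ] E3) :
    Geometry.SimplicialComplex ℝ E3 where
  faces := (fun s => s.map e.toEquiv.toEmbedding) '' K.faces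
  isRelLowerSet_faces := by
    rintro _ ⟨s, hs, rfl⟩
    refine ⟨(K.nonempty_of_mem_faces hs).map, fun t hts ht => ?_⟩
    obtain ⟨u, hu, rfl⟩ := Finset.subset_map_iff.1 hts
    exact ⟨u, K.down_closed hs hu (by simpa using ht), rfl⟩
  indep := by
    rintro _ ⟨s, hs, rfl⟩
    exact affineIndependent_map e (K.indep hs)
  inter_subset_convexHull := by
    rintro _ _ ⟨s, hs, rfl⟩ ⟨t, ht, rfl⟩
    have himg : ∀ u : Set E3, convexHull ℝ (e '' u) = e '' convexHull ℝ u := fun u =>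
      (e.toAffineMap.image_convexHull u).symm
    simp only [Finset.coe_map]
    show convexHull ℝ (e '' s) ∩ convexHull ℝ (e '' t) ⊆ convexHull ℝ (e '' s ∩ e '' t)
    rw [← image_inter e.injective, himg, himg, himg, ← image_inter e.injective]
    exact image_mono (K.inter_subset_convexHull hs ht)

lemma space_mapComplex (K : Geometry.SimplicialComplex ℝ E3) (e : E3 ≃ᵃ[ℝ] E3) :
    (mapComplex K e).space = e '' K.space := by
  have himg : ∀ u : Set E3, convexHull ℝ (e '' u) = e '' convexHull ℝ u := fun u =>
    (e.toAffineMap.image_convexHull u).symm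
  unfold Geometry.SimplicialComplex.space
  rw [image_iUnion₂]
  show ⋃ s ∈ (fun s => s.map e.toEquiv.toEmbedding) '' K.faces, _ = _
  rw [biUnion_image]
  refine iUnion₂_congr fun s _ => ?_
  rw [← himg, Finset.coe_map]
  rfl

lemma IsSimilarity.isAcuteTriangulation {e : E3 ≃ᵃ[ℝ] E3} {r : ℝ} (h : IsSimilarity e r)
    {K : Geometry.SimplicialComplex ℝ E3} {P : Set E3} (hK : IsAcuteTriangulation K P) :
    IsAcuteTriangulation (mapComplex K e) (e '' P) := by
  refine ⟨hK.finite.image _, by rw [space_mapComplex, hK.space_eq], ?_⟩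
  rintro _ ⟨⟨s, hs, rfl⟩, hmax⟩
  refine h.isAcuteTetrahedron (hK.acute s ⟨hs, fun t ht hst => ?_⟩)
  have := hmax ⟨t, ht, rfl⟩ (Finset.map_subset_map.2 hst)
  exact Finset.map_injective _ this

lemma isNontrivialTriangulation_mapComplex (e : E3 ≃ᵃ[ℝ] E3)
    {K : Geometry.SimplicialComplex ℝ E3} (hK : IsNontrivialTriangulation K) :
    IsNontrivialTriangulation (mapComplex K e) := by
  obtain ⟨s, hs, t, ht, hs4, ht4, hst⟩ := hK
  exact ⟨_, ⟨s, hs, rfl⟩, _, ⟨t, ht, rfl⟩, by simpa, by simpa,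
    fun h => hst (Finset.map_injective _ h)⟩

/-- The similarity `x ↦ c + r • A x`. -/
noncomputable def similarity (A : E3 ≃ₗᵢ[ℝ] E3) {r : ℝ} (hr : r ≠ 0) (c : E3) : E3 ≃ᵃ[ℝ] E3 :=
  (A.toLinearEquiv.trans (LinearEquiv.smulOfNeZero ℝ E3 r hr)).toAffineEquiv.trans
    (AffineEquiv.constVAdd ℝ E3 c)

lemma similarity_apply (A : E3 ≃ₗᵢ[ℝ] E3) {r : ℝ} (hr : r ≠ 0) (c x : E3) :
    similarity A hr c x = c + r • A x := rfl

lemma isSimilarity_similarity (A : E3 ≃ₗᵢ[ℝ] E3) {r : ℝ} (hr : r ≠ 0) (c : E3) :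
    IsSimilarity (similarity A hr c) r := by
  refine ⟨hr, fun x y z w => ?_⟩
  simp only [similarity_apply, add_sub_add_left_eq_sub, ← smul_sub, ← map_sub, inner_smul_left,
    inner_smul_right, LinearIsometryEquiv.inner_map_map]
  simp only [conj_trivial]
  ring

end Transport

/-! ### Gluing two complexes along a plane. -/

section Glue

/-- A convex combination of values at most `c` reaches `c` only if every vertex with a smaller value
has weight zero. -/
lemma mem_convexHull_filter {s : Finset E3} (f : E3 →ₗ[ℝ] ℝ) {c : ℝ} (hs : ∀ v ∈ s, f v ≤ c)
    {x : E3} (hx : x ∈ convexHull ℝ (s : Set E3)) (hfx : c ≤ f x) :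
    x ∈ convexHull ℝ ((s.filter (fun v => f v = c) : Finset E3) : Set E3) := by
  rw [Finset.mem_convexHull'] at hx ⊢
  obtain ⟨w, hw, hw1, rfl⟩ := hx
  have hle : ∀ v ∈ s, 0 ≤ w v * (c - f v) := fun v hv =>
    mul_nonneg (hw v hv) (sub_nonneg.2 (hs v hv))
  have hsum : ∑ v ∈ s, w v * (c - f v) = c - f (∑ v ∈ s, w v • v) := by
    simp only [mul_sub, Finset.sum_sub_distrib, ← Finset.sum_mul, hw1, one_mul, map_sum, map_smul,
      smul_eq_mul]
  have hzero : ∀ v ∈ s, w v * (c - f v) = 0 :=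
    (Finset.sum_eq_zero_iff_of_nonneg hle).1
      (le_antisymm (by rw [hsum]; linarith) (Finset.sum_nonneg hle))
  have hw0 : ∀ v ∈ s, f v ≠ c → w v = 0 := fun v hv hne =>
    (mul_eq_zero.1 (hzero v hv)).resolve_right fun h => hne (by linarith)
  refine ⟨w, fun v hv => hw v (Finset.mem_filter.1 hv).1, ?_, ?_⟩
  · rw [← hw1]
    refine Finset.sum_filter_of_ne fun v hv hne => ?_
    by_contra h
    exact hne (hw0 v hv h)
  · refine Finset.sum_filter_of_ne fun v hv hne => ?_
    by_contra h
    exact hne (by rw [hw0 v hv h, zero_smul])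

/-- Two simplicial complexes separated by the plane `f = c`, such that the part of the second one in
this plane is a subcomplex of the first one, together form a simplicial complex. -/
noncomputable def glue (K₁ K₂ : Geometry.SimplicialComplex ℝ E3) (f : E3 →ₗ[ℝ] ℝ) (c : ℝ)
    (h₁ : ∀ s ∈ K₁.faces, ∀ v ∈ s, c ≤ f v) (h₂ : ∀ s ∈ K₂.faces, ∀ v ∈ s, f v ≤ c)
    (h : ∀ s ∈ K₂.faces, (s.filter (fun v => f v = c)).Nonempty →
      s.filter (fun v => f v = c) ∈ K₁.faces) :
    Geometry.SimplicialComplex ℝ E3 where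
  faces := K₁.faces ∪ K₂.faces
  isRelLowerSet_faces := by
    rintro s (hs | hs)
    · exact ⟨K₁.nonempty_of_mem_faces hs, fun t hts ht => Or.inl (K₁.down_closed hs hts ht)⟩
    · exact ⟨K₂.nonempty_of_mem_faces hs, fun t hts ht => Or.inr (K₂.down_closed hs hts ht)⟩
  indep := by
    rintro s (hs | hs)
    exacts [K₁.indep hs, K₂.indep hs]
  inter_subset_convexHull := by
    have key : ∀ s ∈ K₁.faces, ∀ t ∈ K₂.faces, convexHull ℝ (s : Set E3) ∩ convexHull ℝ (t : Set E3)
        ⊆ convexHull ℝ ((s : Set E3) ∩ (t : Set E3)) := by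
      rintro s hs t ht x ⟨hxs, hxt⟩
      -- A common point lies in the separating plane, hence in the part of `t` there. That part is a
      -- face of `K₁`, so the intersection property of `K₁` applies.
      have hfx : c ≤ f x := convexHull_min (h₁ s hs) (convex_halfSpace_ge f.isLinear c) hxs
      have hx := mem_convexHull_filter f (h₂ t ht) hxt hfx
      have hne : (t.filter (fun v => f v = c)).Nonempty := by
        rw [← Finset.coe_nonempty, ← convexHull_nonempty_iff (𝕜 := ℝ)]
        exact ⟨x, hx⟩
      refine convexHull_mono ?_ (K₁.inter_subset_convexHull hs (h t ht hne) ⟨hxs, hx⟩)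
      exact inter_subset_inter_right _ (Finset.coe_subset.2 (Finset.filter_subset _ _))
    rintro s t (hs | hs) (ht | ht)
    · exact K₁.inter_subset_convexHull hs ht
    · exact key s hs t ht
    · rw [inter_comm, inter_comm (s : Set E3)]
      exact key t ht s hs
    · exact K₂.inter_subset_convexHull hs ht

variable {K₁ K₂ : Geometry.SimplicialComplex ℝ E3} {f : E3 →ₗ[ℝ] ℝ} {c : ℝ}
    {h₁ : ∀ s ∈ K₁.faces, ∀ v ∈ s, c ≤ f v} {h₂ : ∀ s ∈ K₂.faces, ∀ v ∈ s, f v ≤ c}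
    {h : ∀ s ∈ K₂.faces, (s.filter (fun v => f v = c)).Nonempty →
      s.filter (fun v => f v = c) ∈ K₁.faces}

lemma isAcuteTriangulation_glue {P₁ P₂ : Set E3} (hK₁ : IsAcuteTriangulation K₁ P₁)
    (hK₂ : IsAcuteTriangulation K₂ P₂) :
    IsAcuteTriangulation (glue K₁ K₂ f c h₁ h₂ h) (P₁ ∪ P₂) := by
  refine ⟨hK₁.finite.union hK₂.finite, ?_, ?_⟩
  · rw [← hK₁.space_eq, ← hK₂.space_eq]
    exact biUnion_union _ _ _
  · rintro s ⟨hs | hs, hmax⟩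
    · exact hK₁.acute s ⟨hs, fun t ht => hmax (Or.inl ht)⟩
    · exact hK₂.acute s ⟨hs, fun t ht => hmax (Or.inr ht)⟩

lemma isNontrivialTriangulation_glue (hK₁ : IsNontrivialTriangulation K₁) :
    IsNontrivialTriangulation (glue K₁ K₂ f c h₁ h₂ h) := by
  obtain ⟨s, hs, t, ht, hst⟩ := hK₁
  exact ⟨s, Or.inl hs, t, Or.inl ht, hst⟩

end Glue

end AcuteTriangulation

namespace AcuteTriangulation

open Set

/-! ### Exact arithmetic for points, determinants and dihedral forms. -/

section Exact

/-- A type of exactly represented real numbers with computable arithmetic and (sound) sign tests. -/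
class ExactReal (R : Type) extends Add R, Sub R, Mul R where
  val : R → ℝ
  pos : R → Bool
  nonneg : R → Bool
  val_add : ∀ x y, val (x + y) = val x + val y
  val_sub : ∀ x y, val (x - y) = val x - val y
  val_mul : ∀ x y, val (x * y) = val x * val y
  val_pos : ∀ x, pos x = true → 0 < val x
  val_nonneg : ∀ x, nonneg x = true → 0 ≤ val x

/-- A point of `R³`. -/
structure Pt (R : Type) where
  x : R
  y : R
  z : R

variable {R : Type} [ExactReal R]

/-- The determinant of `b - a`, `c - a`, `d - a`. -/
def Pt.det (a b c d : Pt R) : R :=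
  (b.x - a.x) * ((c.y - a.y) * (d.z - a.z) - (c.z - a.z) * (d.y - a.y)) +
  (b.y - a.y) * ((c.z - a.z) * (d.x - a.x) - (c.x - a.x) * (d.z - a.z)) +
  (b.z - a.z) * ((c.x - a.x) * (d.y - a.y) - (c.y - a.y) * (d.x - a.x))

/-- The inner product of the cross products of `b - a` with `c - a` and with `d - a`. -/
def Pt.dihedral (a b c d : Pt R) : R :=
  ((b.y - a.y) * (c.z - a.z) - (b.z - a.z) * (c.y - a.y)) *
    ((b.y - a.y) * (d.z - a.z) - (b.z - a.z) * (d.y - a.y)) +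
  ((b.z - a.z) * (c.x - a.x) - (b.x - a.x) * (c.z - a.z)) *
    ((b.z - a.z) * (d.x - a.x) - (b.x - a.x) * (d.z - a.z)) +
  ((b.x - a.x) * (c.y - a.y) - (b.y - a.y) * (c.x - a.x)) *
    ((b.x - a.x) * (d.y - a.y) - (b.y - a.y) * (d.x - a.x))

/-- The point of Euclidean space represented by an element of `R³`. -/
noncomputable def Pt.toE (p : Pt R) : E3 :=
  !₂[ExactReal.val p.x, ExactReal.val p.y, ExactReal.val p.z]

/-- The determinant of `b - a`, `c - a`, `d - a`. -/
def det₃ (a b c d : E3) : ℝ :=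
  (b 0 - a 0) * ((c 1 - a 1) * (d 2 - a 2) - (c 2 - a 2) * (d 1 - a 1)) +
  (b 1 - a 1) * ((c 2 - a 2) * (d 0 - a 0) - (c 0 - a 0) * (d 2 - a 2)) +
  (b 2 - a 2) * ((c 0 - a 0) * (d 1 - a 1) - (c 1 - a 1) * (d 0 - a 0))

lemma inner_eq_sum (x y : E3) : inner ℝ x y = x 0 * y 0 + x 1 * y 1 + x 2 * y 2 := by
  simp [PiLp.inner_apply, Fin.sum_univ_three, mul_comm]

lemma Pt.val_det (a b c d : Pt R) :
    ExactReal.val (Pt.det a b c d) = det₃ a.toE b.toE c.toE d.toE := by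
  simp [Pt.det, det₃, Pt.toE, ExactReal.val_add, ExactReal.val_sub, ExactReal.val_mul]

/-- This is the Binet–Cauchy identity for the inner product of two cross products with a common
factor. -/
lemma Pt.val_dihedral (a b c d : Pt R) :
    ExactReal.val (Pt.dihedral a b c d) = dihedralForm a.toE b.toE c.toE d.toE := by
  simp only [Pt.dihedral, dihedralForm, inner_eq_sum, ExactReal.val_add, ExactReal.val_sub,
    ExactReal.val_mul]
  simp [Pt.toE]
  ring

end Exact

/-! ### Nondegenerate tetrahedra and Cramer's rule. -/

section Basis

lemma affineIndependent_of_det_ne_zero {p : Fin 4 → E3} (h : det₃ (p 0) (p 1) (p 2) (p 3) ≠ 0) :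
    AffineIndependent ℝ p := by
  rw [affineIndependent_iff_of_fintype]
  intro w hw hp
  rw [Finset.univ.weightedVSub_eq_linear_combination hw] at hp
  have e : ∀ k : Fin 3, w 0 * p 0 k + w 1 * p 1 k + w 2 * p 2 k + w 3 * p 3 k = 0 := by
    intro k
    have := congrArg (fun v : E3 => v k) hp
    simpa [Fin.sum_univ_four] using this
  have hw' : w 0 + w 1 + w 2 + w 3 = 0 := by simpa [Fin.sum_univ_four] using hw
  have d : ∀ k : Fin 3,
      w 1 * (p 1 k - p 0 k) + w 2 * (p 2 k - p 0 k) + w 3 * (p 3 k - p 0 k) = 0 := fun k => by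
    linear_combination e k - p 0 k * hw'
  unfold det₃ at h
  -- Cramer's rule: the three coordinate equations are combined with the cofactors of the first edge
  -- vector; `h2` and `h3` are analogous.
  have h1 : w 1 = 0 := by
    refine (mul_eq_zero.1 (?_ : w 1 * _ = 0)).resolve_right h
    linear_combination d 0 * ((p 2 1 - p 0 1) * (p 3 2 - p 0 2) - (p 2 2 - p 0 2) * (p 3 1 - p 0 1)) +
      d 1 * ((p 2 2 - p 0 2) * (p 3 0 - p 0 0) - (p 2 0 - p 0 0) * (p 3 2 - p 0 2)) +
      d 2 * ((p 2 0 - p 0 0) * (p 3 1 - p 0 1) - (p 2 1 - p 0 1) * (p 3 0 - p 0 0))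
  have h2 : w 2 = 0 := by
    refine (mul_eq_zero.1 (?_ : w 2 * _ = 0)).resolve_right h
    linear_combination d 0 * ((p 3 1 - p 0 1) * (p 1 2 - p 0 2) - (p 3 2 - p 0 2) * (p 1 1 - p 0 1)) +
      d 1 * ((p 3 2 - p 0 2) * (p 1 0 - p 0 0) - (p 3 0 - p 0 0) * (p 1 2 - p 0 2)) +
      d 2 * ((p 3 0 - p 0 0) * (p 1 1 - p 0 1) - (p 3 1 - p 0 1) * (p 1 0 - p 0 0))
  have h3 : w 3 = 0 := by
    refine (mul_eq_zero.1 (?_ : w 3 * _ = 0)).resolve_right h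
    linear_combination d 0 * ((p 1 1 - p 0 1) * (p 2 2 - p 0 2) - (p 1 2 - p 0 2) * (p 2 1 - p 0 1)) +
      d 1 * ((p 1 2 - p 0 2) * (p 2 0 - p 0 0) - (p 1 0 - p 0 0) * (p 2 2 - p 0 2)) +
      d 2 * ((p 1 0 - p 0 0) * (p 2 1 - p 0 1) - (p 1 1 - p 0 1) * (p 2 0 - p 0 0))
  intro i
  fin_cases i
  · show w 0 = 0
    linarith
  exacts [h1, h2, h3]

/-- The affine basis formed by the vertices of a nondegenerate tetrahedron. -/
noncomputable def tetBasis (p : Fin 4 → E3) (h : det₃ (p 0) (p 1) (p 2) (p 3) ≠ 0) :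
    AffineBasis (Fin 4) ℝ E3 :=
  ⟨p, affineIndependent_of_det_ne_zero h,
    (affineIndependent_of_det_ne_zero h).affineSpan_eq_top_iff_card_eq_finrank_add_one.2 (by simp)⟩

lemma tetBasis_apply {p : Fin 4 → E3} (h : det₃ (p 0) (p 1) (p 2) (p 3) ≠ 0) (k : Fin 4) :
    tetBasis p h k = p k := rfl

/-- The determinant is affine in its last point and vanishes at the first three vertices. It
translates sides of facets into signs of determinants. -/
lemma det_eq_coord_mul {p : Fin 4 → E3} (h : det₃ (p 0) (p 1) (p 2) (p 3) ≠ 0) (x : E3) :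
    det₃ (p 0) (p 1) (p 2) x = (tetBasis p h).coord 3 x * det₃ (p 0) (p 1) (p 2) (p 3) := by
  have hs := (tetBasis p h).sum_coord_apply_eq_one x
  have hx := (tetBasis p h).linear_combination_coord_eq_self x
  simp only [Fin.sum_univ_four, tetBasis_apply] at hs hx
  generalize (tetBasis p h).coord 0 x = w₀ at *
  generalize (tetBasis p h).coord 1 x = w₁ at *
  generalize (tetBasis p h).coord 2 x = w₂ at *
  generalize (tetBasis p h).coord 3 x = w₃ at *
  obtain rfl : w₀ = 1 - w₁ - w₂ - w₃ := by linarith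
  subst hx
  simp only [det₃, PiLp.add_apply, PiLp.smul_apply, smul_eq_mul]
  ring

end Basis

/-! ### Sorting the facets by structural recursion. -/

section MergeSort

variable {α : Type}

/-- Merge two lists sorted by `key`, using at most `n` comparisons. -/
def mergeBy (key : α → ℕ) : ℕ → List α → List α → List α
  | 0, l, m => l ++ m
  | _ + 1, [], m => m
  | _ + 1, l, [] => l
  | n + 1, a :: l, b :: m =>
    bif (key a).ble (key b) then a :: mergeBy key n l (b :: m) else b :: mergeBy key n (a :: l) m

/-- Merge neighbouring lists. -/
def mergePairs (key : α → ℕ) (n : ℕ) : List (List α) → List (List α)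
  | a :: b :: l => mergeBy key n a b :: mergePairs key n l
  | l => l

/-- Merge sort by `key`; correctly sorted if `k` and `n` are large enough. -/
def mergeAll (key : α → ℕ) (n : ℕ) : ℕ → List (List α) → List α
  | 0, l => l.flatten
  | k + 1, l => mergeAll key n k (mergePairs key n l)

lemma mergeBy_perm (key : α → ℕ) (n : ℕ) (l m : List α) : (mergeBy key n l m).Perm (l ++ m) := by
  induction n generalizing l m with
  | zero => exact List.Perm.refl _
  | succ n ih =>
    match l, m with
    | [], m => exact List.Perm.refl _
    | a :: l, [] => simp [mergeBy]
    | a :: l, b :: m =>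
      simp only [mergeBy]
      cases (key a).ble (key b)
      · exact ((ih (a :: l) m).cons b).trans List.perm_middle.symm
      · exact (ih l (b :: m)).cons a

lemma mergePairs_flatten_perm (key : α → ℕ) (n : ℕ) (l : List (List α)) :
    (mergePairs key n l).flatten.Perm l.flatten := by
  fun_induction mergePairs with
  | case1 a b l ih =>
    simp only [List.flatten_cons, ← List.append_assoc]
    exact (mergeBy_perm key n a b).append ih
  | case2 l h => exact List.Perm.refl _

/-- Only this is needed: sums over the list do not depend on its order. A list that was not properly
sorted could at worst make the later test fail. -/
lemma mergeAll_perm (key : α → ℕ) (n k : ℕ) (l : List (List α)) :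
    (mergeAll key n k l).Perm l.flatten := by
  induction k generalizing l with
  | zero => exact List.Perm.refl _
  | succ k ih => exact (ih _).trans (mergePairs_flatten_perm key n l)

end MergeSort

end AcuteTriangulation

/-! ### Meshes, their tests, and what the tests imply. -/

namespace AcuteTriangulation

open Set

/-- A tetrahedron, given by the numbers of its four vertices. -/
abbrev Tet : Type := ℕ × ℕ × ℕ × ℕ

/-- The tetrahedra obtained from `t` by distinguishing one vertex (moved to the last place) and
keeping the order of the other ones. -/
def Tet.facets : Tet → List Tet
  | (a, b, c, d) => [(b, c, d, a), (a, c, d, b), (a, b, d, c), (a, b, c, d)]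

/-- The `j`-th element of `t.facets`. -/
def Tet.facet : Tet → Fin 4 → Tet
  | (a, b, c, d) => ![(b, c, d, a), (a, c, d, b), (a, b, d, c), (a, b, c, d)]

lemma Tet.facets_eq (t : Tet) : t.facets = [t.facet 0, t.facet 1, t.facet 2, t.facet 3] := rfl

lemma Tet.facet_mem (t : Tet) (j : Fin 4) : t.facet j ∈ t.facets := by
  rw [Tet.facets_eq]; fin_cases j <;> simp

lemma Tet.mem_facets {t r : Tet} : r ∈ t.facets ↔ ∃ j, r = t.facet j := by
  rw [Tet.facets_eq]; simp [Fin.exists_fin_succ]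

/-- The vertices of a tetrahedron. -/
def Tet.vertices : Tet → List ℕ
  | (a, b, c, d) => [a, b, c, d]

/-- A number that encodes the first three vertices. -/
def Tet.key : Tet → ℕ
  | (a, b, c, _) => (a * 256 + b) * 256 + c

/-- A mesh of tetrahedra with exact coordinates, with data certifying that it triangulates the convex
hull of some of its vertices: tetrahedra `hulls` spanned by these corners that together contain all
vertices, and a point `inner` of the first tetrahedron. -/
structure Mesh (R : Type) where
  pt : ℕ → Pt R
  size : ℕ
  tets : List Tet
  corners : List ℕ
  hulls : List Tet
  inner : Pt R

namespace Mesh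

variable {R : Type} [ExactReal R] (m : Mesh R)

/-- The tetrahedron is nondegenerate and acute. -/
def acuteTest : Tet → Bool
  | (a, b, c, d) =>
    let p := m.pt a; let q := m.pt b; let r := m.pt c; let s := m.pt d
    ExactReal.pos (Pt.det p q r s * Pt.det p q r s) &&
    ExactReal.pos (Pt.dihedral p q r s) && ExactReal.pos (Pt.dihedral p r q s) &&
    ExactReal.pos (Pt.dihedral p s q r) && ExactReal.pos (Pt.dihedral q r p s) &&
    ExactReal.pos (Pt.dihedral q s p r) && ExactReal.pos (Pt.dihedral r s p q)

/-- The two tetrahedra share the facet opposite to the last vertex, and lie on opposite sides. -/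
def oppositeTest : Tet → Tet → Bool
  | (a, b, c, d), (a', b', c', d') =>
    a.beq a' && b.beq b' && c.beq c' &&
    ExactReal.pos (Pt.det (m.pt a) (m.pt b) (m.pt c) (m.pt d) *
      Pt.det (m.pt b) (m.pt a) (m.pt c) (m.pt d'))

/-- All corners lie on the same side as the last vertex of the facet opposite to it. -/
def boundaryTest : Tet → Bool
  | (a, b, c, d) => m.corners.all fun v =>
    ExactReal.nonneg (Pt.det (m.pt a) (m.pt b) (m.pt c) (m.pt d) *
      Pt.det (m.pt a) (m.pt b) (m.pt c) (m.pt v))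

/-- The list consists of consecutive opposite pairs and of boundary facets. -/
def pairTest : List Tet → Bool
  | [] => true
  | [r] => m.boundaryTest r
  | r :: r' :: l => bif m.oppositeTest r r' then pairTest l else
      m.boundaryTest r && pairTest (r' :: l)

/-- The point lies strictly on the same side as the last vertex of the facet opposite to it. -/
def insideTest (p : Pt R) : Tet → Bool
  | (a, b, c, d) => ExactReal.pos (Pt.det (m.pt a) (m.pt b) (m.pt c) (m.pt d) *
      Pt.det (m.pt a) (m.pt b) (m.pt c) p)

/-- The point lies strictly on the other side of the facet opposite to the last vertex. -/
def outsideTest (p : Pt R) : Tet → Bool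
  | (a, b, c, d) => ExactReal.pos (Pt.det (m.pt a) (m.pt b) (m.pt c) (m.pt d) *
      Pt.det (m.pt b) (m.pt a) (m.pt c) p)

/-- The point lies weakly on the same side as the last vertex of the facet opposite to it. -/
def weaklyInsideTest (p : Pt R) : Tet → Bool
  | (a, b, c, d) => ExactReal.nonneg (Pt.det (m.pt a) (m.pt b) (m.pt c) (m.pt d) *
      Pt.det (m.pt a) (m.pt b) (m.pt c) p)

/-- The point `inner` lies in the first tetrahedron and in no other one. -/
def onceTest : List Tet → Bool
  | [] => false
  | t :: l => t.facets.all (m.insideTest m.inner) &&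
      l.all fun t => t.facets.any (m.outsideTest m.inner)

/-- The vertex is a corner or lies in the convex hull of four corners. -/
def hullTest (n : ℕ) : Bool :=
  m.corners.any n.beq || m.hulls.any fun t => t.facets.all (m.weaklyInsideTest (m.pt n))

/-- The tetrahedron is nondegenerate and spanned by corners. -/
def cornerTest : Tet → Bool
  | (a, b, c, d) =>
    ExactReal.pos (Pt.det (m.pt a) (m.pt b) (m.pt c) (m.pt d) *
      Pt.det (m.pt a) (m.pt b) (m.pt c) (m.pt d)) &&
    [a, b, c, d].all fun v => m.corners.any v.beq

/-- The tests which imply that the mesh is an acute triangulation of the convex hull of its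
corners. -/
structure Valid : Prop where
  acute : m.tets.all m.acuteTest = true
  pair : m.pairTest (mergeAll Tet.key 10000 16
    ((m.tets.flatMap Tet.facets).map fun t => [t])) = true
  once : m.onceTest m.tets = true
  bound : (m.tets.all fun t => t.vertices.all fun v => v.blt m.size) = true
  hull : (List.range m.size).all m.hullTest = true
  corner : m.hulls.all m.cornerTest = true
  two : Nat.ble 2 m.tets.length = true

/-- The position of a vertex. -/
noncomputable def vertex (n : ℕ) : E3 := (m.pt n).toE

/-- The positions of the vertices of a tetrahedron. -/
noncomputable def quad : Tet → Fin 4 → E3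
  | (a, b, c, d) => ![m.vertex a, m.vertex b, m.vertex c, m.vertex d]

/-- The polytope triangulated by the mesh. -/
def hullSet : Set E3 := convexHull ℝ (m.vertex '' {n | n ∈ m.corners})

/-- The determinant of a tetrahedron of the mesh. -/
noncomputable def detTet (t : Tet) : ℝ :=
  det₃ (m.quad t 0) (m.quad t 1) (m.quad t 2) (m.quad t 3)

/-- The permutation that moves `j` to the last place. -/
def facetPerm : Fin 4 → Equiv.Perm (Fin 4) :=
  ![Equiv.swap 0 1 * Equiv.swap 1 2 * Equiv.swap 2 3, Equiv.swap 1 2 * Equiv.swap 2 3,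
    Equiv.swap 2 3, 1]

lemma facetPerm_apply : ∀ j, facetPerm j 3 = j := by decide

lemma forall_quad {t : Tet} {S : Set E3} (h : ∀ v ∈ t.vertices, m.vertex v ∈ S) (k : Fin 4) :
    m.quad t k ∈ S := by
  obtain ⟨a, b, c, d⟩ := t
  simp only [Tet.vertices, List.forall_mem_cons] at h
  fin_cases k
  exacts [h.1, h.2.1, h.2.2.1, h.2.2.2.1]

lemma facetPerm_eq : ∀ j k, facetPerm j k =
    (![![1, 2, 3, 0], ![0, 2, 3, 1], ![0, 1, 3, 2], ![0, 1, 2, 3]] : Fin 4 → Fin 4 → Fin 4) j k := by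
  decide

lemma quad_facet (t : Tet) (j k : Fin 4) : m.quad (t.facet j) k = m.quad t (facetPerm j k) := by
  rw [facetPerm_eq]
  obtain ⟨a, b, c, d⟩ := t
  fin_cases j <;> fin_cases k <;> simp [Tet.facet, quad]

variable {m}

/-- Permuting the vertices changes the determinant at most by a sign. -/
lemma detTet_facet_ne_zero {t : Tet} (h : m.detTet t ≠ 0) (j : Fin 4) : m.detTet (t.facet j) ≠ 0 := by
  intro h0
  apply h
  unfold detTet det₃ at *
  simp only [quad_facet, facetPerm_eq] at h0
  fin_cases j <;> simp at h0 <;> first | linear_combination h0 | linear_combination -h0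

/-- The affine basis formed by the vertices of a nondegenerate tetrahedron of the mesh. -/
noncomputable def tetrahedron (t : Tet) (h : m.detTet t ≠ 0) : AffineBasis (Fin 4) ℝ E3 :=
  tetBasis (m.quad t) h

lemma tetrahedron_apply {t : Tet} (h : m.detTet t ≠ 0) (k : Fin 4) :
    tetrahedron t h k = m.quad t k := rfl

lemma rearrange_facet {t : Tet} (h : m.detTet t ≠ 0) (j : Fin 4) :
    rearrange (tetrahedron t h) (facetPerm j) =
      tetrahedron (t.facet j) (detTet_facet_ne_zero h j) := by
  refine AffineBasis.ext (funext fun k => ?_)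
  rw [rearrange_apply, tetrahedron_apply, tetrahedron_apply, quad_facet]

lemma det_eq_coord_mul_detTet {t : Tet} (h : m.detTet t ≠ 0) (x : E3) :
    det₃ (m.quad t 0) (m.quad t 1) (m.quad t 2) x = (tetrahedron t h).coord 3 x * m.detTet t :=
  det_eq_coord_mul h x

lemma det_facet {t : Tet} (h : m.detTet t ≠ 0) (j : Fin 4) (x : E3) :
    det₃ (m.quad (t.facet j) 0) (m.quad (t.facet j) 1) (m.quad (t.facet j) 2) x =
      (tetrahedron t h).coord j x * m.detTet (t.facet j) := by
  rw [det_eq_coord_mul_detTet (detTet_facet_ne_zero h j), ← rearrange_facet h j, rearrange_coord,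
    facetPerm_apply]

lemma det₃_swap (a b c d : E3) : det₃ b a c d = -det₃ a b c d := by
  unfold det₃; ring

lemma pos_of_insideTest {p : Pt R} {r : Tet} (hp : m.insideTest p r = true) :
    0 < m.detTet r * det₃ (m.quad r 0) (m.quad r 1) (m.quad r 2) p.toE := by
  obtain ⟨a, b, c, d⟩ := r
  have h1 := ExactReal.val_pos _ hp
  rwa [ExactReal.val_mul, Pt.val_det, Pt.val_det] at h1

lemma pos_of_outsideTest {p : Pt R} {r : Tet} (hp : m.outsideTest p r = true) :
    0 < m.detTet r * -det₃ (m.quad r 0) (m.quad r 1) (m.quad r 2) p.toE := by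
  obtain ⟨a, b, c, d⟩ := r
  have h1 := ExactReal.val_pos _ hp
  rwa [ExactReal.val_mul, Pt.val_det, Pt.val_det, det₃_swap (m.pt a).toE] at h1

lemma nonneg_of_weaklyInsideTest {p : Pt R} {r : Tet} (hp : m.weaklyInsideTest p r = true) :
    0 ≤ m.detTet r * det₃ (m.quad r 0) (m.quad r 1) (m.quad r 2) p.toE := by
  obtain ⟨a, b, c, d⟩ := r
  have h1 := ExactReal.val_nonneg _ hp
  rwa [ExactReal.val_mul, Pt.val_det, Pt.val_det] at h1

/-- The tested product is the barycentric coordinate times the square of a determinant, so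
tetrahedra of either orientation are allowed. -/
lemma insideTest_imp {p : Pt R} {t : Tet} (h : m.detTet t ≠ 0) {j : Fin 4}
    (hp : m.insideTest p (t.facet j) = true) : 0 < (tetrahedron t h).coord j p.toE := by
  have h1 := pos_of_insideTest hp
  rw [det_facet h] at h1
  by_contra! hle
  nlinarith [mul_self_nonneg (m.detTet (t.facet j))]

lemma outsideTest_imp {p : Pt R} {t : Tet} (h : m.detTet t ≠ 0) {j : Fin 4}
    (hp : m.outsideTest p (t.facet j) = true) : (tetrahedron t h).coord j p.toE < 0 := by
  have h1 := pos_of_outsideTest hp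
  rw [det_facet h] at h1
  by_contra! hle
  nlinarith [mul_self_nonneg (m.detTet (t.facet j))]

lemma weaklyInsideTest_imp {p : Pt R} {t : Tet} (h : m.detTet t ≠ 0) {j : Fin 4}
    (hp : m.weaklyInsideTest p (t.facet j) = true) : 0 ≤ (tetrahedron t h).coord j p.toE := by
  have h1 := nonneg_of_weaklyInsideTest hp
  rw [det_facet h] at h1
  by_contra! hle
  nlinarith [mul_self_pos.2 (detTet_facet_ne_zero h j)]

lemma boundaryTest_eq (r : Tet) :
    m.boundaryTest r = m.corners.all fun v => m.weaklyInsideTest (m.pt v) r := by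
  obtain ⟨a, b, c, d⟩ := r
  rfl

lemma boundaryTest_imp {t : Tet} (h : m.detTet t ≠ 0) {j : Fin 4}
    (hb : m.boundaryTest (t.facet j) = true) {x : E3} (hx : x ∈ m.hullSet) :
    0 ≤ (tetrahedron t h).coord j x := by
  rw [boundaryTest_eq] at hb
  have hsub : m.vertex '' {n | n ∈ m.corners} ⊆ (tetrahedron t h).coord j ⁻¹' Ici 0 := by
    rintro _ ⟨v, hv, rfl⟩
    exact weaklyInsideTest_imp h (List.all_eq_true.1 hb v hv)
  exact convexHull_min hsub ((convex_Ici 0).affine_preimage _) hx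

lemma oppositeTest_imp {r r' : Tet} (h : m.detTet r ≠ 0) (h' : m.detTet r' ≠ 0)
    (ho : m.oppositeTest r r' = true) :
    Opposite 3 (tetrahedron r h) (tetrahedron r' h') := by
  obtain ⟨a, b, c, d⟩ := r
  obtain ⟨a', b', c', d'⟩ := r'
  simp only [oppositeTest, Bool.and_eq_true] at ho
  obtain ⟨⟨⟨ha, hb⟩, hc⟩, hpos⟩ := ho
  obtain rfl := Nat.eq_of_beq_eq_true ha
  obtain rfl := Nat.eq_of_beq_eq_true hb
  obtain rfl := Nat.eq_of_beq_eq_true hc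
  refine ⟨fun k hk => ?_, ?_⟩
  · rw [tetrahedron_apply, tetrahedron_apply]
    fin_cases k
    · simp [quad]
    · simp [quad]
    · simp [quad]
    · exact absurd rfl hk
  · have h1 := ExactReal.val_pos _ hpos
    -- The test swaps two vertices in one determinant to express a negative product, because the
    -- exact numbers come without negation.
    rw [ExactReal.val_mul, Pt.val_det, Pt.val_det, det₃_swap (m.pt a).toE] at h1
    have h2 := det_eq_coord_mul_detTet h' (m.vertex d)
    have e1 : det₃ (m.pt a).toE (m.pt b).toE (m.pt c).toE (m.pt d).toE =
      det₃ (m.quad (a, b, c, d') 0) (m.quad (a, b, c, d') 1) (m.quad (a, b, c, d') 2)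
        (m.vertex d) := rfl
    have e2 : det₃ (m.pt a).toE (m.pt b).toE (m.pt c).toE (m.pt d').toE =
      m.detTet (a, b, c, d') := rfl
    rw [e1, e2, h2] at h1
    rw [tetrahedron_apply, show m.quad (a, b, c, d) 3 = m.vertex d from rfl]
    by_contra! hle
    nlinarith [mul_self_nonneg (m.detTet (a, b, c, d'))]

/-- The test consumes the list in opposite pairs and single boundary facets, and each of these
contributes zero. -/
lemma sum_eq_zero_of_pairTest {L : List Tet} (hL : m.pairTest L = true) (G : Tet → ℤ)
    (ho : ∀ r ∈ L, ∀ r' ∈ L, m.oppositeTest r r' = true → G r + G r' = 0)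
    (hb : ∀ r ∈ L, m.boundaryTest r = true → G r = 0) : (L.map G).sum = 0 := by
  fun_induction pairTest m L with
  | case1 => rfl
  | case2 r => simpa using hb r (by simp) hL
  | case3 r r' l h ih =>
    have h1 := ih hL (fun s hs s' hs' => ho s (by simp [hs]) s' (by simp [hs']))
      (fun s hs => hb s (by simp [hs]))
    have h2 := ho r (by simp) r' (by simp) h
    simp only [List.map_cons, List.sum_cons]
    omega
  | case4 r r' l h ih =>
    rw [Bool.and_eq_true] at hL
    have h1 := ih hL.2 (fun s hs s' hs' => ho s (List.mem_cons_of_mem _ hs) s'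
      (List.mem_cons_of_mem _ hs')) (fun s hs => hb s (List.mem_cons_of_mem _ hs))
    rw [List.map_cons, List.sum_cons, h1, hb r (by simp) hL.1, add_zero]

lemma exists_of_onceTest {L : List Tet} (h : m.onceTest L = true) : ∃ h0 : 0 < L.length,
    (L.get ⟨0, h0⟩).facets.all (m.insideTest m.inner) = true ∧
    ∀ i, i ≠ ⟨0, h0⟩ → (L.get i).facets.any (m.outsideTest m.inner) = true := by
  cases L with
  | nil => simp [onceTest] at h
  | cons t l =>
    rw [onceTest, Bool.and_eq_true] at h
    refine ⟨Nat.succ_pos _, h.1, fun i => Fin.cases (fun hi => absurd rfl hi) (fun i _ => ?_) i⟩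
    exact List.all_eq_true.1 h.2 _ (List.get_mem l i)

lemma dihedralForm_swap_left (a b c d : E3) : dihedralForm b a c d = dihedralForm a b c d := by
  simp only [dihedralForm, inner_eq_sum, PiLp.sub_apply]; ring

lemma dihedralForm_swap_right (a b c d : E3) : dihedralForm a b d c = dihedralForm a b c d := by
  simp only [dihedralForm, inner_eq_sum, PiLp.sub_apply]; ring

/-- The 24 orderings fall into six classes, one for each edge, under exchanging the ends of the edge
and exchanging the other two vertices. -/
lemma forall_nodup_of_symm {F : Fin 4 → Fin 4 → Fin 4 → Fin 4 → Prop}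
    (hl : ∀ i j k l, F i j k l → F j i k l) (hr : ∀ i j k l, F i j k l → F i j l k)
    (h1 : F 0 1 2 3) (h2 : F 0 2 1 3) (h3 : F 0 3 1 2) (h4 : F 1 2 0 3) (h5 : F 1 3 0 2)
    (h6 : F 2 3 0 1) : ∀ i j k l : Fin 4, [i, j, k, l].Nodup → F i j k l := by
  have key : ∀ i j k l : Fin 4, [i, j, k, l].Nodup →
      ∃ q ∈ [((0, 1, 2, 3) : Fin 4 × Fin 4 × Fin 4 × Fin 4), (0, 2, 1, 3), (0, 3, 1, 2),
        (1, 2, 0, 3), (1, 3, 0, 2), (2, 3, 0, 1)],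
        (i, j, k, l) = q ∨ (j, i, k, l) = q ∨ (i, j, l, k) = q ∨ (j, i, l, k) = q := by
    decide
  intro i j k l hnd
  obtain ⟨q, hq, hijkl⟩ := key i j k l hnd
  have hF : F q.1 q.2.1 q.2.2.1 q.2.2.2 := by
    simp only [List.mem_cons, List.not_mem_nil, or_false] at hq
    rcases hq with rfl | rfl | rfl | rfl | rfl | rfl <;> assumption
  rcases hijkl with rfl | rfl | rfl | rfl
  exacts [hF, hl _ _ _ _ hF, hr _ _ _ _ hF, hl _ _ _ _ (hr _ _ _ _ hF)]

namespace Valid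

variable (hm : m.Valid)
include hm

lemma detTet_ne_zero {t : Tet} (ht : t ∈ m.tets) : m.detTet t ≠ 0 := by
  have h := List.all_eq_true.1 hm.acute t ht
  obtain ⟨a, b, c, d⟩ := t
  simp only [acuteTest, Bool.and_eq_true] at h
  have h1 := ExactReal.val_pos _ h.1.1.1.1.1.1
  rw [ExactReal.val_mul, Pt.val_det] at h1
  exact fun h0 => h1.ne' (by rw [show det₃ (m.pt a).toE (m.pt b).toE (m.pt c).toE (m.pt d).toE = 0
    from h0, mul_zero])

/-- The tetrahedra of the mesh. -/
noncomputable def basis (i : Fin m.tets.length) : AffineBasis (Fin 4) ℝ E3 :=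
  tetrahedron (m.tets.get i) (hm.detTet_ne_zero (m.tets.get_mem i))

lemma facetPaired : FacetPaired 3 facetPerm hm.basis m.hullSet := by
  classical
  refine ⟨facetPerm_apply, fun g hgo hgb => ?_⟩
  -- The default value is never used: every facet in the list comes from a nondegenerate
  -- tetrahedron.
  let G : Tet → ℤ := fun r => if h : m.detTet r ≠ 0 then g (tetrahedron r h) else 0
  have hG : ∀ i j, g (rearrange (hm.basis i) (facetPerm j)) = G ((m.tets.get i).facet j) := by
    intro i j
    have h := hm.detTet_ne_zero (m.tets.get_mem i)
    simp only [G, dif_pos (detTet_facet_ne_zero h j)]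
    exact congrArg g (rearrange_facet h j)
  have hperm := mergeAll_perm Tet.key 10000 16 ((m.tets.flatMap Tet.facets).map fun t => [t])
  have hflat : ((m.tets.flatMap Tet.facets).map fun t => [t]).flatten =
      m.tets.flatMap Tet.facets := by
    rw [← List.flatMap_def]; simp
  rw [hflat] at hperm
  have hmem : ∀ r ∈ mergeAll Tet.key 10000 16 ((m.tets.flatMap Tet.facets).map fun t => [t]),
      ∃ i j, r = (m.tets.get i).facet j := by
    intro r hr
    obtain ⟨t, ht, hrt⟩ := List.mem_flatMap.1 (hperm.mem_iff.1 hr)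
    obtain ⟨i, rfl⟩ := List.get_of_mem ht
    obtain ⟨j, rfl⟩ := Tet.mem_facets.1 hrt
    exact ⟨i, j, rfl⟩
  have hsum := sum_eq_zero_of_pairTest hm.pair G ?_ ?_
  · rw [(hperm.map G).sum_eq] at hsum
    have h1 : ∀ l : List Tet, ((l.flatMap Tet.facets).map G).sum =
        (l.map fun t => ∑ j, G (t.facet j)).sum := by
      intro l
      induction l with
      | nil => rfl
      | cons t l ih =>
        rw [List.flatMap_cons, List.map_append, List.sum_append, ih, List.map_cons, List.sum_cons,
          Tet.facets_eq, Fin.sum_univ_four]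
        simp [add_assoc]
    rw [h1] at hsum
    simp only [hG]
    rw [← hsum, ← List.sum_ofFn]
    congr 1
    exact List.ofFn_getElem_eq_map m.tets fun t => ∑ j, G (t.facet j)
  · intro r hr r' hr' hop
    obtain ⟨i, j, rfl⟩ := hmem r hr
    obtain ⟨i', j', rfl⟩ := hmem r' hr'
    rw [← hG, ← hG]
    apply hgo
    have h := oppositeTest_imp
      (detTet_facet_ne_zero (hm.detTet_ne_zero (m.tets.get_mem i)) j)
      (detTet_facet_ne_zero (hm.detTet_ne_zero (m.tets.get_mem i')) j') hop
    rwa [← rearrange_facet, ← rearrange_facet] at h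
  · intro r hr hbd
    obtain ⟨i, j, rfl⟩ := hmem r hr
    rw [← hG]
    exact hgb i j fun x hx => boundaryTest_imp (hm.detTet_ne_zero (m.tets.get_mem i)) hbd hx

/-- A vertex that is not a corner is located in one of the nondegenerate tetrahedra `hulls` spanned
by corners, by its barycentric coordinates. -/
lemma vertex_mem {n : ℕ} (hn : n < m.size) : m.vertex n ∈ m.hullSet := by
  have h := List.all_eq_true.1 hm.hull n (List.mem_range.2 hn)
  have hc : ∀ v, m.corners.any (Nat.beq v) = true → m.vertex v ∈ m.hullSet := by
    intro v hv
    obtain ⟨w, hw, hvw⟩ := List.any_eq_true.1 hv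
    obtain rfl := Nat.eq_of_beq_eq_true hvw
    exact subset_convexHull ℝ _ ⟨v, hw, rfl⟩
  rcases (Bool.or_eq_true _ _).mp h with h | h
  · exact hc n h
  · obtain ⟨t, ht, hin⟩ := List.any_eq_true.1 h
    have hct := List.all_eq_true.1 hm.corner t ht
    obtain ⟨a, b, c, d⟩ := t
    simp only [cornerTest, Bool.and_eq_true] at hct
    have hdet : m.detTet (a, b, c, d) ≠ 0 := by
      have h1 := ExactReal.val_pos _ hct.1
      rw [ExactReal.val_mul, Pt.val_det] at h1
      exact fun h0 => h1.ne' (by rw [show det₃ (m.pt a).toE (m.pt b).toE (m.pt c).toE (m.pt d).toE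
        = 0 from h0, mul_zero])
    have hx : m.vertex n ∈ convexHull ℝ (range (tetrahedron (a, b, c, d) hdet)) := by
      rw [AffineBasis.convexHull_eq_nonneg_coord]
      exact fun j => weaklyInsideTest_imp hdet (List.all_eq_true.1 hin _ (Tet.facet_mem _ j))
    refine convexHull_min ?_ (convex_convexHull ℝ _) hx
    rintro _ ⟨k, rfl⟩
    exact m.forall_quad (t := (a, b, c, d)) (fun v hv => hc v (List.all_eq_true.1 hct.2 v hv)) k

lemma quad_mem {t : Tet} (ht : t ∈ m.tets) (k : Fin 4) : m.quad t k ∈ m.hullSet :=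
  m.forall_quad (fun v hv => hm.vertex_mem (Nat.le_of_ble_eq_true
    (List.all_eq_true.1 (List.all_eq_true.1 hm.bound t ht) v hv))) k

lemma isTiling : IsTiling 3 facetPerm hm.basis m.hullSet where
  toFacetPaired := hm.facetPaired
  convex := convex_convexHull ℝ _
  mem i k := hm.quad_mem (m.tets.get_mem i) k
  covered_once := by
    obtain ⟨h0, hin, hout⟩ := exists_of_onceTest hm.once
    refine ⟨⟨0, h0⟩, m.inner.toE, fun k => ?_, fun i hi => ?_⟩
    · exact insideTest_imp _ (List.all_eq_true.1 hin _ (Tet.facet_mem _ k))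
    · obtain ⟨r, hr, hro⟩ := List.any_eq_true.1 (hout i hi)
      obtain ⟨k, rfl⟩ := Tet.mem_facets.1 hr
      exact ⟨k, outsideTest_imp _ hro⟩

lemma dihedralForm_pos {t : Tet} (ht : t ∈ m.tets) : ∀ i j k l : Fin 4, [i, j, k, l].Nodup →
    0 < dihedralForm (m.quad t i) (m.quad t j) (m.quad t k) (m.quad t l) := by
  have h := List.all_eq_true.1 hm.acute t ht
  obtain ⟨a, b, c, d⟩ := t
  simp only [acuteTest, Bool.and_eq_true] at h
  have hp : ∀ p q r s : Pt R, ExactReal.pos (Pt.dihedral p q r s) = true →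
      0 < dihedralForm p.toE q.toE r.toE s.toE := fun p q r s h => by
    rw [← Pt.val_dihedral]; exact ExactReal.val_pos _ h
  obtain ⟨⟨⟨⟨⟨⟨-, h1⟩, h2⟩, h3⟩, h4⟩, h5⟩, h6⟩ := h
  exact forall_nodup_of_symm
    (F := fun i j k l => 0 < dihedralForm (m.quad (a, b, c, d) i) (m.quad (a, b, c, d) j)
      (m.quad (a, b, c, d) k) (m.quad (a, b, c, d) l))
    (fun i j k l h => by rwa [dihedralForm_swap_left])
    (fun i j k l h => by rwa [dihedralForm_swap_right])
    (hp _ _ _ _ h1) (hp _ _ _ _ h2) (hp _ _ _ _ h3) (hp _ _ _ _ h4) (hp _ _ _ _ h5)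
    (hp _ _ _ _ h6)

lemma isAcuteTetrahedron {t : Tet} (ht : t ∈ m.tets) {s : Finset E3}
    (hs : (s : Set E3) = range (m.quad t)) : IsAcuteTetrahedron s := by
  have hind : AffineIndependent ℝ (m.quad t) :=
    affineIndependent_of_det_ne_zero (hm.detTet_ne_zero ht)
  refine ⟨?_, ?_, ?_⟩
  · rw [← Set.ncard_coe_finset, hs, ← image_univ, Set.ncard_image_of_injective _ hind.injective]
    simp
  · have h1 := hind.range
    rw [← hs] at h1
    exact h1
  · have hmem : ∀ x ∈ s, ∃ k, m.quad t k = x := fun x hx => by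
      rw [← Finset.mem_coe, hs] at hx
      exact hx
    intro a ha b hb c hc d hd hnd
    obtain ⟨i, rfl⟩ := hmem a ha
    obtain ⟨j, rfl⟩ := hmem b hb
    obtain ⟨k, rfl⟩ := hmem c hc
    obtain ⟨l, rfl⟩ := hmem d hd
    have hnd' : [i, j, k, l].Nodup := List.Nodup.of_map (m.quad t) hnd
    refine (dihedralAngle_lt_iff _ _ (fun h => ?_)).2 (hm.dihedralForm_pos ht i j k l hnd')
    simp [h] at hnd

/-- The explicit description of the faces is recorded because the gluing for the cube has to
identify faces of two different meshes. -/
theorem exists_triangulation : ∃ K : Geometry.SimplicialComplex ℝ E3,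
    (∀ s, s ∈ K.faces ↔ s.Nonempty ∧ ∃ t ∈ m.tets, (s : Set E3) ⊆ range (m.quad t)) ∧
    IsAcuteTriangulation K m.hullSet ∧ IsNontrivialTriangulation K := by
  classical
  have hT := hm.isTiling
  have hfaces : ∀ s, s ∈ hT.complex.faces ↔
      s.Nonempty ∧ ∃ t ∈ m.tets, (s : Set E3) ⊆ range (m.quad t) := by
    intro s
    refine and_congr_right fun _ => ⟨fun ⟨i, hi⟩ => ⟨_, m.tets.get_mem i, hi⟩, ?_⟩
    rintro ⟨t, ht, hst⟩
    obtain ⟨i, rfl⟩ := List.get_of_mem ht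
    exact ⟨i, hst⟩
  have hfull : ∀ i, Finset.univ.image (hm.basis i) ∈ hT.complex.faces := fun i =>
    ⟨Finset.univ_nonempty.image _, i, by simp⟩
  refine ⟨hT.complex, hfaces, ⟨?_, ?_, ?_⟩, ?_⟩
  · refine (Finset.finite_toSet
      (Finset.univ.image fun a : Fin m.tets.length × Fin 4 => hm.basis a.1 a.2).powerset).subset ?_
    rintro s ⟨-, i, hi⟩
    rw [Finset.mem_coe, Finset.mem_powerset]
    intro x hx
    obtain ⟨k, rfl⟩ := hi hx
    exact Finset.mem_image.2 ⟨(i, k), Finset.mem_univ _, rfl⟩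
  · ext x
    rw [Geometry.SimplicialComplex.mem_space_iff]
    constructor
    · rintro ⟨s, ⟨-, i, hi⟩, hx⟩
      refine convexHull_min ?_ hT.convex (convexHull_mono hi hx)
      rintro _ ⟨k, rfl⟩
      exact hT.mem i k
    · intro hx
      obtain ⟨i, hi⟩ := hT.exists_coord_nonneg hx
      refine ⟨_, hfull i, ?_⟩
      rw [Finset.coe_image, Finset.coe_univ, image_univ, AffineBasis.convexHull_eq_nonneg_coord]
      exact hi
  · rintro s ⟨⟨-, i, hi⟩, hmax⟩
    have hs := hmax (hfull i) (by rw [← Finset.coe_subset]; simpa using hi)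
    refine hm.isAcuteTetrahedron (m.tets.get_mem i) ?_
    rw [hs]
    simp only [Finset.coe_image, Finset.coe_univ, image_univ]
    rfl
  · have h2 := Nat.le_of_ble_eq_true hm.two
    have hcard : ∀ i, (Finset.univ.image (hm.basis i)).card = 4 := fun i => by
      rw [Finset.card_image_of_injective _ (hm.basis i).ind.injective]; simp
    refine ⟨_, hfull ⟨0, by omega⟩, _, hfull ⟨1, by omega⟩, hcard _, hcard _, fun heq => ?_⟩
    -- Equal vertex sets would give equal, nonempty interiors, contradicting their disjointness.
    have hr : range (hm.basis ⟨0, by omega⟩) = range (hm.basis ⟨1, by omega⟩) := by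
      simpa using congrArg (fun s : Finset E3 => (s : Set E3)) heq
    obtain ⟨x, hx⟩ : (interior (convexHull ℝ (range (hm.basis ⟨0, by omega⟩)))).Nonempty := by
      rw [interior_convexHull_nonempty_iff_affineSpan_eq_top]
      exact (hm.basis _).tot
    have hx' := hx
    rw [hr] at hx'
    rw [AffineBasis.interior_convexHull] at hx hx'
    have := hT.eq_of_coord_pos hx hx'
    simp at this

end Valid

end Mesh

end AcuteTriangulation

/-! ### Meshes from lists of points; the rings ℤ and ℤ[φ]. -/

namespace AcuteTriangulation

open Set

/-- The mesh whose vertices are the given corners and other points, numbered consecutively. -/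
def Mesh.ofPoints {R : Type} (dflt : Pt R) (cornerPts otherPts : List (Pt R)) (tets hulls : List Tet)
    (inner : Pt R) : Mesh R where
  pt n := (cornerPts ++ otherPts).getD n dflt
  size := (cornerPts ++ otherPts).length
  tets := tets
  corners := List.range cornerPts.length
  hulls := hulls
  inner := inner

lemma Mesh.hullSet_ofPoints {R : Type} [ExactReal R] (dflt : Pt R) (cornerPts otherPts : List (Pt R))
    (tets hulls : List Tet) (inner : Pt R) :
    (Mesh.ofPoints dflt cornerPts otherPts tets hulls inner).hullSet =
      convexHull ℝ (Pt.toE '' {p | p ∈ cornerPts}) := by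
  unfold Mesh.hullSet
  congr 1
  ext x
  simp only [mem_image, mem_ofPred_eq, Mesh.ofPoints, List.mem_range, Mesh.vertex]
  constructor
  · rintro ⟨n, hn, rfl⟩
    refine ⟨_, List.getElem_mem hn, ?_⟩
    rw [List.getD_append _ _ _ _ hn, List.getD_eq_getElem _ _ hn]
  · rintro ⟨p, hp, rfl⟩
    obtain ⟨n, hn, rfl⟩ := List.getElem_of_mem hp
    refine ⟨n, hn, ?_⟩
    rw [List.getD_append _ _ _ _ hn, List.getD_eq_getElem _ _ hn]

noncomputable instance : ExactReal ℤ where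
  val x := x
  pos x := decide (0 < x)
  nonneg x := decide (0 ≤ x)
  val_add x y := by push_cast; rfl
  val_sub x y := by push_cast; rfl
  val_mul x y := by push_cast; rfl
  val_pos x h := by simpa using h
  val_nonneg x h := by simpa using h

/-- The number `re + im * φ`, where `φ` is the golden ratio. -/
structure ZPhi where
  re : ℤ
  im : ℤ

namespace ZPhi

instance : Add ZPhi := ⟨fun x y => ⟨x.re + y.re, x.im + y.im⟩⟩
instance : Sub ZPhi := ⟨fun x y => ⟨x.re - y.re, x.im - y.im⟩⟩
instance : Mul ZPhi :=
  ⟨fun x y => ⟨x.re * y.re + x.im * y.im, x.re * y.im + x.im * y.re + x.im * y.im⟩⟩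

/-- The real number represented by `x`. -/
noncomputable def toReal (x : ZPhi) : ℝ := x.re + x.im * Real.goldenRatio

/-- A positivity test: `2 * (re + im * φ) = x + y * √5` with `x = 2 * re + im` and `y = im`. -/
def isPos (a : ZPhi) : Bool :=
  let x := 2 * a.re + a.im
  let y := a.im
  (decide (0 < x) && (decide (0 ≤ y) || decide (5 * (y * y) < x * x))) ||
  (decide (0 < y) && (decide (0 ≤ x) || decide (x * x < 5 * (y * y))))

/-- If `x` and `y` have different signs, the sign of `x + y * √5` is decided by comparing `x * x`
with `5 * (y * y)`. -/
lemma toReal_pos_of_isPos {a : ZPhi} (h : a.isPos = true) : 0 < a.toReal := by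
  have h5 : (√5 : ℝ) * √5 = 5 := Real.mul_self_sqrt (by norm_num)
  have hs : (0 : ℝ) < √5 := Real.sqrt_pos.2 (by norm_num)
  have hval : a.toReal = ((2 * a.re + a.im : ℤ) + (a.im : ℤ) * √5) / 2 := by
    unfold toReal Real.goldenRatio; push_cast; ring
  rw [hval]
  simp only [isPos, Bool.or_eq_true, Bool.and_eq_true, decide_eq_true_eq] at h
  generalize 2 * a.re + a.im = x at h ⊢
  generalize a.im = y at h ⊢
  refine div_pos ?_ two_pos
  rcases h with ⟨hx, hy | hxy⟩ | ⟨hy, hx | hxy⟩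
  · have hx' : (0 : ℝ) < x := by exact_mod_cast hx
    have hy' : (0 : ℝ) ≤ y := by exact_mod_cast hy
    positivity
  · have hx' : (0 : ℝ) < x := by exact_mod_cast hx
    have hxy' : (5 : ℝ) * (y * y) < x * x := by exact_mod_cast hxy
    by_contra! hle
    nlinarith
  · have hx' : (0 : ℝ) ≤ x := by exact_mod_cast hx
    have hy' : (0 : ℝ) < y := by exact_mod_cast hy
    positivity
  · have hy' : (0 : ℝ) < y := by exact_mod_cast hy
    have hxy' : (x * x : ℝ) < 5 * (y * y) := by exact_mod_cast hxy
    have hys : 0 < y * √5 := by positivity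
    by_contra! hle
    nlinarith

noncomputable instance : ExactReal ZPhi where
  val := toReal
  pos := isPos
  nonneg x := x.isPos || (decide (x.re = 0) && decide (x.im = 0))
  val_add x y := by
    change ((x.re + y.re : ℤ) : ℝ) + ((x.im + y.im : ℤ) : ℝ) * _ = _
    unfold toReal; push_cast; ring
  val_sub x y := by
    change ((x.re - y.re : ℤ) : ℝ) + ((x.im - y.im : ℤ) : ℝ) * _ = _
    unfold toReal; push_cast; ring
  val_mul x y := by
    change ((x.re * y.re + x.im * y.im : ℤ) : ℝ) +
      ((x.re * y.im + x.im * y.re + x.im * y.im : ℤ) : ℝ) * _ = _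
    unfold toReal; push_cast
    linear_combination -((x.im : ℝ) * y.im) * Real.goldenRatio_sq
  val_pos x h := toReal_pos_of_isPos h
  val_nonneg x h := by
    rw [Bool.or_eq_true, Bool.and_eq_true, decide_eq_true_eq, decide_eq_true_eq] at h
    rcases h with h | ⟨h1, h2⟩
    · exact (toReal_pos_of_isPos h).le
    · unfold toReal; simp [h1, h2]

end ZPhi

end AcuteTriangulation

/-! ### The explicit meshes. -/

namespace AcuteTriangulation

/-- The combinatorial structure of the triangulations of the regular tetrahedron and of the
trirectangular tetrahedron: the boundary complex of the 600-cell without the tetrahedra that meet a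
given tetrahedron. -/
def cellTets : List Tet :=
    [(0, 10, 29, 41), (0, 10, 30, 41), (0, 11, 29, 42), (0, 11, 31, 42), (0, 13, 30, 44), (0, 13,
    31, 44), (0, 29, 41, 42), (0, 30, 41, 44), (0, 31, 42, 44), (0, 41, 42, 44), (1, 5, 9, 22),
    (1, 5, 16, 22), (1, 6, 9, 25), (1, 6, 19, 25), (1, 9, 22, 25), (1, 13, 16, 35), (1, 13, 19,
    35), (1, 16, 22, 35), (1, 19, 25, 35), (1, 22, 25, 35), (2, 4, 8, 21), (2, 4, 15, 21), (2, 6,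
    8, 23), (2, 6, 17, 23), (2, 8, 21, 23), (2, 11, 15, 33), (2, 11, 17, 33), (2, 15, 21, 33), (2,
    17, 23, 33), (2, 21, 23, 33), (3, 4, 7, 18), (3, 4, 12, 18), (3, 5, 7, 20), (3, 5, 14, 20),
    (3, 7, 18, 20), (3, 10, 12, 32), (3, 10, 14, 32), (3, 12, 18, 32), (3, 14, 20, 32), (3, 18,
    20, 32), (4, 7, 8, 24), (4, 7, 18, 24), (4, 8, 21, 24), (4, 12, 15, 34), (4, 12, 18, 34), (4,
    15, 21, 34), (4, 18, 24, 34), (4, 21, 24, 34), (5, 7, 9, 26), (5, 7, 20, 26), (5, 9, 22, 26),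
    (5, 14, 16, 36), (5, 14, 20, 36), (5, 16, 22, 36), (5, 20, 26, 36), (5, 22, 26, 36), (6, 8, 9,
    27), (6, 8, 23, 27), (6, 9, 25, 27), (6, 17, 19, 37), (6, 17, 23, 37), (6, 19, 25, 37), (6,
    23, 27, 37), (6, 25, 27, 37), (7, 8, 9, 28), (7, 8, 24, 28), (7, 9, 26, 28), (7, 18, 20, 38),
    (7, 18, 24, 38), (7, 20, 26, 38), (7, 24, 28, 38), (7, 26, 28, 38), (8, 9, 27, 28), (8, 21,
    23, 39), (8, 21, 24, 39), (8, 23, 27, 39), (8, 24, 28, 39), (8, 27, 28, 39), (9, 22, 25, 40),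
    (9, 22, 26, 40), (9, 25, 27, 40), (9, 26, 28, 40), (9, 27, 28, 40), (10, 12, 29, 43), (10, 12,
    32, 43), (10, 14, 30, 45), (10, 14, 32, 45), (10, 29, 41, 43), (10, 30, 41, 45), (10, 32, 43,
    45), (10, 41, 43, 45), (11, 15, 29, 46), (11, 15, 33, 46), (11, 17, 31, 50), (11, 17, 33, 50),
    (11, 29, 42, 46), (11, 31, 42, 50), (11, 33, 46, 50), (11, 42, 46, 50), (12, 15, 29, 47), (12,
    15, 34, 47), (12, 18, 32, 51), (12, 18, 34, 51), (12, 29, 43, 47), (12, 32, 43, 51), (12, 34,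
    47, 51), (12, 43, 47, 51), (13, 16, 30, 48), (13, 16, 35, 48), (13, 19, 31, 52), (13, 19, 35,
    52), (13, 30, 44, 48), (13, 31, 44, 52), (13, 35, 48, 52), (13, 44, 48, 52), (14, 16, 30, 49),
    (14, 16, 36, 49), (14, 20, 32, 53), (14, 20, 36, 53), (14, 30, 45, 49), (14, 32, 45, 53), (14,
    36, 49, 53), (14, 45, 49, 53), (15, 21, 33, 54), (15, 21, 34, 54), (15, 29, 46, 47), (15, 33,
    46, 54), (15, 34, 47, 54), (15, 46, 47, 54), (16, 22, 35, 57), (16, 22, 36, 57), (16, 30, 48,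
    49), (16, 35, 48, 57), (16, 36, 49, 57), (16, 48, 49, 57), (17, 19, 31, 55), (17, 19, 37, 55),
    (17, 23, 33, 58), (17, 23, 37, 58), (17, 31, 50, 55), (17, 33, 50, 58), (17, 37, 55, 58), (17,
    50, 55, 58), (18, 20, 32, 56), (18, 20, 38, 56), (18, 24, 34, 59), (18, 24, 38, 59), (18, 32,
    51, 56), (18, 34, 51, 59), (18, 38, 56, 59), (18, 51, 56, 59), (19, 25, 35, 60), (19, 25, 37,
    60), (19, 31, 52, 55), (19, 35, 52, 60), (19, 37, 55, 60), (19, 52, 55, 60), (20, 26, 36, 61),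
    (20, 26, 38, 61), (20, 32, 53, 56), (20, 36, 53, 61), (20, 38, 56, 61), (20, 53, 56, 61), (21,
    23, 33, 62), (21, 23, 39, 62), (21, 24, 34, 63), (21, 24, 39, 63), (21, 33, 54, 62), (21, 34,
    54, 63), (21, 39, 62, 63), (21, 54, 62, 63), (22, 25, 35, 64), (22, 25, 40, 64), (22, 26, 36,
    65), (22, 26, 40, 65), (22, 35, 57, 64), (22, 36, 57, 65), (22, 40, 64, 65), (22, 57, 64, 65),
    (23, 27, 37, 66), (23, 27, 39, 66), (23, 33, 58, 62), (23, 37, 58, 66), (23, 39, 62, 66), (23,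
    58, 62, 66), (24, 28, 38, 67), (24, 28, 39, 67), (24, 34, 59, 63), (24, 38, 59, 67), (24, 39,
    63, 67), (24, 59, 63, 67), (25, 27, 37, 68), (25, 27, 40, 68), (25, 35, 60, 64), (25, 37, 60,
    68), (25, 40, 64, 68), (25, 60, 64, 68), (26, 28, 38, 69), (26, 28, 40, 69), (26, 36, 61, 65),
    (26, 38, 61, 69), (26, 40, 65, 69), (26, 61, 65, 69), (27, 28, 39, 70), (27, 28, 40, 70), (27,
    37, 66, 68), (27, 39, 66, 70), (27, 40, 68, 70), (27, 66, 68, 70), (28, 38, 67, 69), (28, 39,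
    67, 70), (28, 40, 69, 70), (28, 67, 69, 70), (29, 41, 42, 71), (29, 41, 43, 71), (29, 42, 46,
    71), (29, 43, 47, 71), (29, 46, 47, 71), (30, 41, 44, 72), (30, 41, 45, 72), (30, 44, 48, 72),
    (30, 45, 49, 72), (30, 48, 49, 72), (31, 42, 44, 73), (31, 42, 50, 73), (31, 44, 52, 73), (31,
    50, 55, 73), (31, 52, 55, 73), (32, 43, 45, 74), (32, 43, 51, 74), (32, 45, 53, 74), (32, 51,
    56, 74), (32, 53, 56, 74), (33, 46, 50, 75), (33, 46, 54, 75), (33, 50, 58, 75), (33, 54, 62,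
    75), (33, 58, 62, 75), (34, 47, 51, 76), (34, 47, 54, 76), (34, 51, 59, 76), (34, 54, 63, 76),
    (34, 59, 63, 76), (35, 48, 52, 77), (35, 48, 57, 77), (35, 52, 60, 77), (35, 57, 64, 77), (35,
    60, 64, 77), (36, 49, 53, 78), (36, 49, 57, 78), (36, 53, 61, 78), (36, 57, 65, 78), (36, 61,
    65, 78), (37, 55, 58, 79), (37, 55, 60, 79), (37, 58, 66, 79), (37, 60, 68, 79), (37, 66, 68,
    79), (38, 56, 59, 80), (38, 56, 61, 80), (38, 59, 67, 80), (38, 61, 69, 80), (38, 67, 69, 80),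
    (39, 62, 63, 81), (39, 62, 66, 81), (39, 63, 67, 81), (39, 66, 70, 81), (39, 67, 70, 81), (40,
    64, 65, 82), (40, 64, 68, 82), (40, 65, 69, 82), (40, 68, 70, 82), (40, 69, 70, 82), (41, 42,
    44, 83), (41, 42, 71, 83), (41, 43, 45, 84), (41, 43, 71, 84), (41, 44, 72, 83), (41, 45, 72,
    84), (41, 71, 83, 84), (41, 72, 83, 84), (42, 44, 73, 83), (42, 46, 50, 85), (42, 46, 71, 85),
    (42, 50, 73, 85), (42, 71, 83, 85), (42, 73, 83, 85), (43, 45, 74, 84), (43, 47, 51, 86), (43,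
    47, 71, 86), (43, 51, 74, 86), (43, 71, 84, 86), (43, 74, 84, 86), (44, 48, 52, 87), (44, 48,
    72, 87), (44, 52, 73, 87), (44, 72, 83, 87), (44, 73, 83, 87), (45, 49, 53, 88), (45, 49, 72,
    88), (45, 53, 74, 88), (45, 72, 84, 88), (45, 74, 84, 88), (46, 47, 54, 89), (46, 47, 71, 89),
    (46, 50, 75, 85), (46, 54, 75, 89), (46, 71, 85, 89), (46, 75, 85, 89), (47, 51, 76, 86), (47,
    54, 76, 89), (47, 71, 86, 89), (47, 76, 86, 89), (48, 49, 57, 90), (48, 49, 72, 90), (48, 52,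
    77, 87), (48, 57, 77, 90), (48, 72, 87, 90), (48, 77, 87, 90), (49, 53, 78, 88), (49, 57, 78,
    90), (49, 72, 88, 90), (49, 78, 88, 90), (50, 55, 58, 91), (50, 55, 73, 91), (50, 58, 75, 91),
    (50, 73, 85, 91), (50, 75, 85, 91), (51, 56, 59, 92), (51, 56, 74, 92), (51, 59, 76, 92), (51,
    74, 86, 92), (51, 76, 86, 92), (52, 55, 60, 93), (52, 55, 73, 93), (52, 60, 77, 93), (52, 73,
    87, 93), (52, 77, 87, 93), (53, 56, 61, 94), (53, 56, 74, 94), (53, 61, 78, 94), (53, 74, 88,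
    94), (53, 78, 88, 94), (54, 62, 63, 95), (54, 62, 75, 95), (54, 63, 76, 95), (54, 75, 89, 95),
    (54, 76, 89, 95), (55, 58, 79, 91), (55, 60, 79, 93), (55, 73, 91, 93), (55, 79, 91, 93), (56,
    59, 80, 92), (56, 61, 80, 94), (56, 74, 92, 94), (56, 80, 92, 94), (57, 64, 65, 96), (57, 64,
    77, 96), (57, 65, 78, 96), (57, 77, 90, 96), (57, 78, 90, 96), (58, 62, 66, 97), (58, 62, 75,
    97), (58, 66, 79, 97), (58, 75, 91, 97), (58, 79, 91, 97), (59, 63, 67, 98), (59, 63, 76, 98),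
    (59, 67, 80, 98), (59, 76, 92, 98), (59, 80, 92, 98), (60, 64, 68, 99), (60, 64, 77, 99), (60,
    68, 79, 99), (60, 77, 93, 99), (60, 79, 93, 99), (61, 65, 69, 100), (61, 65, 78, 100), (61,
    69, 80, 100), (61, 78, 94, 100), (61, 80, 94, 100), (62, 63, 81, 95), (62, 66, 81, 97), (62,
    75, 95, 97), (62, 81, 95, 97), (63, 67, 81, 98), (63, 76, 95, 98), (63, 81, 95, 98), (64, 65,
    82, 96), (64, 68, 82, 99), (64, 77, 96, 99), (64, 82, 96, 99), (65, 69, 82, 100), (65, 78, 96,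
    100), (65, 82, 96, 100), (66, 68, 70, 101), (66, 68, 79, 101), (66, 70, 81, 101), (66, 79, 97,
    101), (66, 81, 97, 101), (67, 69, 70, 102), (67, 69, 80, 102), (67, 70, 81, 102), (67, 80, 98,
    102), (67, 81, 98, 102), (68, 70, 82, 101), (68, 79, 99, 101), (68, 82, 99, 101), (69, 70, 82,
    102), (69, 80, 100, 102), (69, 82, 100, 102), (70, 81, 101, 102), (70, 82, 101, 102), (71, 83,
    84, 103), (71, 83, 85, 103), (71, 84, 86, 103), (71, 85, 89, 103), (71, 86, 89, 103), (72, 83,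
    84, 104), (72, 83, 87, 104), (72, 84, 88, 104), (72, 87, 90, 104), (72, 88, 90, 104), (73, 83,
    85, 105), (73, 83, 87, 105), (73, 85, 91, 105), (73, 87, 93, 105), (73, 91, 93, 105), (74, 84,
    86, 106), (74, 84, 88, 106), (74, 86, 92, 106), (74, 88, 94, 106), (74, 92, 94, 106), (75, 85,
    89, 107), (75, 85, 91, 107), (75, 89, 95, 107), (75, 91, 97, 107), (75, 95, 97, 107), (76, 86,
    89, 108), (76, 86, 92, 108), (76, 89, 95, 108), (76, 92, 98, 108), (76, 95, 98, 108), (77, 87,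
    90, 109), (77, 87, 93, 109), (77, 90, 96, 109), (77, 93, 99, 109), (77, 96, 99, 109), (78, 88,
    90, 110), (78, 88, 94, 110), (78, 90, 96, 110), (78, 94, 100, 110), (78, 96, 100, 110), (79,
    91, 93, 111), (79, 91, 97, 111), (79, 93, 99, 111), (79, 97, 101, 111), (79, 99, 101, 111),
    (80, 92, 94, 112), (80, 92, 98, 112), (80, 94, 100, 112), (80, 98, 102, 112), (80, 100, 102,
    112), (81, 95, 97, 113), (81, 95, 98, 113), (81, 97, 101, 113), (81, 98, 102, 113), (81, 101,
    102, 113), (82, 96, 99, 114), (82, 96, 100, 114), (82, 99, 101, 114), (82, 100, 102, 114),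
    (82, 101, 102, 114), (83, 84, 103, 104), (83, 85, 103, 105), (83, 87, 104, 105), (83, 103,
    104, 105), (84, 86, 103, 106), (84, 88, 104, 106), (84, 103, 104, 106), (85, 89, 103, 107),
    (85, 91, 105, 107), (85, 103, 105, 107), (86, 89, 103, 108), (86, 92, 106, 108), (86, 103,
    106, 108), (87, 90, 104, 109), (87, 93, 105, 109), (87, 104, 105, 109), (88, 90, 104, 110),
    (88, 94, 106, 110), (88, 104, 106, 110), (89, 95, 107, 108), (89, 103, 107, 108), (90, 96,
    109, 110), (90, 104, 109, 110), (91, 93, 105, 111), (91, 97, 107, 111), (91, 105, 107, 111),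
    (92, 94, 106, 112), (92, 98, 108, 112), (92, 106, 108, 112), (93, 99, 109, 111), (93, 105,
    109, 111), (94, 100, 110, 112), (94, 106, 110, 112), (95, 97, 107, 113), (95, 98, 108, 113),
    (95, 107, 108, 113), (96, 99, 109, 114), (96, 100, 110, 114), (96, 109, 110, 114), (97, 101,
    111, 113), (97, 107, 111, 113), (98, 102, 112, 113), (98, 108, 112, 113), (99, 101, 111, 114),
    (99, 109, 111, 114), (100, 102, 112, 114), (100, 110, 112, 114), (101, 102, 113, 114), (101,
    111, 113, 114), (102, 112, 113, 114), (103, 104, 105, 115), (103, 104, 106, 115), (103, 105,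
    107, 115), (103, 106, 108, 115), (103, 107, 108, 115), (104, 105, 109, 115), (104, 106, 110,
    115), (104, 109, 110, 115), (105, 107, 111, 115), (105, 109, 111, 115), (106, 108, 112, 115),
    (106, 110, 112, 115), (107, 108, 113, 115), (107, 111, 113, 115), (108, 112, 113, 115), (109,
    110, 114, 115), (109, 111, 114, 115), (110, 112, 114, 115), (111, 113, 114, 115), (112, 113,
    114, 115)]

/-- The vertices of the triangulated regular tetrahedron. -/
def tetraCorners : List (Pt ℤ) :=
  [⟨300, 300, 300⟩, ⟨300, -300, -300⟩, ⟨-300, 300, -300⟩, ⟨-300, -300, 300⟩]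

/-- The other points of the triangulation of the regular tetrahedron. -/
def tetraPoints : List (Pt ℤ) :=
    [⟨-300, 0, 0⟩, ⟨0, -300, 0⟩, ⟨0, 0, -300⟩, ⟨-132, -132, -36⟩, ⟨-132, -36, -132⟩, ⟨-36, -132,
    -132⟩, ⟨0, 0, 300⟩, ⟨0, 300, 0⟩, ⟨-132, 36, 132⟩, ⟨300, 0, 0⟩, ⟨36, -132, 132⟩, ⟨-132, 132,
    36⟩, ⟨132, -132, 36⟩, ⟨36, 132, -132⟩, ⟨-113, -42, 42⟩, ⟨132, 36, -132⟩, ⟨-42, -113, 42⟩,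
    ⟨-113, 42, -42⟩, ⟨42, -113, -42⟩, ⟨-42, 42, -113⟩, ⟨-104, -26, -26⟩, ⟨42, -42, -113⟩, ⟨-26,
    -104, -26⟩, ⟨-26, -26, -104⟩, ⟨-52, -52, -52⟩, ⟨-36, 132, 132⟩, ⟨132, -36, 132⟩, ⟨132, 132,
    -36⟩, ⟨-42, -42, 113⟩, ⟨-42, 113, -42⟩, ⟨-104, 26, 26⟩, ⟨113, -42, -42⟩, ⟨26, -104, 26⟩, ⟨26,
    26, -104⟩, ⟨-55, -55, -7⟩, ⟨-55, -7, -55⟩, ⟨-7, -55, -55⟩, ⟨42, 42, 113⟩, ⟨42, 113, 42⟩, ⟨-26,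
    26, 104⟩, ⟨113, 42, 42⟩, ⟨26, -26, 104⟩, ⟨-26, 104, 26⟩, ⟨-52, 52, 52⟩, ⟨104, -26, 26⟩, ⟨52,
    -52, 52⟩, ⟨26, 104, -26⟩, ⟨-55, 7, 55⟩, ⟨104, 26, -26⟩, ⟨7, -55, 55⟩, ⟨-55, 55, 7⟩, ⟨52, 52,
    -52⟩, ⟨-34, -34, 34⟩, ⟨55, -55, 7⟩, ⟨7, 55, -55⟩, ⟨-51, -9, 9⟩, ⟨55, 7, -55⟩, ⟨-9, -51, 9⟩,
    ⟨-34, 34, -34⟩, ⟨-51, 9, -9⟩, ⟨34, -34, -34⟩, ⟨9, -51, -9⟩, ⟨-9, 9, -51⟩, ⟨-41, -26, -26⟩, ⟨9,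
    -9, -51⟩, ⟨-26, -41, -26⟩, ⟨-26, -26, -41⟩, ⟨-7, 55, 55⟩, ⟨55, -7, 55⟩, ⟨55, 55, -7⟩, ⟨-9, -9,
    51⟩, ⟨-9, 51, -9⟩, ⟨-41, 26, 26⟩, ⟨51, -9, -9⟩, ⟨26, -41, 26⟩, ⟨26, 26, -41⟩, ⟨-24, -24, 5⟩,
    ⟨-24, 5, -24⟩, ⟨5, -24, -24⟩, ⟨34, 34, 34⟩, ⟨9, 9, 51⟩, ⟨9, 51, 9⟩, ⟨-26, 26, 41⟩, ⟨51, 9, 9⟩,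
    ⟨26, -26, 41⟩, ⟨-26, 41, 26⟩, ⟨41, -26, 26⟩, ⟨26, 41, -26⟩, ⟨-24, -5, 24⟩, ⟨41, 26, -26⟩, ⟨-5,
    -24, 24⟩, ⟨-24, 24, -5⟩, ⟨24, -24, -5⟩, ⟨-5, 24, -24⟩, ⟨-32, 0, 0⟩, ⟨24, -5, -24⟩, ⟨0, -32,
    0⟩, ⟨0, 0, -32⟩, ⟨-12, -12, -12⟩, ⟨5, 24, 24⟩, ⟨24, 5, 24⟩, ⟨24, 24, 5⟩, ⟨0, 0, 32⟩, ⟨0, 32,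
    0⟩, ⟨-12, 12, 12⟩, ⟨32, 0, 0⟩, ⟨12, -12, 12⟩, ⟨12, 12, -12⟩, ⟨-7, -7, 7⟩, ⟨-7, 7, -7⟩, ⟨7, -7,
    -7⟩, ⟨7, 7, 7⟩]

/-- The acute triangulation of the regular tetrahedron. -/
def tetraMesh : Mesh ℤ :=
  -- The inner point is the centroid of the first tetrahedron, rounded to integers.
  Mesh.ofPoints ⟨0, 0, 0⟩ tetraCorners tetraPoints cellTets [(0, 1, 2, 3)] ⟨76, 118, 211⟩

/-- The vertices of the triangulated trirectangular tetrahedron. -/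
def cornerCorners : List (Pt ℤ) :=
  [⟨0, 0, 0⟩, ⟨600, 0, 0⟩, ⟨0, 600, 0⟩, ⟨0, 0, 600⟩]

/-- The other points of the triangulation of the trirectangular tetrahedron. -/
def cornerPoints : List (Pt ℤ) :=
    [⟨0, 300, 300⟩, ⟨300, 0, 300⟩, ⟨300, 300, 0⟩, ⟨168, 168, 264⟩, ⟨168, 264, 168⟩, ⟨264, 168,
    168⟩, ⟨0, 0, 182⟩, ⟨0, 182, 0⟩, ⟨0, 119, 204⟩, ⟨182, 0, 0⟩, ⟨119, 0, 204⟩, ⟨0, 204, 119⟩,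
    ⟨204, 0, 119⟩, ⟨119, 204, 0⟩, ⟨88, 136, 222⟩, ⟨204, 119, 0⟩, ⟨136, 88, 222⟩, ⟨88, 222, 136⟩,
    ⟨222, 88, 136⟩, ⟨136, 222, 88⟩, ⟨108, 179, 179⟩, ⟨222, 136, 88⟩, ⟨179, 108, 179⟩, ⟨179, 179,
    108⟩, ⟨161, 161, 161⟩, ⟨0, 106, 106⟩, ⟨106, 0, 106⟩, ⟨106, 106, 0⟩, ⟨76, 76, 203⟩, ⟨76, 203,
    76⟩, ⟨67, 164, 164⟩, ⟨203, 76, 76⟩, ⟨164, 67, 164⟩, ⟨164, 164, 67⟩, ⟨132, 132, 174⟩, ⟨132,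
    174, 132⟩, ⟨174, 132, 132⟩, ⟨69, 69, 112⟩, ⟨69, 112, 69⟩, ⟨62, 95, 143⟩, ⟨112, 69, 69⟩, ⟨95,
    62, 143⟩, ⟨62, 143, 95⟩, ⟨60, 136, 136⟩, ⟨143, 62, 95⟩, ⟨136, 60, 136⟩, ⟨95, 143, 62⟩, ⟨80,
    124, 160⟩, ⟨143, 95, 62⟩, ⟨124, 80, 160⟩, ⟨80, 160, 124⟩, ⟨136, 136, 60⟩, ⟨112, 112, 165⟩,
    ⟨160, 80, 124⟩, ⟨124, 160, 80⟩, ⟨102, 139, 159⟩, ⟨160, 124, 80⟩, ⟨139, 102, 159⟩, ⟨112, 165,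
    112⟩, ⟨102, 159, 139⟩, ⟨165, 112, 112⟩, ⟨159, 102, 139⟩, ⟨139, 159, 102⟩, ⟨130, 147, 147⟩,
    ⟨159, 139, 102⟩, ⟨147, 130, 147⟩, ⟨147, 147, 130⟩, ⟨72, 115, 115⟩, ⟨115, 72, 115⟩, ⟨115, 115,
    72⟩, ⟨100, 100, 148⟩, ⟨100, 148, 100⟩, ⟨92, 140, 140⟩, ⟨148, 100, 100⟩, ⟨140, 92, 140⟩, ⟨140,
    140, 92⟩, ⟨125, 125, 152⟩, ⟨125, 152, 125⟩, ⟨152, 125, 125⟩, ⟨103, 103, 103⟩, ⟨99, 99, 128⟩,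
    ⟨99, 128, 99⟩, ⟨89, 121, 136⟩, ⟨128, 99, 99⟩, ⟨121, 89, 136⟩, ⟨89, 136, 121⟩, ⟨136, 89, 121⟩,
    ⟨121, 136, 89⟩, ⟨105, 121, 145⟩, ⟨136, 121, 89⟩, ⟨121, 105, 145⟩, ⟨105, 145, 121⟩, ⟨145, 105,
    121⟩, ⟨121, 145, 105⟩, ⟨120, 136, 136⟩, ⟨145, 121, 105⟩, ⟨136, 120, 136⟩, ⟨136, 136, 120⟩,
    ⟨134, 134, 134⟩, ⟨105, 117, 117⟩, ⟨117, 105, 117⟩, ⟨117, 117, 105⟩, ⟨109, 109, 133⟩, ⟨109,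
    133, 109⟩, ⟨111, 127, 127⟩, ⟨133, 109, 109⟩, ⟨127, 111, 127⟩, ⟨127, 127, 111⟩, ⟨122, 122,
    133⟩, ⟨122, 133, 122⟩, ⟨133, 122, 122⟩, ⟨120, 120, 120⟩]

/-- The acute triangulation of the trirectangular tetrahedron. -/
def cornerMesh : Mesh ℤ :=
  -- Again the rounded centroid of the first tetrahedron.
  Mesh.ofPoints ⟨0, 0, 0⟩ cornerCorners cornerPoints cellTets [(0, 1, 2, 3)] ⟨17, 44, 100⟩

/-- The signs `1` and `-1`. -/
def unitSigns : List ZPhi := [⟨1, 0⟩, ⟨-1, 0⟩]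

/-- The cyclic permutations of the points `(0, ±a, ±b)`. -/
def cyclicPoints (a b : ZPhi) : List (Pt ZPhi) :=
  (unitSigns.flatMap fun s => unitSigns.map fun t => ⟨⟨0, 0⟩, s * a, t * b⟩) ++
  (unitSigns.flatMap fun s => unitSigns.map fun t => ⟨t * b, ⟨0, 0⟩, s * a⟩) ++
  (unitSigns.flatMap fun s => unitSigns.map fun t => ⟨s * a, t * b, ⟨0, 0⟩⟩)

/-- The points `(±1, ±1, ±1)`. -/
def cubePoints : List (Pt ZPhi) :=
  unitSigns.flatMap fun s => unitSigns.flatMap fun t => unitSigns.map fun u => ⟨s, t, u⟩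

/-- The vertices of the model of the dodecahedron. -/
def dodecahedronPoints : List (Pt ZPhi) := cubePoints ++ cyclicPoints ⟨-1, 1⟩ ⟨0, 1⟩

/-- The vertices of the model of the icosahedron. -/
def icosahedronPoints : List (Pt ZPhi) := cyclicPoints ⟨1, 0⟩ ⟨0, 1⟩

/-- Points on the axes through the faces of the model of the dodecahedron. -/
def facePoints : List (Pt ZPhi) := cyclicPoints ⟨0, 1⟩ ⟨1, 0⟩

/-- Points on the axes through the edges of the model of the dodecahedron. -/
def edgePoints : List (Pt ZPhi) :=
  (unitSigns.map fun s => ⟨s * ⟨2, 0⟩, ⟨0, 0⟩, ⟨0, 0⟩⟩) ++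
  (unitSigns.map fun s => ⟨⟨0, 0⟩, s * ⟨2, 0⟩, ⟨0, 0⟩⟩) ++
  (unitSigns.map fun s => ⟨⟨0, 0⟩, ⟨0, 0⟩, s * ⟨2, 0⟩⟩) ++
  (cubePoints.map fun p => ⟨p.x * ⟨-1, 1⟩, p.y, p.z * ⟨0, 1⟩⟩) ++
  (cubePoints.map fun p => ⟨p.z * ⟨0, 1⟩, p.x * ⟨-1, 1⟩, p.y⟩) ++
  (cubePoints.map fun p => ⟨p.y, p.z * ⟨0, 1⟩, p.x * ⟨-1, 1⟩⟩)

/-- The point `p` multiplied by `r`. -/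
def scalePt (r : ZPhi) (p : Pt ZPhi) : Pt ZPhi := ⟨r * p.x, r * p.y, r * p.z⟩

/-- The combinatorial structure of the triangulation of the dodecahedron: the boundary complex of the
600-cell without the tetrahedra that contain a given vertex or a neighbour of it. -/
def dodecahedronTets : List Tet :=
    [(0, 8, 20, 38), (0, 8, 24, 38), (0, 12, 24, 46), (0, 12, 28, 46), (0, 16, 20, 54), (0, 16,
    28, 54), (0, 20, 38, 54), (0, 24, 38, 46), (0, 28, 46, 54), (0, 38, 46, 54), (1, 9, 21, 39),
    (1, 9, 26, 39), (1, 14, 26, 48), (1, 14, 28, 48), (1, 16, 21, 58), (1, 16, 28, 58), (1, 21,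
    39, 58), (1, 26, 39, 48), (1, 28, 48, 58), (1, 39, 48, 58), (2, 10, 22, 40), (2, 10, 24, 40),
    (2, 12, 24, 50), (2, 12, 29, 50), (2, 17, 22, 55), (2, 17, 29, 55), (2, 22, 40, 55), (2, 24,
    40, 50), (2, 29, 50, 55), (2, 40, 50, 55), (3, 11, 23, 41), (3, 11, 26, 41), (3, 14, 26, 52),
    (3, 14, 29, 52), (3, 17, 23, 59), (3, 17, 29, 59), (3, 23, 41, 59), (3, 26, 41, 52), (3, 29,
    52, 59), (3, 41, 52, 59), (4, 8, 20, 42), (4, 8, 25, 42), (4, 13, 25, 47), (4, 13, 30, 47),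
    (4, 18, 20, 56), (4, 18, 30, 56), (4, 20, 42, 56), (4, 25, 42, 47), (4, 30, 47, 56), (4, 42,
    47, 56), (5, 9, 21, 43), (5, 9, 27, 43), (5, 15, 27, 49), (5, 15, 30, 49), (5, 18, 21, 60),
    (5, 18, 30, 60), (5, 21, 43, 60), (5, 27, 43, 49), (5, 30, 49, 60), (5, 43, 49, 60), (6, 10,
    22, 44), (6, 10, 25, 44), (6, 13, 25, 51), (6, 13, 31, 51), (6, 19, 22, 57), (6, 19, 31, 57),
    (6, 22, 44, 57), (6, 25, 44, 51), (6, 31, 51, 57), (6, 44, 51, 57), (7, 11, 23, 45), (7, 11,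
    27, 45), (7, 15, 27, 53), (7, 15, 31, 53), (7, 19, 23, 61), (7, 19, 31, 61), (7, 23, 45, 61),
    (7, 27, 45, 53), (7, 31, 53, 61), (7, 45, 53, 61), (8, 10, 24, 36), (8, 10, 25, 36), (8, 20,
    38, 42), (8, 24, 36, 38), (8, 25, 36, 42), (8, 36, 38, 42), (9, 11, 26, 37), (9, 11, 27, 37),
    (9, 21, 39, 43), (9, 26, 37, 39), (9, 27, 37, 43), (9, 37, 39, 43), (10, 22, 40, 44), (10, 24,
    36, 40), (10, 25, 36, 44), (10, 36, 40, 44), (11, 23, 41, 45), (11, 26, 37, 41), (11, 27, 37,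
    45), (11, 37, 41, 45), (12, 14, 28, 32), (12, 14, 29, 32), (12, 24, 46, 50), (12, 28, 32, 46),
    (12, 29, 32, 50), (12, 32, 46, 50), (13, 15, 30, 33), (13, 15, 31, 33), (13, 25, 47, 51), (13,
    30, 33, 47), (13, 31, 33, 51), (13, 33, 47, 51), (14, 26, 48, 52), (14, 28, 32, 48), (14, 29,
    32, 52), (14, 32, 48, 52), (15, 27, 49, 53), (15, 30, 33, 49), (15, 31, 33, 53), (15, 33, 49,
    53), (16, 18, 20, 34), (16, 18, 21, 34), (16, 20, 34, 54), (16, 21, 34, 58), (16, 28, 54, 58),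
    (16, 34, 54, 58), (17, 19, 22, 35), (17, 19, 23, 35), (17, 22, 35, 55), (17, 23, 35, 59), (17,
    29, 55, 59), (17, 35, 55, 59), (18, 20, 34, 56), (18, 21, 34, 60), (18, 30, 56, 60), (18, 34,
    56, 60), (19, 22, 35, 57), (19, 23, 35, 61), (19, 31, 57, 61), (19, 35, 57, 61), (20, 34, 54,
    62), (20, 34, 56, 62), (20, 38, 42, 62), (20, 38, 54, 62), (20, 42, 56, 62), (21, 34, 58, 63),
    (21, 34, 60, 63), (21, 39, 43, 63), (21, 39, 58, 63), (21, 43, 60, 63), (22, 35, 55, 64), (22,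
    35, 57, 64), (22, 40, 44, 64), (22, 40, 55, 64), (22, 44, 57, 64), (23, 35, 59, 65), (23, 35,
    61, 65), (23, 41, 45, 65), (23, 41, 59, 65), (23, 45, 61, 65), (24, 36, 38, 66), (24, 36, 40,
    66), (24, 38, 46, 66), (24, 40, 50, 66), (24, 46, 50, 66), (25, 36, 42, 67), (25, 36, 44, 67),
    (25, 42, 47, 67), (25, 44, 51, 67), (25, 47, 51, 67), (26, 37, 39, 68), (26, 37, 41, 68), (26,
    39, 48, 68), (26, 41, 52, 68), (26, 48, 52, 68), (27, 37, 43, 69), (27, 37, 45, 69), (27, 43,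
    49, 69), (27, 45, 53, 69), (27, 49, 53, 69), (28, 32, 46, 70), (28, 32, 48, 70), (28, 46, 54,
    70), (28, 48, 58, 70), (28, 54, 58, 70), (29, 32, 50, 71), (29, 32, 52, 71), (29, 50, 55, 71),
    (29, 52, 59, 71), (29, 55, 59, 71), (30, 33, 47, 72), (30, 33, 49, 72), (30, 47, 56, 72), (30,
    49, 60, 72), (30, 56, 60, 72), (31, 33, 51, 73), (31, 33, 53, 73), (31, 51, 57, 73), (31, 53,
    61, 73), (31, 57, 61, 73), (32, 46, 50, 86), (32, 46, 70, 86), (32, 48, 52, 88), (32, 48, 70,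
    88), (32, 50, 71, 86), (32, 52, 71, 88), (32, 70, 86, 88), (32, 71, 86, 88), (33, 47, 51, 87),
    (33, 47, 72, 87), (33, 49, 53, 89), (33, 49, 72, 89), (33, 51, 73, 87), (33, 53, 73, 89), (33,
    72, 87, 89), (33, 73, 87, 89), (34, 54, 58, 90), (34, 54, 62, 90), (34, 56, 60, 92), (34, 56,
    62, 92), (34, 58, 63, 90), (34, 60, 63, 92), (34, 62, 90, 92), (34, 63, 90, 92), (35, 55, 59,
    91), (35, 55, 64, 91), (35, 57, 61, 93), (35, 57, 64, 93), (35, 59, 65, 91), (35, 61, 65, 93),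
    (35, 64, 91, 93), (35, 65, 91, 93), (36, 38, 42, 82), (36, 38, 66, 82), (36, 40, 44, 84), (36,
    40, 66, 84), (36, 42, 67, 82), (36, 44, 67, 84), (36, 66, 82, 84), (36, 67, 82, 84), (37, 39,
    43, 83), (37, 39, 68, 83), (37, 41, 45, 85), (37, 41, 68, 85), (37, 43, 69, 83), (37, 45, 69,
    85), (37, 68, 83, 85), (37, 69, 83, 85), (38, 42, 62, 82), (38, 46, 54, 74), (38, 46, 66, 74),
    (38, 54, 62, 74), (38, 62, 74, 82), (38, 66, 74, 82), (39, 43, 63, 83), (39, 48, 58, 75), (39,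
    48, 68, 75), (39, 58, 63, 75), (39, 63, 75, 83), (39, 68, 75, 83), (40, 44, 64, 84), (40, 50,
    55, 76), (40, 50, 66, 76), (40, 55, 64, 76), (40, 64, 76, 84), (40, 66, 76, 84), (41, 45, 65,
    85), (41, 52, 59, 77), (41, 52, 68, 77), (41, 59, 65, 77), (41, 65, 77, 85), (41, 68, 77, 85),
    (42, 47, 56, 78), (42, 47, 67, 78), (42, 56, 62, 78), (42, 62, 78, 82), (42, 67, 78, 82), (43,
    49, 60, 79), (43, 49, 69, 79), (43, 60, 63, 79), (43, 63, 79, 83), (43, 69, 79, 83), (44, 51,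
    57, 80), (44, 51, 67, 80), (44, 57, 64, 80), (44, 64, 80, 84), (44, 67, 80, 84), (45, 53, 61,
    81), (45, 53, 69, 81), (45, 61, 65, 81), (45, 65, 81, 85), (45, 69, 81, 85), (46, 50, 66, 86),
    (46, 54, 70, 74), (46, 66, 74, 86), (46, 70, 74, 86), (47, 51, 67, 87), (47, 56, 72, 78), (47,
    67, 78, 87), (47, 72, 78, 87), (48, 52, 68, 88), (48, 58, 70, 75), (48, 68, 75, 88), (48, 70,
    75, 88), (49, 53, 69, 89), (49, 60, 72, 79), (49, 69, 79, 89), (49, 72, 79, 89), (50, 55, 71,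
    76), (50, 66, 76, 86), (50, 71, 76, 86), (51, 57, 73, 80), (51, 67, 80, 87), (51, 73, 80, 87),
    (52, 59, 71, 77), (52, 68, 77, 88), (52, 71, 77, 88), (53, 61, 73, 81), (53, 69, 81, 89), (53,
    73, 81, 89), (54, 58, 70, 90), (54, 62, 74, 90), (54, 70, 74, 90), (55, 59, 71, 91), (55, 64,
    76, 91), (55, 71, 76, 91), (56, 60, 72, 92), (56, 62, 78, 92), (56, 72, 78, 92), (57, 61, 73,
    93), (57, 64, 80, 93), (57, 73, 80, 93), (58, 63, 75, 90), (58, 70, 75, 90), (59, 65, 77, 91),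
    (59, 71, 77, 91), (60, 63, 79, 92), (60, 72, 79, 92), (61, 65, 81, 93), (61, 73, 81, 93), (62,
    74, 82, 94), (62, 74, 90, 94), (62, 78, 82, 94), (62, 78, 92, 94), (62, 90, 92, 94), (63, 75,
    83, 95), (63, 75, 90, 95), (63, 79, 83, 95), (63, 79, 92, 95), (63, 90, 92, 95), (64, 76, 84,
    96), (64, 76, 91, 96), (64, 80, 84, 96), (64, 80, 93, 96), (64, 91, 93, 96), (65, 77, 85, 97),
    (65, 77, 91, 97), (65, 81, 85, 97), (65, 81, 93, 97), (65, 91, 93, 97), (66, 74, 82, 98), (66,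
    74, 86, 98), (66, 76, 84, 98), (66, 76, 86, 98), (66, 82, 84, 98), (67, 78, 82, 99), (67, 78,
    87, 99), (67, 80, 84, 99), (67, 80, 87, 99), (67, 82, 84, 99), (68, 75, 83, 100), (68, 75, 88,
    100), (68, 77, 85, 100), (68, 77, 88, 100), (68, 83, 85, 100), (69, 79, 83, 101), (69, 79, 89,
    101), (69, 81, 85, 101), (69, 81, 89, 101), (69, 83, 85, 101), (70, 74, 86, 102), (70, 74, 90,
    102), (70, 75, 88, 102), (70, 75, 90, 102), (70, 86, 88, 102), (71, 76, 86, 103), (71, 76, 91,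
    103), (71, 77, 88, 103), (71, 77, 91, 103), (71, 86, 88, 103), (72, 78, 87, 104), (72, 78, 92,
    104), (72, 79, 89, 104), (72, 79, 92, 104), (72, 87, 89, 104), (73, 80, 87, 105), (73, 80, 93,
    105), (73, 81, 89, 105), (73, 81, 93, 105), (73, 87, 89, 105), (74, 82, 94, 98), (74, 86, 98,
    102), (74, 90, 94, 102), (74, 94, 98, 102), (75, 83, 95, 100), (75, 88, 100, 102), (75, 90,
    95, 102), (75, 95, 100, 102), (76, 84, 96, 98), (76, 86, 98, 103), (76, 91, 96, 103), (76, 96,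
    98, 103), (77, 85, 97, 100), (77, 88, 100, 103), (77, 91, 97, 103), (77, 97, 100, 103), (78,
    82, 94, 99), (78, 87, 99, 104), (78, 92, 94, 104), (78, 94, 99, 104), (79, 83, 95, 101), (79,
    89, 101, 104), (79, 92, 95, 104), (79, 95, 101, 104), (80, 84, 96, 99), (80, 87, 99, 105),
    (80, 93, 96, 105), (80, 96, 99, 105), (81, 85, 97, 101), (81, 89, 101, 105), (81, 93, 97,
    105), (81, 97, 101, 105), (82, 84, 98, 99), (82, 94, 98, 99), (83, 85, 100, 101), (83, 95,
    100, 101), (84, 96, 98, 99), (85, 97, 100, 101), (86, 88, 102, 103), (86, 98, 102, 103), (87,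
    89, 104, 105), (87, 99, 104, 105), (88, 100, 102, 103), (89, 101, 104, 105), (90, 92, 94, 95),
    (90, 94, 95, 102), (91, 93, 96, 97), (91, 96, 97, 103), (92, 94, 95, 104), (93, 96, 97, 105),
    (94, 95, 102, 106), (94, 95, 104, 106), (94, 98, 99, 106), (94, 98, 102, 106), (94, 99, 104,
    106), (95, 100, 101, 106), (95, 100, 102, 106), (95, 101, 104, 106), (96, 97, 103, 106), (96,
    97, 105, 106), (96, 98, 99, 106), (96, 98, 103, 106), (96, 99, 105, 106), (97, 100, 101, 106),
    (97, 100, 103, 106), (97, 101, 105, 106), (98, 102, 103, 106), (99, 104, 105, 106), (100, 102,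
    103, 106), (101, 104, 105, 106)]

/-- The acute triangulation of the dodecahedron, enlarged by the factor `20`. -/
def dodecahedronMesh : Mesh ZPhi :=
  Mesh.ofPoints ⟨⟨0, 0⟩, ⟨0, 0⟩, ⟨0, 0⟩⟩ (dodecahedronPoints.map (scalePt ⟨20, 0⟩))
    -- Since (8 + 4φ)(φ² + 1) = 20φ², the first twelve points are the centres of the faces of the
    -- enlarged dodecahedron. The others lie in its interior.
    (facePoints.map (scalePt ⟨8, 4⟩) ++ edgePoints.map (scalePt ⟨8, 0⟩) ++
      facePoints.map (scalePt ⟨6, 0⟩) ++ dodecahedronPoints.map (scalePt ⟨5, 0⟩) ++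
      facePoints.map (scalePt ⟨2, 0⟩) ++ [⟨⟨0, 0⟩, ⟨0, 0⟩, ⟨0, 0⟩⟩])
    dodecahedronTets
    [(0, 3, 5, 6), (1, 2, 4, 7), (0, 1, 10, 12), (0, 4, 15, 18), (1, 3, 9, 18), (2, 6, 14, 17),
    (3, 7, 13, 19), (0, 4, 6, 8), (0, 5, 7, 9)]
    ⟨⟨6, 0⟩, ⟨16, 0⟩, ⟨20, 0⟩⟩

/-- The triangles in the boundary of the icosahedron, joined to the centre. -/
def icosahedronTets : List Tet :=
    [(0, 2, 4, 12), (0, 2, 5, 12), (0, 4, 8, 12), (0, 5, 10, 12), (0, 8, 10, 12), (1, 3, 6, 12),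
    (1, 3, 7, 12), (1, 6, 8, 12), (1, 7, 10, 12), (1, 8, 10, 12), (2, 4, 9, 12), (2, 5, 11, 12),
    (2, 9, 11, 12), (3, 6, 9, 12), (3, 7, 11, 12), (3, 9, 11, 12), (4, 6, 8, 12), (4, 6, 9, 12),
    (5, 7, 10, 12), (5, 7, 11, 12)]

/-- The acute triangulation of the icosahedron. -/
def icosahedronMesh : Mesh ZPhi :=
  Mesh.ofPoints ⟨⟨0, 0⟩, ⟨0, 0⟩, ⟨0, 0⟩⟩ icosahedronPoints [⟨⟨0, 0⟩, ⟨0, 0⟩, ⟨0, 0⟩⟩]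
    -- The centre is the only vertex that is not a corner, and this tetrahedron contains it.
    icosahedronTets [(0, 1, 4, 11)]
    ⟨⟨2, -1⟩, ⟨0, 0⟩, ⟨1, 0⟩⟩

end AcuteTriangulation

/-! ### Evaluation of the tests. -/

namespace AcuteTriangulation

lemma tetraMesh_valid : tetraMesh.Valid where
  acute := by decide +kernel
  pair := by decide +kernel
  once := by decide +kernel
  bound := by decide +kernel
  hull := by decide +kernel
  corner := by decide +kernel
  two := by decide +kernel

lemma cornerMesh_valid : cornerMesh.Valid where
  acute := by decide +kernel
  pair := by decide +kernel
  once := by decide +kernel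
  bound := by decide +kernel
  hull := by decide +kernel
  corner := by decide +kernel
  two := by decide +kernel

lemma dodecahedronMesh_valid : dodecahedronMesh.Valid where
  acute := by decide +kernel
  pair := by decide +kernel
  once := by decide +kernel
  bound := by decide +kernel
  hull := by decide +kernel
  corner := by decide +kernel
  two := by decide +kernel

lemma icosahedronMesh_valid : icosahedronMesh.Valid where
  acute := by decide +kernel
  pair := by decide +kernel
  once := by decide +kernel
  bound := by decide +kernel
  hull := by decide +kernel
  corner := by decide +kernel
  two := by decide +kernel

end AcuteTriangulation

namespace AcuteTriangulation

open Set

/-- The set has a nontrivial acute triangulation. -/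
def Triangulable (P : Set E3) : Prop :=
  ∃ K : Geometry.SimplicialComplex ℝ E3, IsAcuteTriangulation K P ∧ IsNontrivialTriangulation K

lemma Triangulable.image {P : Set E3} (hP : Triangulable P) {e : E3 ≃ᵃ[ℝ] E3} {r : ℝ}
    (he : IsSimilarity e r) : Triangulable (e '' P) := by
  obtain ⟨K, hK, hK'⟩ := hP
  exact ⟨mapComplex K e, he.isAcuteTriangulation hK, isNontrivialTriangulation_mapComplex e hK'⟩

lemma Mesh.Valid.triangulable {R : Type} [ExactReal R] {m : Mesh R} (hm : m.Valid) :
    Triangulable m.hullSet := by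
  obtain ⟨K, -, hK⟩ := hm.exists_triangulation
  exact ⟨K, hK⟩

/-! ### The dodecahedron and icosahedron meshes fill the models. -/

section GoldenModels

lemma val_zphi (a b : ℤ) : ExactReal.val (⟨a, b⟩ : ZPhi) = a + b * Real.goldenRatio := rfl

lemma toE_scalePt (r : ZPhi) (p : Pt ZPhi) :
    (scalePt r p).toE = ExactReal.val r • p.toE := by
  ext i
  fin_cases i <;> simp [scalePt, Pt.toE, ExactReal.val_mul]

lemma exists_unitSign {x y : ℝ} (hy : 0 ≤ y) (h : |x| = y) :
    ∃ s ∈ unitSigns, x = ExactReal.val s * y := by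
  rcases (abs_eq hy).1 h with h | h
  · exact ⟨⟨1, 0⟩, by simp [unitSigns], by simp [val_zphi, h]⟩
  · exact ⟨⟨-1, 0⟩, by simp [unitSigns], by simp [val_zphi, h]⟩

lemma abs_val_unitSign {s : ZPhi} (hs : s ∈ unitSigns) : |ExactReal.val s| = 1 := by
  simp only [unitSigns, List.mem_cons, List.not_mem_nil, or_false] at hs
  rcases hs with rfl | rfl <;> simp [val_zphi]

lemma ext_toE {x : E3} {p : Pt ZPhi} (h0 : x 0 = ExactReal.val p.x) (h1 : x 1 = ExactReal.val p.y)
    (h2 : x 2 = ExactReal.val p.z) : p.toE = x := by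
  ext i
  fin_cases i <;> simp [Pt.toE, h0, h1, h2]

lemma val_zero : ExactReal.val (⟨0, 0⟩ : ZPhi) = 0 := by simp [val_zphi]

lemma mem_cyclicPoints_iff {a b : ZPhi} (ha : 0 ≤ ExactReal.val a) (hb : 0 ≤ ExactReal.val b)
    (x : E3) : x ∈ Pt.toE '' {p | p ∈ cyclicPoints a b} ↔
      ∃ i, x i = 0 ∧ |x (i + 1)| = ExactReal.val a ∧ |x (i + 2)| = ExactReal.val b := by
  constructor
  · rintro ⟨p, hp, rfl⟩
    simp only [cyclicPoints, mem_ofPred_eq, List.mem_append, List.mem_flatMap, List.mem_map] at hp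
    rcases hp with (⟨s, hs, t, ht, rfl⟩ | ⟨s, hs, t, ht, rfl⟩) | ⟨s, hs, t, ht, rfl⟩
    · refine ⟨0, ?_⟩
      simp [Pt.toE, val_zero, ExactReal.val_mul, abs_mul, abs_val_unitSign hs, abs_val_unitSign ht,
        abs_of_nonneg ha, abs_of_nonneg hb]
    · refine ⟨1, ?_⟩
      simp [Pt.toE, val_zero, ExactReal.val_mul, abs_mul, abs_val_unitSign hs, abs_val_unitSign ht,
        abs_of_nonneg ha, abs_of_nonneg hb]
    · refine ⟨2, ?_⟩
      simp [Pt.toE, val_zero, ExactReal.val_mul, abs_mul, abs_val_unitSign hs, abs_val_unitSign ht,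
        abs_of_nonneg ha, abs_of_nonneg hb]
  · rintro ⟨i, h0, h1, h2⟩
    obtain ⟨s, hs, h1⟩ := exists_unitSign ha h1
    obtain ⟨t, ht, h2⟩ := exists_unitSign hb h2
    rw [← ExactReal.val_mul] at h1 h2
    rw [← val_zero] at h0
    simp only [cyclicPoints, mem_image, mem_ofPred_eq, List.mem_append, List.mem_flatMap,
      List.mem_map]
    fin_cases i
    · exact ⟨_, Or.inl (Or.inl ⟨s, hs, t, ht, rfl⟩), ext_toE h0 h1 h2⟩
    · exact ⟨_, Or.inl (Or.inr ⟨s, hs, t, ht, rfl⟩), ext_toE h2 h0 h1⟩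
    · exact ⟨_, Or.inr ⟨s, hs, t, ht, rfl⟩, ext_toE h1 h2 h0⟩

lemma mem_cubePoints_iff (x : E3) :
    x ∈ Pt.toE '' {p | p ∈ cubePoints} ↔ ∀ i, |x i| = 1 := by
  simp only [cubePoints, mem_image, mem_ofPred_eq, List.mem_flatMap, List.mem_map]
  constructor
  · rintro ⟨_, ⟨s, hs, t, ht, u, hu, rfl⟩, rfl⟩ i
    fin_cases i
    · simpa [Pt.toE] using abs_val_unitSign hs
    · simpa [Pt.toE] using abs_val_unitSign ht
    · simpa [Pt.toE] using abs_val_unitSign hu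
  · intro h
    obtain ⟨s, hs, h0⟩ := exists_unitSign zero_le_one (h 0)
    obtain ⟨t, ht, h1⟩ := exists_unitSign zero_le_one (h 1)
    obtain ⟨u, hu, h2⟩ := exists_unitSign zero_le_one (h 2)
    rw [mul_one] at h0 h1 h2
    exact ⟨_, ⟨s, hs, t, ht, u, hu, rfl⟩, ext_toE h0 h1 h2⟩

lemma val_phi : ExactReal.val (⟨0, 1⟩ : ZPhi) = Real.goldenRatio := by simp [val_zphi]

lemma val_inv_phi : ExactReal.val (⟨-1, 1⟩ : ZPhi) = Real.goldenRatio⁻¹ := by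
  rw [val_zphi, Real.inv_goldenRatio, Real.goldenRatio, Real.goldenConj]
  push_cast; ring

lemma image_dodecahedronPoints :
    Pt.toE '' {p | p ∈ dodecahedronPoints} = PlatonicType.dodecahedron.vertices := by
  have hphi : 0 ≤ Real.goldenRatio := Real.goldenRatio_pos.le
  ext x
  have h1 := mem_cyclicPoints_iff (a := ⟨-1, 1⟩) (b := ⟨0, 1⟩) (by rw [val_inv_phi]; positivity)
    (by rw [val_phi]; exact hphi) x
  have h2 := mem_cubePoints_iff x
  rw [val_phi, val_inv_phi] at h1
  have h3 : {p | p ∈ dodecahedronPoints} =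
      {p | p ∈ cubePoints} ∪ {p | p ∈ cyclicPoints ⟨-1, 1⟩ ⟨0, 1⟩} := by
    ext p; simp [dodecahedronPoints]
  rw [h3, image_union]
  exact or_congr h2 h1

lemma image_icosahedronPoints :
    Pt.toE '' {p | p ∈ icosahedronPoints} = PlatonicType.icosahedron.vertices := by
  have hphi : 0 ≤ Real.goldenRatio := Real.goldenRatio_pos.le
  have h0 : ExactReal.val (⟨1, 0⟩ : ZPhi) = 1 := by simp [val_zphi]
  ext x
  have h1 := mem_cyclicPoints_iff (a := ⟨1, 0⟩) (b := ⟨0, 1⟩) (by rw [h0]; norm_num)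
    (by rw [val_phi]; exact hphi) x
  rw [val_phi, h0] at h1
  exact h1

lemma image_smul_convexHull (r : ℝ) (s : Set E3) :
    (fun x => r • x) '' convexHull ℝ s = convexHull ℝ ((fun x => r • x) '' s) :=
  (LinearMap.lsmul ℝ E3 r).image_convexHull s

lemma hullSet_dodecahedronMesh :
    dodecahedronMesh.hullSet = (fun x : E3 => (20 : ℝ) • x) '' PlatonicType.dodecahedron.model := by
  have h20 : ExactReal.val (⟨20, 0⟩ : ZPhi) = 20 := by simp [val_zphi]
  rw [dodecahedronMesh, Mesh.hullSet_ofPoints, PlatonicType.model, image_smul_convexHull,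
    ← image_dodecahedronPoints, image_image]
  congr 1
  ext x
  simp only [List.mem_map, mem_image, mem_ofPred_eq]
  constructor
  · rintro ⟨_, ⟨p, hp, rfl⟩, rfl⟩
    exact ⟨p, hp, by rw [toE_scalePt, h20]⟩
  · rintro ⟨p, hp, rfl⟩
    exact ⟨_, ⟨p, hp, rfl⟩, by rw [toE_scalePt, h20]⟩

lemma hullSet_icosahedronMesh :
    icosahedronMesh.hullSet = PlatonicType.icosahedron.model := by
  rw [icosahedronMesh, Mesh.hullSet_ofPoints, PlatonicType.model, image_icosahedronPoints]

end GoldenModels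

/-! ### The other solids as intersections of half-spaces. -/

section HalfSpaces

/-- The linear form with the given coefficients. -/
noncomputable def linForm (a b c : ℝ) : E3 →ₗ[ℝ] ℝ :=
  a • (EuclideanSpace.proj (0 : Fin 3) : E3 →L[ℝ] ℝ).toLinearMap +
  b • (EuclideanSpace.proj (1 : Fin 3) : E3 →L[ℝ] ℝ).toLinearMap +
  c • (EuclideanSpace.proj (2 : Fin 3) : E3 →L[ℝ] ℝ).toLinearMap

lemma linForm_apply (a b c : ℝ) (x : E3) : linForm a b c x = a * x 0 + b * x 1 + c * x 2 := by
  simp [linForm]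

lemma le_of_mem_convexHull {V : Set E3} (a b c d : ℝ) (h : ∀ v ∈ V, d ≤ a * v 0 + b * v 1 + c * v 2)
    {x : E3} (hx : x ∈ convexHull ℝ V) : d ≤ a * x 0 + b * x 1 + c * x 2 := by
  have hsub : V ⊆ {x | d ≤ linForm a b c x} := fun v hv => by
    show d ≤ linForm a b c v
    rw [linForm_apply]; exact h v hv
  have := convexHull_min hsub (convex_halfSpace_ge (linForm a b c).isLinear d) hx
  rwa [mem_ofPred_eq, linForm_apply] at this

lemma mem_convexHull_of_sum {α : Type*} [Fintype α] {V : Set E3} {x : E3} (w : α → ℝ) (p : α → E3)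
    (hw : ∀ a, 0 ≤ w a) (hsum : ∑ a, w a = 1) (hp : ∀ a, p a ∈ V)
    (hx : ∀ i, x i = ∑ a, w a * p a i) : x ∈ convexHull ℝ V := by
  have h := (convex_convexHull ℝ V).sum_mem (t := Finset.univ) (fun a _ => hw a) hsum
    fun a _ => subset_convexHull ℝ V (hp a)
  have hx' : x = ∑ a, w a • p a := by
    ext i
    simp [hx]
  rwa [hx']

lemma val_int (a : ℤ) : ExactReal.val a = (a : ℝ) := rfl

lemma hullSet_cornerMesh : cornerMesh.hullSet =
    {x : E3 | 0 ≤ x 0 ∧ 0 ≤ x 1 ∧ 0 ≤ x 2 ∧ x 0 + x 1 + x 2 ≤ 600} := by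
  rw [cornerMesh, Mesh.hullSet_ofPoints]
  ext x
  constructor
  · intro hx
    have hV : ∀ a b c d : ℝ, d ≤ 0 → d ≤ a * 600 → d ≤ b * 600 → d ≤ c * 600 →
        d ≤ a * x 0 + b * x 1 + c * x 2 := by
      intro a b c d h0 h1 h2 h3
      refine le_of_mem_convexHull a b c d ?_ hx
      rintro _ ⟨p, hp, rfl⟩
      simp only [cornerCorners, mem_ofPred_eq, List.mem_cons, List.not_mem_nil, or_false] at hp
      rcases hp with rfl | rfl | rfl | rfl <;> simpa [Pt.toE, val_int]
    have h0 := hV 1 0 0 0 (by norm_num) (by norm_num) (by norm_num) (by norm_num)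
    have h1 := hV 0 1 0 0 (by norm_num) (by norm_num) (by norm_num) (by norm_num)
    have h2 := hV 0 0 1 0 (by norm_num) (by norm_num) (by norm_num) (by norm_num)
    have h3 := hV (-1) (-1) (-1) (-600) (by norm_num) (by norm_num) (by norm_num) (by norm_num)
    refine ⟨?_, ?_, ?_, ?_⟩ <;> linarith
  · rintro ⟨h0, h1, h2, h3⟩
    refine mem_convexHull_of_sum
      -- The barycentric coordinates, each nonnegative by one of the four inequalities.
      ![1 - (x 0 + x 1 + x 2) / 600, x 0 / 600, x 1 / 600, x 2 / 600]
      (fun a => Pt.toE (cornerCorners.get a)) ?_ ?_ (fun a => ⟨_, List.get_mem _ _, rfl⟩) ?_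
    · intro a
      fin_cases a <;> simp <;> linarith
    · simp [Fin.sum_univ_four]; ring
    · intro i
      fin_cases i <;> simp [cornerCorners, Fin.sum_univ_four, Pt.toE, val_int]

lemma hullSet_tetraMesh : tetraMesh.hullSet =
    {x : E3 | -300 ≤ x 0 + x 1 + x 2 ∧ -300 ≤ x 0 - x 1 - x 2 ∧ -300 ≤ -x 0 + x 1 - x 2 ∧
      -300 ≤ -x 0 - x 1 + x 2} := by
  rw [tetraMesh, Mesh.hullSet_ofPoints]
  ext x
  constructor
  · intro hx
    have hV : ∀ a b c d : ℝ, d ≤ (a + b + c) * 300 → d ≤ (a - b - c) * 300 →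
        d ≤ (-a + b - c) * 300 → d ≤ (-a - b + c) * 300 → d ≤ a * x 0 + b * x 1 + c * x 2 := by
      intro a b c d h0 h1 h2 h3
      refine le_of_mem_convexHull a b c d ?_ hx
      rintro _ ⟨p, hp, rfl⟩
      simp only [tetraCorners, mem_ofPred_eq, List.mem_cons, List.not_mem_nil, or_false] at hp
      rcases hp with rfl | rfl | rfl | rfl <;> simp [Pt.toE, val_int] <;> linarith
    have h0 := hV 1 1 1 (-300) (by norm_num) (by norm_num) (by norm_num) (by norm_num)
    have h1 := hV 1 (-1) (-1) (-300) (by norm_num) (by norm_num) (by norm_num) (by norm_num)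
    have h2 := hV (-1) 1 (-1) (-300) (by norm_num) (by norm_num) (by norm_num) (by norm_num)
    have h3 := hV (-1) (-1) 1 (-300) (by norm_num) (by norm_num) (by norm_num) (by norm_num)
    refine ⟨?_, ?_, ?_, ?_⟩ <;> linarith
  · rintro ⟨h0, h1, h2, h3⟩
    refine mem_convexHull_of_sum
      ![(300 + x 0 + x 1 + x 2) / 1200, (300 + x 0 - x 1 - x 2) / 1200,
        (300 - x 0 + x 1 - x 2) / 1200, (300 - x 0 - x 1 + x 2) / 1200]
      (fun a => Pt.toE (tetraCorners.get a)) ?_ ?_ (fun a => ⟨_, List.get_mem _ _, rfl⟩) ?_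
    · intro a
      fin_cases a <;> simp <;> linarith
    · simp [Fin.sum_univ_four]; ring
    · intro i
      fin_cases i <;> simp [tetraCorners, Fin.sum_univ_four, Pt.toE, val_int] <;> ring

lemma vertices_tetrahedron : (fun x : E3 => (300 : ℝ) • x) '' PlatonicType.tetrahedron.vertices =
    Pt.toE '' {p | p ∈ tetraCorners} := by
  ext x
  constructor
  · rintro ⟨v, ⟨h, hprod⟩, rfl⟩
    have key : ∀ p : Pt ℤ, p ∈ tetraCorners → 300 * v 0 = p.x → 300 * v 1 = p.y →
        300 * v 2 = p.z → (300 : ℝ) • v ∈ Pt.toE '' {p | p ∈ tetraCorners} := by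
      intro p hp h0 h1 h2
      refine ⟨p, hp, ?_⟩
      ext i
      fin_cases i <;> simp [Pt.toE, val_int, h0, h1, h2]
    have hv : ∀ i, v i = 1 ∨ v i = -1 := fun i => (abs_eq zero_le_one).1 (h i)
    rcases hv 0 with h0 | h0 <;> rcases hv 1 with h1 | h1 <;> rcases hv 2 with h2 | h2 <;>
      rw [h0, h1, h2] at hprod <;> norm_num at hprod
    · exact key ⟨300, 300, 300⟩ (by simp [tetraCorners]) (by simp [h0]) (by simp [h1]) (by simp [h2])
    · exact key ⟨300, -300, -300⟩ (by simp [tetraCorners]) (by simp [h0]) (by simp [h1])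
        (by simp [h2])
    · exact key ⟨-300, 300, -300⟩ (by simp [tetraCorners]) (by simp [h0]) (by simp [h1])
        (by simp [h2])
    · exact key ⟨-300, -300, 300⟩ (by simp [tetraCorners]) (by simp [h0]) (by simp [h1])
        (by simp [h2])
  · rintro ⟨p, hp, rfl⟩
    refine ⟨(1 / 300 : ℝ) • p.toE, ?_, ?_⟩
    · simp only [tetraCorners, mem_ofPred_eq, List.mem_cons, List.not_mem_nil, or_false] at hp
      rcases hp with rfl | rfl | rfl | rfl <;>
        simp [PlatonicType.vertices, Fin.forall_fin_succ, Pt.toE, val_int]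
    · simp only [smul_smul]
      norm_num

lemma model_tetrahedron : tetraMesh.hullSet =
    (fun x : E3 => (300 : ℝ) • x) '' PlatonicType.tetrahedron.model := by
  rw [PlatonicType.model, image_smul_convexHull, vertices_tetrahedron, tetraMesh,
    Mesh.hullSet_ofPoints]

lemma image_smul_eq {r : ℝ} (hr : r ≠ 0) {s t : Set E3} (h : ∀ x, r • x ∈ t ↔ x ∈ s) :
    (fun x : E3 => r • x) '' s = t := by
  ext x
  constructor
  · rintro ⟨y, hy, rfl⟩
    exact (h y).2 hy
  · intro hx
    refine ⟨r⁻¹ • x, (h _).1 ?_, ?_⟩ <;> simp [smul_smul, hr, hx]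

lemma mem_model_octahedron (x : E3) :
    x ∈ PlatonicType.octahedron.model ↔ |x 0| + |x 1| + |x 2| ≤ 1 := by
  constructor
  · intro hx
    -- The eight facet inequalities; choosing the signs opposite to those of the coordinates of `x`
    -- gives the bound on the sum of absolute values.
    have hV : ∀ a b c : ℝ, |a| = 1 → |b| = 1 → |c| = 1 →
        -1 ≤ a * x 0 + b * x 1 + c * x 2 := by
      intro a b c ha hb hc
      refine le_of_mem_convexHull a b c _ ?_ hx
      rintro v ⟨i, h0, h1, h2⟩
      fin_cases i
      · have := neg_abs_le (a * v 0)
        simp_all [abs_mul]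
      · have := neg_abs_le (b * v 1)
        simp_all [abs_mul]
      · have := neg_abs_le (c * v 2)
        simp_all [abs_mul]
    have hs : ∀ t : ℝ, ∃ a : ℝ, |a| = 1 ∧ a * t = -|t| := fun t => by
      rcases le_total 0 t with h | h
      · exact ⟨-1, by simp, by simp [abs_of_nonneg h]⟩
      · exact ⟨1, by simp, by simp [abs_of_nonpos h]⟩
    obtain ⟨a, ha, ha'⟩ := hs (x 0)
    obtain ⟨b, hb, hb'⟩ := hs (x 1)
    obtain ⟨c, hc, hc'⟩ := hs (x 2)
    have := hV a b c ha hb hc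
    linarith
  · intro hx
    have h0 := abs_le.1 (le_refl |x 0|)
    have h1 := abs_le.1 (le_refl |x 1|)
    have h2 := abs_le.1 (le_refl |x 2|)
    refine mem_convexHull_of_sum
      -- Positive and negative parts of the coordinates serve as weights. The missing mass is split
      -- equally between two opposite vertices, which leaves the point unchanged.
      ![(|x 0| + x 0) / 2 + (1 - |x 0| - |x 1| - |x 2|) / 2,
        (|x 0| - x 0) / 2 + (1 - |x 0| - |x 1| - |x 2|) / 2,
        (|x 1| + x 1) / 2, (|x 1| - x 1) / 2, (|x 2| + x 2) / 2, (|x 2| - x 2) / 2]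
      ![!₂[1, 0, 0], !₂[-1, 0, 0], !₂[0, 1, 0], !₂[0, -1, 0], !₂[0, 0, 1], !₂[0, 0, -1]] ?_ ?_ ?_ ?_
    · intro a
      fin_cases a <;> simp <;> linarith
    · simp [Fin.sum_univ_succ]; ring
    · intro a
      fin_cases a
      · exact ⟨0, by simp⟩
      · exact ⟨0, by simp⟩
      · exact ⟨1, by simp⟩
      · exact ⟨1, by simp⟩
      · exact ⟨2, by simp⟩
      · exact ⟨2, by simp⟩
    · intro i
      fin_cases i <;> simp [Fin.sum_univ_succ] <;> ring

lemma mem_model_cube (x : E3) : x ∈ PlatonicType.cube.model ↔ ∀ i, |x i| ≤ 1 := by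
  constructor
  · intro hx i
    have hc : Convex ℝ {x : E3 | |x i| ≤ 1} := by
      have h1 : {x : E3 | |x i| ≤ 1} =
          (EuclideanSpace.proj i : E3 →L[ℝ] ℝ).toLinearMap ⁻¹' Icc (-1) 1 := by
        ext x
        simp [abs_le]
      rw [h1]
      exact (convex_Icc (-1 : ℝ) 1).linear_preimage _
    exact convexHull_min (fun v hv => (hv i).le) hc hx
  · intro hx
    have hx' := fun i => abs_le.1 (hx i)
    let s : Fin 2 → ℝ := ![1, -1]
    -- Product weights: each coordinate is independently a convex combination of 1 and -1.
    refine mem_convexHull_of_sum (α := Fin 2 × Fin 2 × Fin 2)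
      (fun a => (1 + s a.1 * x 0) / 2 * ((1 + s a.2.1 * x 1) / 2) * ((1 + s a.2.2 * x 2) / 2))
      (fun a => !₂[s a.1, s a.2.1, s a.2.2]) ?_ ?_ ?_ ?_
    · have : ∀ (a : Fin 2) i, 0 ≤ (1 + s a * x i) / 2 := by
        intro a i
        obtain ⟨h1, h2⟩ := hx' i
        fin_cases a <;> simp [s] <;> linarith
      intro a
      exact mul_nonneg (mul_nonneg (this _ _) (this _ _)) (this _ _)
    · simp [Fintype.sum_prod_type, s]; ring
    · have : ∀ a, |s a| = 1 := by
        intro a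
        fin_cases a <;> simp [s]
      intro a i
      fin_cases i <;> simp [this]
    · intro i
      fin_cases i <;> simp [Fintype.sum_prod_type, s] <;> ring

lemma model_octahedron : (fun x : E3 => (600 : ℝ) • x) '' PlatonicType.octahedron.model =
    {x : E3 | |x 0| + |x 1| + |x 2| ≤ 600} := by
  refine image_smul_eq (by norm_num) fun x => ?_
  rw [mem_model_octahedron]
  simp only [mem_ofPred_eq, PiLp.smul_apply, smul_eq_mul, abs_mul, Nat.abs_ofNat]
  constructor <;> intro h <;> linarith

lemma model_cube : (fun x : E3 => (300 : ℝ) • x) '' PlatonicType.cube.model =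
    {x : E3 | ∀ i, |x i| ≤ 300} := by
  refine image_smul_eq (by norm_num) fun x => ?_
  rw [mem_model_cube]
  simp only [mem_ofPred_eq, PiLp.smul_apply, smul_eq_mul, abs_mul, Nat.abs_ofNat]
  exact forall_congr' fun i => ⟨fun h => by linarith, fun h => by linarith⟩

end HalfSpaces

end AcuteTriangulation

namespace AcuteTriangulation

open Set

/-! ### Sign changes of coordinates combined with translations. -/

section Signs

/-- The linear isometry that multiplies the coordinates by signs. -/
noncomputable def signIsometry (ε : Fin 3 → ℤ) (hε : ∀ i, ε i * ε i = 1) : E3 ≃ₗᵢ[ℝ] E3 where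
  toFun x := WithLp.toLp 2 fun i => ε i * x i
  invFun x := WithLp.toLp 2 fun i => ε i * x i
  map_add' x y := by ext i; simp [mul_add]
  map_smul' r x := by ext i; simp [mul_left_comm]
  left_inv x := by
    ext i
    have h : (ε i * ε i : ℝ) = 1 := by exact_mod_cast hε i
    simp [← mul_assoc, h]
  right_inv x := by
    ext i
    have h : (ε i * ε i : ℝ) = 1 := by exact_mod_cast hε i
    simp [← mul_assoc, h]
  norm_map' x := by
    have h : ∀ i, (ε i ^ 2 : ℝ) = 1 := fun i => by rw [sq]; exact_mod_cast hε i
    simp [EuclideanSpace.norm_eq, mul_pow, h]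

variable (ε : Fin 3 → ℤ) (hε : ∀ i, ε i * ε i = 1)

/-- The isometry `x ↦ (ε i * (x i - c))ᵢ`. -/
noncomputable def signMap (c : ℤ) : E3 ≃ᵃ[ℝ] E3 :=
  similarity (signIsometry ε hε) one_ne_zero (WithLp.toLp 2 fun i => -(ε i * c))

lemma signMap_apply (c : ℤ) (x : E3) (i : Fin 3) : signMap ε hε c x i = ε i * (x i - c) := by
  simp [signMap, similarity_apply, signIsometry]
  ring

lemma isSimilarity_signMap (c : ℤ) : IsSimilarity (signMap ε hε c) 1 :=
  isSimilarity_similarity _ _ _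

lemma mem_image_signMap (c : ℤ) {S : Set E3} {x : E3} :
    x ∈ signMap ε hε c '' S ↔ (WithLp.toLp 2 fun i => ε i * x i + c : E3) ∈ S := by
  have h : ∀ i, (ε i * ε i : ℝ) = 1 := fun i => by exact_mod_cast hε i
  constructor
  · rintro ⟨y, hy, rfl⟩
    convert hy using 1
    ext i
    simp [signMap_apply, ← mul_assoc, h]
  · intro hx
    refine ⟨_, hx, ?_⟩
    ext i
    simp [signMap_apply, ← mul_assoc, h]

end Signs

/-! ### The octahedron by repeated reflection of the trirectangular tetrahedron. -/

section Octahedron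

lemma mem_of_mem_face {K : Geometry.SimplicialComplex ℝ E3} {P : Set E3}
    (hK : IsAcuteTriangulation K P) {s : Finset E3} (hs : s ∈ K.faces) {v : E3} (hv : v ∈ s) :
    v ∈ P :=
  hK.space_eq ▸ K.subset_space hs hv

/-- A triangulation of a set on one side of a coordinate plane and its mirror image fit together. -/
lemma Triangulable.union_reflection {P : Set E3} (hP : Triangulable P) {ε : Fin 3 → ℤ}
    (hε : ∀ i, ε i * ε i = 1) {k : Fin 3} (hk : ε k = -1) (hk' : ∀ i, i ≠ k → ε i = 1)
    (hpos : ∀ x ∈ P, 0 ≤ x k) : Triangulable (P ∪ signMap ε hε 0 '' P) := by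
  obtain ⟨K, hK, hK'⟩ := hP
  let f : E3 →ₗ[ℝ] ℝ := (EuclideanSpace.proj k : E3 →L[ℝ] ℝ).toLinearMap
  have hf : ∀ x, f x = x k := fun _ => rfl
  have hek : ∀ x, signMap ε hε 0 x k = -x k := fun x => by simp [signMap_apply, hk]
  have hfix : ∀ x : E3, x k = 0 → signMap ε hε 0 x = x := fun x hx => by
    ext i
    by_cases hi : i = k
    · rw [hi, hek, hx, neg_zero]
    · simp [signMap_apply, hk' i hi]
  refine ⟨glue K (mapComplex K (signMap ε hε 0)) f 0 ?_ ?_ ?_,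
    isAcuteTriangulation_glue hK ((isSimilarity_signMap ε hε 0).isAcuteTriangulation hK),
    isNontrivialTriangulation_glue hK'⟩
  · intro s hs v hv
    exact hpos v (mem_of_mem_face hK hs hv)
  · rintro _ ⟨s, hs, rfl⟩ v hv
    obtain ⟨u, hu, rfl⟩ := Finset.mem_map.1 hv
    have := hpos u (mem_of_mem_face hK hs hu)
    show signMap ε hε 0 u k ≤ 0
    rw [hek]; linarith
  · rintro _ ⟨s, hs, rfl⟩ hne
    -- The reflection fixes its mirror pointwise, so the part of a reflected face in the mirror is
    -- already part of the original face.
    refine K.down_closed hs ?_ hne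
    intro v hv
    obtain ⟨hv, hv0⟩ := Finset.mem_filter.1 hv
    obtain ⟨u, hu, rfl⟩ := Finset.mem_map.1 hv
    have h0 : signMap ε hε 0 u k = 0 := hv0
    rw [hek, neg_eq_zero] at h0
    show signMap ε hε 0 u ∈ s
    rwa [hfix u h0]

/-- The trirectangular mesh fills one octant; each of the three reflections doubles the set and
replaces one coordinate by its absolute value. -/
lemma triangulable_octahedron : Triangulable {x : E3 | |x 0| + |x 1| + |x 2| ≤ 600} := by
  have h := cornerMesh_valid.triangulable
  rw [hullSet_cornerMesh] at h
  have h0 := h.union_reflection (ε := ![-1, 1, 1]) (k := 0) (by decide) rfl (by decide)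
    fun x hx => hx.1
  have e0 : {x : E3 | 0 ≤ x 0 ∧ 0 ≤ x 1 ∧ 0 ≤ x 2 ∧ x 0 + x 1 + x 2 ≤ 600} ∪
      signMap ![-1, 1, 1] (by decide) 0 ''
        {x : E3 | 0 ≤ x 0 ∧ 0 ≤ x 1 ∧ 0 ≤ x 2 ∧ x 0 + x 1 + x 2 ≤ 600} =
      {x : E3 | 0 ≤ x 1 ∧ 0 ≤ x 2 ∧ |x 0| + x 1 + x 2 ≤ 600} := by
    ext x
    simp only [mem_union, mem_image_signMap, mem_ofPred_eq]
    rcases abs_cases (x 0) with ⟨ha, hb⟩ | ⟨ha, hb⟩ <;> rw [ha] <;> simp <;> grind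
  rw [e0] at h0
  have h1 := h0.union_reflection (ε := ![1, -1, 1]) (k := 1) (by decide) rfl (by decide)
    fun x hx => hx.1
  have e1 : {x : E3 | 0 ≤ x 1 ∧ 0 ≤ x 2 ∧ |x 0| + x 1 + x 2 ≤ 600} ∪
      signMap ![1, -1, 1] (by decide) 0 ''
        {x : E3 | 0 ≤ x 1 ∧ 0 ≤ x 2 ∧ |x 0| + x 1 + x 2 ≤ 600} =
      {x : E3 | 0 ≤ x 2 ∧ |x 0| + |x 1| + x 2 ≤ 600} := by
    ext x
    simp only [mem_union, mem_image_signMap, mem_ofPred_eq]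
    rcases abs_cases (x 1) with ⟨ha, hb⟩ | ⟨ha, hb⟩ <;> rw [ha] <;> simp <;> grind
  rw [e1] at h1
  have h2 := h1.union_reflection (ε := ![1, 1, -1]) (k := 2) (by decide) rfl (by decide)
    fun x hx => hx.1
  convert h2 using 1
  ext x
  simp only [mem_union, mem_image_signMap, mem_ofPred_eq]
  rcases abs_cases (x 2) with ⟨ha, hb⟩ | ⟨ha, hb⟩ <;> rw [ha] <;> simp <;> grind

end Octahedron

/-! ### The cube as a regular tetrahedron with four trirectangular corners. -/

section Cube

lemma Mesh.mem_range_quad {R : Type} [ExactReal R] {m : Mesh R} {t : Tet} {x : E3} :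
    x ∈ range (m.quad t) ↔ ∃ n ∈ t.vertices, m.vertex n = x := by
  obtain ⟨a, b, c, d⟩ := t
  simp only [Mesh.quad, Tet.vertices, mem_range, Fin.exists_fin_succ]
  simp

/-- In the face of the trirectangular tetrahedron that does not contain the right angles, its
triangulation matches that of the regular tetrahedron in one of its faces. -/
def matchTest (ε : Fin 3 → ℤ) : Bool :=
  cornerMesh.tets.all fun t => tetraMesh.tets.any fun t' => t.vertices.all fun n =>
    let p := cornerMesh.pt n
    !decide (p.x + p.y + p.z = 600) || t'.vertices.any fun n' =>
      let q := tetraMesh.pt n'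
      decide (q.x = ε 0 * (p.x - 300)) && decide (q.y = ε 1 * (p.y - 300)) &&
        decide (q.z = ε 2 * (p.z - 300))

lemma matchTest_eq : (matchTest ![1, 1, 1] && matchTest ![1, -1, -1] && matchTest ![-1, 1, -1] &&
    matchTest ![-1, -1, 1]) = true := by
  decide +kernel

/-- The set has a triangulation that contains the given simplices. -/
def TriangulableExtending (F : Set (Finset E3)) (P : Set E3) : Prop :=
  ∃ K : Geometry.SimplicialComplex ℝ E3, IsAcuteTriangulation K P ∧ IsNontrivialTriangulation K ∧
    F ⊆ K.faces

/-- The simplices of the triangulation of the regular tetrahedron. -/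
def tetraFaces : Set (Finset E3) :=
  {s | s.Nonempty ∧ ∃ t ∈ tetraMesh.tets, (s : Set E3) ⊆ range (tetraMesh.quad t)}

/-- Keeping the faces of the central tetrahedron in the complex makes the step repeatable: each
corner meets the set built so far only in the plane of one face of this tetrahedron. -/
lemma TriangulableExtending.union_corner {P : Set E3} (hP : TriangulableExtending tetraFaces P)
    {ε : Fin 3 → ℤ} (hε : ∀ i, ε i * ε i = 1) (hmatch : matchTest ε = true)
    (hpos : ∀ x ∈ P, -300 ≤ ε 0 * x 0 + ε 1 * x 1 + ε 2 * x 2) :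
    TriangulableExtending tetraFaces (P ∪ signMap ε hε 300 '' cornerMesh.hullSet) := by
  obtain ⟨K, hK, hK', hF⟩ := hP
  obtain ⟨C, hfaces, hC, -⟩ := cornerMesh_valid.exists_triangulation
  -- The slanted face, where the coordinates sum to 600, thus goes to the plane with value -300, and
  -- the rest of the corner to the far side of it.
  have hform : ∀ x, linForm (ε 0) (ε 1) (ε 2) (signMap ε hε 300 x) = x 0 + x 1 + x 2 - 900 := by
    intro x
    have h : ∀ i, (ε i * ε i : ℝ) = 1 := fun i => by exact_mod_cast hε i
    simp only [linForm_apply, signMap_apply]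
    push_cast
    linear_combination (x 0 - 300) * h 0 + (x 1 - 300) * h 1 + (x 2 - 300) * h 2
  refine ⟨glue K (mapComplex C (signMap ε hε 300)) (linForm (ε 0) (ε 1) (ε 2)) (-300) ?_ ?_ ?_,
    isAcuteTriangulation_glue hK ((isSimilarity_signMap ε hε 300).isAcuteTriangulation hC),
    isNontrivialTriangulation_glue hK', hF.trans subset_union_left⟩
  · intro s hs v hv
    rw [linForm_apply]
    exact hpos v (mem_of_mem_face hK hs hv)
  · rintro _ ⟨s, hs, rfl⟩ v hv
    obtain ⟨u, hu, rfl⟩ := Finset.mem_map.1 hv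
    have h := mem_of_mem_face hC hs hu
    rw [hullSet_cornerMesh] at h
    show linForm _ _ _ (signMap ε hε 300 u) ≤ -300
    rw [hform]
    linarith [h.2.2.2]
  · rintro _ ⟨s, hs, rfl⟩ hne
    refine hF ⟨hne, ?_⟩
    obtain ⟨-, t, ht, hst⟩ := (hfaces s).1 hs
    -- One tetrahedron `t'` accommodates all vertices of `t` that lie in the slanted face, so the
    -- filtered face is a face of the central mesh.
    obtain ⟨t', ht', htt'⟩ := List.any_eq_true.1 (List.all_eq_true.1 hmatch t ht)
    refine ⟨t', ht', fun v hv => ?_⟩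
    obtain ⟨hv, hv0⟩ := Finset.mem_filter.1 hv
    obtain ⟨u, hu, rfl⟩ := Finset.mem_map.1 hv
    replace hv0 : linForm _ _ _ (signMap ε hε 300 u) = -300 := hv0
    rw [hform] at hv0
    obtain ⟨n, hn, rfl⟩ := Mesh.mem_range_quad.1 (hst hu)
    have hsum : (cornerMesh.pt n).x + (cornerMesh.pt n).y + (cornerMesh.pt n).z = 600 := by
      have : ((cornerMesh.pt n).x + (cornerMesh.pt n).y + (cornerMesh.pt n).z : ℝ) = 600 := by
        simp only [Mesh.vertex, Pt.toE, val_int] at hv0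
        simp at hv0
        linarith
      exact_mod_cast this
    have htest := List.all_eq_true.1 htt' n hn
    simp only [hsum, decide_true, Bool.not_true, Bool.false_or, List.any_eq_true,
      Bool.and_eq_true, decide_eq_true_eq] at htest
    obtain ⟨n', hn', ⟨hx, hy⟩, hz⟩ := htest
    refine Mesh.mem_range_quad.2 ⟨n', hn', ?_⟩
    show tetraMesh.vertex n' = signMap ε hε 300 (cornerMesh.vertex n)
    ext i
    rw [signMap_apply]
    fin_cases i
    · simp [Mesh.vertex, Pt.toE, val_int, hx]
    · simp [Mesh.vertex, Pt.toE, val_int, hy]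
    · simp [Mesh.vertex, Pt.toE, val_int, hz]

lemma mem_signMap_cornerMesh (ε : Fin 3 → ℤ) (hε : ∀ i, ε i * ε i = 1) (x : E3) :
    x ∈ signMap ε hε 300 '' cornerMesh.hullSet ↔ 0 ≤ ε 0 * x 0 + 300 ∧ 0 ≤ ε 1 * x 1 + 300 ∧
      0 ≤ ε 2 * x 2 + 300 ∧ ε 0 * x 0 + ε 1 * x 1 + ε 2 * x 2 ≤ -300 := by
  rw [mem_image_signMap, hullSet_cornerMesh]
  simp only [mem_ofPred_eq, Int.cast_ofNat]
  refine and_congr_right fun _ => and_congr_right fun _ => and_congr_right fun _ => ?_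
  constructor <;> intro h <;> linarith

lemma triangulable_cube : Triangulable {x : E3 | ∀ i, |x i| ≤ 300} := by
  have hm := matchTest_eq
  simp only [Bool.and_eq_true] at hm
  obtain ⟨⟨⟨m0, m1⟩, m2⟩, m3⟩ := hm
  have h : TriangulableExtending tetraFaces tetraMesh.hullSet := by
    obtain ⟨K, hfaces, hK, hK'⟩ := tetraMesh_valid.exists_triangulation
    exact ⟨K, hK, hK', fun s hs => (hfaces s).2 hs⟩
  have ht : ∀ x ∈ tetraMesh.hullSet, -300 ≤ x 0 + x 1 + x 2 ∧ -300 ≤ x 0 - x 1 - x 2 ∧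
      -300 ≤ -x 0 + x 1 - x 2 ∧ -300 ≤ -x 0 - x 1 + x 2 := by
    rw [hullSet_tetraMesh]
    exact fun x hx => hx
  have h0 := h.union_corner (ε := ![1, 1, 1]) (by decide) m0 fun x hx => by
    obtain ⟨h0, h1, h2, h3⟩ := ht x hx
    simp; linarith
  -- The corners already attached must lie on the inner side of the next plane; this follows from
  -- the inequalities that describe them.
  have h1 := h0.union_corner (ε := ![1, -1, -1]) (by decide) m1 fun x hx => by
    rcases hx with hx | hx
    · obtain ⟨h0, h1, h2, h3⟩ := ht x hx
      simp; linarith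
    · rw [mem_signMap_cornerMesh] at hx
      simp at hx ⊢; linarith
  have h2 := h1.union_corner (ε := ![-1, 1, -1]) (by decide) m2 fun x hx => by
    rcases hx with (hx | hx) | hx
    · obtain ⟨h0, h1, h2, h3⟩ := ht x hx
      simp; linarith
    all_goals
      rw [mem_signMap_cornerMesh] at hx
      simp at hx ⊢; linarith
  have h3 := h2.union_corner (ε := ![-1, -1, 1]) (by decide) m3 fun x hx => by
    rcases hx with ((hx | hx) | hx) | hx
    · obtain ⟨h0, h1, h2, h3⟩ := ht x hx
      simp; linarith
    all_goals
      rw [mem_signMap_cornerMesh] at hx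
      simp at hx ⊢; linarith
  obtain ⟨K, hK, hK', -⟩ := h3
  refine ⟨K, ?_, hK'⟩
  convert hK using 1
  ext x
  simp only [mem_union, mem_signMap_cornerMesh, hullSet_tetraMesh, mem_ofPred_eq,
    Fin.forall_fin_succ, abs_le]
  simp
  grind

end Cube

/-! ### All five models, in any size and position. -/

section Main

lemma exists_triangulable_smul (T : PlatonicType) :
    ∃ s : ℝ, 0 < s ∧ Triangulable ((fun x : E3 => s • x) '' T.model) := by
  cases T with
  | tetrahedron => exact ⟨300, by norm_num, model_tetrahedron ▸ tetraMesh_valid.triangulable⟩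
  | cube => exact ⟨300, by norm_num, model_cube ▸ triangulable_cube⟩
  | octahedron => exact ⟨600, by norm_num, model_octahedron ▸ triangulable_octahedron⟩
  | dodecahedron =>
    exact ⟨20, by norm_num, hullSet_dodecahedronMesh ▸ dodecahedronMesh_valid.triangulable⟩
  | icosahedron =>
    refine ⟨1, one_pos, ?_⟩
    simpa [← hullSet_icosahedronMesh] using icosahedronMesh_valid.triangulable

lemma triangulable_of_isPlatonicSolid {P : Set E3} (hP : IsPlatonicSolid P) : Triangulable P := by
  obtain ⟨T, r, A, c, hr, rfl⟩ := hP
  obtain ⟨s, hs, h⟩ := exists_triangulable_smul T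
  -- The triangulated copy is already enlarged by `s`, so only the ratio `r / s` remains to be
  -- applied.
  have hrs : r / s ≠ 0 := (div_pos hr hs).ne'
  convert h.image (isSimilarity_similarity A hrs c) using 1
  rw [image_image]
  refine image_congr fun x _ => ?_
  rw [similarity_apply, map_smul, smul_smul, div_mul_cancel₀ _ hs.ne']

end Main

end AcuteTriangulation

theorem mainTheorem8 (P : Set E3) (hP : IsPlatonicSolid P) :
    ∃ K : Geometry.SimplicialComplex ℝ E3,
      IsAcuteTriangulation K P ∧ IsNontrivialTriangulation K :=
  AcuteTriangulation.triangulable_of_isPlatonicSolid hP
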